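/- Let $a_1=(\frac{\sqrt3}{2},\frac12)$, $a_2=(\frac{\sqrt3}{2},-\frac12)$, $\Gamma=\mathbb Z a_1+\mathbb Z a_2$, $b_1=(\frac1{\sqrt3},1)$, $b_2=(\frac1{\sqrt3},-1)$, $\tau=e^{2\pi i/3}$. Let $H$ be one of the following operators with real coefficients: (a) $H=-\Delta+q$ on $\mathbb R^2$, with $q$ real, bounded and measurable (for instance smooth and periodic), acting on functions that are locally in $L^2$ together with their weak derivatives of order at most two; (b) a discrete Schrödinger operator $(Hf)_v=\sum_{u\sim v}m_{v,u}(f_v-f_u)+q_vf_v$ on a locally finite graph with vertices in $\mathbb R^2$, finitely many of them in a fundamental domain of $\Gamma$, with weights $m_{v,u}=m_{u,v}>0$ on the edges and real $q_v$. Assume that $H$ commutes with the shifts by $\Gamma$, with the rotation $(R\psi)(x)=\psi(-\frac12x_1+\frac{\sqrt3}2x_2,\,-\frac{\sqrt3}2x_1-\frac12x_2)$, and with at least one of the reflection $(F\psi)(x)=\psi(-x_1,x_2)$ and the inversion $(V\psi)(x)=\psi(-x)$. For $k\in\mathbb R^2$ let $\mathcal X(k)$ be the Hilbert space, with the $L^2$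 inner product over a fundamental domain of $\Gamma$, of locally $L^2$ functions with $\psi(x+n_1a_1+n_2a_2)=e^{i(n_1k_1+n_2k_2)}\psi(x)$ for $n_1,n_2\in\mathbb Z$ (in case (b), functions on the vertices, with $\ell^2$), and let $H(k)$ be the restriction of $H$ to $\mathcal X(k)$. Let $k^*=(\frac{2\pi}3,-\frac{2\pi}3)$ and $k_0\in\{k^*,-k^*,0\}$. For $j=0,1,2$ let $Q_j$ be the part of $H(k_0)$ in $\mathcal X_j=\{\psi\in\mathcal X(k_0):R\psi=\tau^{-j}\psi\}$. Then: 1. $\mathcal X(k_0)=\mathcal X_0\oplus\mathcal X_1\oplus\mathcal X_2$ orthogonally, the operators $Q_0,Q_1,Q_2$ are self-adjoint, and $H(k_0)=Q_0\oplus Q_1\oplus Q_2$ (domains included). 2. $Q_1$ and $Q_2$ are isospectral: they have the same spectrum and the same eigenvalues with the same multiplicities. Therefore every eigenvalue of $Q_1$ is an eigenvalue of $H(k_0)$ of multiplicity at least $2$; and $Q_1$ has an eigenvalue, always in case (a), and in case (b) provided that $\mathcal X_1\ne\{0\}$. 3. Let $\lambda_0$ be an eigenvalue of $H(k_0)$ of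 multiplicity exactly $2$. Then there is $\alpha\in\mathbb C$ such that the dispersion relation near $(k_0,\lambda_0)$, in the coordinates $\kappa=k_1b_1+k_2b_2$, is given by $$(\lambda-\lambda_0)^2=|\alpha|^2|\kappa-\kappa_0|^2+o(|\kappa-\kappa_0|^2).$$ That is, for $k$ near $k_0$ the spectrum of $H(k)$ near $\lambda_0$ consists of two eigenvalues $\lambda_-(k)\le\lambda_+(k)$, counted with multiplicity; both satisfy this equation, and more precisely $\lambda_\pm(k)-\lambda_0=\pm|\alpha||\kappa-\kappa_0|+o(|\kappa-\kappa_0|)$ as $k\to k_0$. 4. At $k_0=0$ the coefficient $\alpha$ in 3 is zero. -/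

import Mathlib

open MeasureTheory Filter Topology
open scoped ContDiff

noncomputable section

namespace Hexagonal

/-! ## Unbounded operators on a Hilbert space -/

section Operators

variable {E F : Type*} [NormedAddCommGroup E] [InnerProductSpace ℂ E]
  [NormedAddCommGroup F] [InnerProductSpace ℂ F]

/-- `A` is self-adjoint: it is densely defined and its graph is the graph of its adjoint. -/
def SelfAdj (A : E →ₗ.[ℂ] E) : Prop :=
  Dense (A.domain : Set E) ∧ A.graph.adjoint = A.graph

/-- On a complete space this is Mathlib's notion of a self-adjoint partially defined operator. -/
theorem selfAdj_iff [CompleteSpace E] (A : E →ₗ.[ℂ] E) : SelfAdj A ↔ IsSelfAdjoint A := by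
  constructor
  · rintro ⟨hd, h⟩
    exact LinearPMap.eq_of_eq_graph (by rw [← h]; exact LinearPMap.adjoint_graph_eq_graph_adjoint hd)
  · intro h
    refine ⟨h.dense_domain, ?_⟩
    rw [← LinearPMap.adjoint_graph_eq_graph_adjoint h.dense_domain]
    exact congrArg LinearPMap.graph h

/-- The eigenspace `ker (A - z)`. -/
def eigenspace (A : E →ₗ.[ℂ] E) (z : ℂ) : Submodule ℂ E :=
  A.graph.comap (LinearMap.prod LinearMap.id (z • LinearMap.id))

/-- The (geometric) multiplicity of `z` as an eigenvalue of `A`. -/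
def multiplicity (A : E →ₗ.[ℂ] E) (z : ℂ) : ℕ := Module.finrank ℂ (eigenspace A z)

/-- The spectrum of `A`: the `z` for which `A - z` has no everywhere defined bounded inverse `S`.
(`S h = f` has to mean that `f` is in the domain of `A` and `A f = h + z f`.) -/
def spec (A : E →ₗ.[ℂ] E) : Set ℂ :=
  {z | ¬ ∃ S : E →L[ℂ] E, ∀ f h : E, S h = f ↔ (f, h + z • f) ∈ A.graph}

/-- Same spectrum, and the same multiplicity of every eigenvalue. -/
def Isospectral {E F : Type} [NormedAddCommGroup E] [InnerProductSpace ℂ E]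
    [NormedAddCommGroup F] [InnerProductSpace ℂ F] (A : E →ₗ.[ℂ] E) (B : F →ₗ.[ℂ] F) : Prop :=
  spec A = spec B ∧
    ∀ z : ℂ, Module.rank ℂ (eigenspace A z) = Module.rank ℂ (eigenspace B z)

/-- The part of the operator with graph `g` in the subspace `K`. -/
def partIn (g : Submodule ℂ (E × E)) (K : Submodule ℂ E) : K →ₗ.[ℂ] K :=
  (g.comap (K.subtype.prodMap K.subtype)).toLinearPMap

/-- `A` is the orthogonal direct sum of the operators `Q j`, which act in the subspaces `K j`:
the space is the orthogonal sum of the `K j`, and `∑ f j` is in the domain of `A`, with image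
`∑ g j`, exactly if every `f j` is in the domain of `Q j`, with image `g j`. -/
def IsOrthogonalSum {ι : Type*} [Fintype ι] (A : E →ₗ.[ℂ] E) (K : ι → Submodule ℂ E)
    (Q : ∀ j, K j →ₗ.[ℂ] K j) : Prop :=
  (∀ i j, i ≠ j → K i ⟂ K j) ∧ (⨆ j, K j) = ⊤ ∧
    ∀ f g : ∀ j, K j,
      ((∑ j, (f j : E), ∑ j, (g j : E)) ∈ A.graph ↔ ∀ j, (f j, g j) ∈ (Q j).graph)

end Operators

/-! ## The lattice, its symmetries and the dual coordinates -/

abbrev Plane : Type := EuclideanSpace ℝ (Fin 2)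

def a₁ : Plane := !₂[√3 / 2, 1 / 2]
def a₂ : Plane := !₂[√3 / 2, -1 / 2]

/-- The dual basis. -/
def b₁ : Plane := !₂[1 / √3, 1]
def b₂ : Plane := !₂[1 / √3, -1]

/-- A fundamental domain of the lattice `Γ = ℤ a₁ + ℤ a₂`: the points `s a₁ + t a₂` with
`0 ≤ s, t < 1`. -/
def cell : Set Plane :=
  {x | inner ℝ b₁ x ∈ Set.Ico (0 : ℝ) 1 ∧ inner ℝ b₂ x ∈ Set.Ico (0 : ℝ) 1}

/-- The shift by `m a₁ + n a₂`. -/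
def shift (m n : ℤ) (x : Plane) : Plane := x + ((m : ℝ) • a₁ + (n : ℝ) • a₂)

/-- The point map behind the rotation operator `(R ψ) x = ψ (rot x)`, which turns functions
counter-clockwise by `2π/3`. -/
def rot (x : Plane) : Plane :=
  !₂[-(1 / 2) * x 0 + √3 / 2 * x 1, -(√3 / 2) * x 0 - 1 / 2 * x 1]

/-- The point map of the horizontal reflection `F`. -/
def reflect (x : Plane) : Plane := !₂[-x 0, x 1]

/-- The point map of the inversion `V`. -/
def invert (x : Plane) : Plane := -x

/-- The Cartesian coordinates `κ = k₁ b₁ + k₂ b₂` of the quasimomentum `k`. -/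
def kappa (k : Fin 2 → ℝ) : Plane := k 0 • b₁ + k 1 • b₂

def kStar : Fin 2 → ℝ := ![2 * Real.pi / 3, -(2 * Real.pi / 3)]

def tau : ℂ := Complex.exp (2 * Real.pi * Complex.I / 3)

/-! ## Operators on functions on the plane or on a discrete subset, and their Bloch reduction -/

/-- An operator acting on (locally square integrable) functions with respect to a measure `μ` on
the plane: Lebesgue measure for differential operators, the counting measure on the set of
vertices for discrete ones. The operator is given by the pairs `(ψ, Hψ)`. -/
structure PlaneOperator where
  μ : Measure Plane
  rel : Submodule ℂ ((Plane → ℂ) × (Plane → ℂ))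

/-- `ψ` is locally in `L²`. -/
def LocL2 (μ : Measure Plane) (ψ : Plane → ℂ) : Prop :=
  ∀ C : Set Plane, IsCompact C → MemLp ψ 2 (μ.restrict C)

theorem LocL2.zero {μ : Measure Plane} : LocL2 μ 0 := fun _ _ => MemLp.zero

theorem LocL2.add {μ : Measure Plane} {ψ φ : Plane → ℂ} (h : LocL2 μ ψ) (h' : LocL2 μ φ) :
    LocL2 μ (ψ + φ) := fun C hC => (h C hC).add (h' C hC)

theorem LocL2.smul {μ : Measure Plane} {ψ : Plane → ℂ} (c : ℂ) (h : LocL2 μ ψ) :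
    LocL2 μ (c • ψ) := fun C hC => (h C hC).const_smul c

/-- The space `𝓧(k)` of Bloch functions: locally `L²` functions with
`ψ (x + m a₁ + n a₂) = exp (i (m k₁ + n k₂)) ψ x`. -/
def blochSpace (μ : Measure Plane) (k : Fin 2 → ℝ) : Submodule ℂ (Plane → ℂ) where
  carrier := {ψ | LocL2 μ ψ ∧ ∀ m n : ℤ, ∀ᵐ x ∂μ,
    ψ (shift m n x) = Complex.exp (Complex.I * (m * k 0 + n * k 1)) * ψ x}
  zero_mem' := ⟨LocL2.zero, fun m n => by simp⟩
  add_mem' := by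
    rintro ψ φ ⟨h1, h2⟩ ⟨h3, h4⟩
    refine ⟨h1.add h3, fun m n => ?_⟩
    filter_upwards [h2 m n, h4 m n] with x hx hy
    simp only [Pi.add_apply, hx, hy]; ring
  smul_mem' := by
    rintro c ψ ⟨h1, h2⟩
    refine ⟨h1.smul c, fun m n => ?_⟩
    filter_upwards [h2 m n] with x hx
    simp only [Pi.smul_apply, smul_eq_mul, hx]; ring

namespace PlaneOperator

variable (H : PlaneOperator)

/-- `H` is invariant under the point map `T`, that is, `H` commutes with `ψ ↦ ψ ∘ T`. -/
def Invariant (T : Plane → Plane) : Prop :=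
  ∀ ψ η : Plane → ℂ, (ψ, η) ∈ H.rel → (ψ ∘ T, η ∘ T) ∈ H.rel

/-- `L²` of the fundamental domain. Restriction to it identifies `𝓧(k)`, for every `k`,
with this Hilbert space. -/
abbrev CellSpace : Type := Lp ℂ 2 (H.μ.restrict cell)

/-- The graph of `H(k)`: restrictions to the fundamental domain of the pairs `(ψ, Hψ)`, where `ψ`
is in `𝓧(k)` and in the domain of `H`. (For `Γ`-invariant `H`, also `Hψ` is then in `𝓧(k)`.) -/
def floquetGraph (k : Fin 2 → ℝ) : Submodule ℂ (H.CellSpace × H.CellSpace) where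
  carrier := {p | ∃ ψ η : Plane → ℂ, ψ ∈ blochSpace H.μ k ∧ (ψ, η) ∈ H.rel ∧
    ψ =ᵐ[H.μ.restrict cell] p.1 ∧ η =ᵐ[H.μ.restrict cell] p.2}
  zero_mem' := ⟨0, 0, Submodule.zero_mem _, Submodule.zero_mem _,
    (Lp.coeFn_zero _ _ _).symm, (Lp.coeFn_zero _ _ _).symm⟩
  add_mem' := by
    rintro p p' ⟨ψ, η, h1, h2, h3, h4⟩ ⟨ψ', η', h1', h2', h3', h4'⟩
    exact ⟨ψ + ψ', η + η', Submodule.add_mem _ h1 h1', Submodule.add_mem _ h2 h2',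
      (h3.add h3').trans (Lp.coeFn_add _ _).symm, (h4.add h4').trans (Lp.coeFn_add _ _).symm⟩
  smul_mem' := by
    rintro c p ⟨ψ, η, h1, h2, h3, h4⟩
    exact ⟨c • ψ, c • η, Submodule.smul_mem _ c h1, Submodule.smul_mem _ c h2,
      (h3.const_smul c).trans (Lp.coeFn_smul _ _).symm,
      (h4.const_smul c).trans (Lp.coeFn_smul _ _).symm⟩

/-- The operator `H(k)`: the restriction of `H` to the Bloch functions of quasimomentum `k`.
(`toLinearPMap` is the operator with the given graph, which is single-valued for `Γ`-invariant
Schrödinger operators: a Bloch function is determined by its restriction to the cell.) -/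
def floquet (k : Fin 2 → ℝ) : H.CellSpace →ₗ.[ℂ] H.CellSpace := (H.floquetGraph k).toLinearPMap

/-- The `j`-th isotypic component of `𝓧(k)` for the rotations: Bloch functions with
`R ψ = τ⁻ʲ ψ`. -/
def isotypic (k : Fin 2 → ℝ) (j : Fin 3) : Submodule ℂ H.CellSpace where
  carrier := {f | ∃ ψ ∈ blochSpace H.μ k, ψ =ᵐ[H.μ.restrict cell] f ∧
    ∀ᵐ x ∂H.μ, ψ (rot x) = (tau⁻¹) ^ (j : ℕ) * ψ x}
  zero_mem' := ⟨0, Submodule.zero_mem _, (Lp.coeFn_zero _ _ _).symm, by simp⟩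
  add_mem' := by
    rintro f f' ⟨ψ, h1, h2, h3⟩ ⟨ψ', h1', h2', h3'⟩
    refine ⟨ψ + ψ', Submodule.add_mem _ h1 h1', (h2.add h2').trans (Lp.coeFn_add _ _).symm, ?_⟩
    filter_upwards [h3, h3'] with x hx hy
    simp only [Pi.add_apply, hx, hy]; ring
  smul_mem' := by
    rintro c f ⟨ψ, h1, h2, h3⟩
    refine ⟨c • ψ, Submodule.smul_mem _ c h1, (h2.const_smul c).trans (Lp.coeFn_smul _ _).symm, ?_⟩
    filter_upwards [h3] with x hx
    simp only [Pi.smul_apply, smul_eq_mul, hx]; ring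

/-- The operator `Q j`: the part of `H(k)` in the `j`-th isotypic component. -/
def Q (k : Fin 2 → ℝ) (j : Fin 3) : H.isotypic k j →ₗ.[ℂ] H.isotypic k j :=
  partIn (H.floquetGraph k) (H.isotypic k j)

/-- Near `(k₀, E₀)` the dispersion relation consists of two branches, `lm ≤ lp`, which give all
the spectrum of `H(k)` near `E₀` with multiplicities. -/
def IsLocalDispersion (k₀ : Fin 2 → ℝ) (E₀ : ℝ) (lm lp : (Fin 2 → ℝ) → ℝ) : Prop :=
  ∃ δ > 0, ∀ᶠ k in 𝓝 k₀, lm k ≤ lp k ∧ |lm k - E₀| < δ ∧ |lp k - E₀| < δ ∧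
    ∀ z : ℂ, ‖z - E₀‖ < δ →
      (z ∈ spec (H.floquet k) ↔ z = lm k ∨ z = lp k) ∧
      multiplicity (H.floquet k) z = (if z = lm k then 1 else 0) + (if z = lp k then 1 else 0)

end PlaneOperator

/-! ## Schrödinger operators on the plane -/

/-- `g` is the weak partial derivative `∂ᵢ f`. -/
def IsWeakPartial (i : Fin 2) (f g : Plane → ℂ) : Prop :=
  ∀ φ : Plane → ℝ, ContDiff ℝ ∞ φ → HasCompactSupport φ →
    ∫ x, fderiv ℝ φ x (EuclideanSpace.single i 1) • f x = -∫ x, φ x • g x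

theorem integrable_smul_of_locL2 {f : Plane → ℂ} (hf : LocL2 volume f) {φ : Plane → ℝ}
    (hφ : Continuous φ) (hc : HasCompactSupport φ) : Integrable (fun x => φ x • f x) := by
  have hl : LocallyIntegrable f := by
    rw [MeasureTheory.locallyIntegrable_iff]
    intro C hC
    have : IsFiniteMeasure (volume.restrict C) := ⟨by simpa using hC.measure_lt_top⟩
    exact (hf C hC).integrable (by norm_num)
  exact hl.integrable_smul_left_of_hasCompactSupport hφ hc

theorem integrable_fderiv_smul {f : Plane → ℂ} (hf : LocL2 volume f) {φ : Plane → ℝ}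
    (hφ : ContDiff ℝ ∞ φ) (hc : HasCompactSupport φ) (v : Plane) :
    Integrable (fun x => fderiv ℝ φ x v • f x) := by
  refine integrable_smul_of_locL2 (φ := fun x => fderiv ℝ φ x v) hf ?_ ?_
  · exact (hφ.continuous_fderiv (by simp)).clm_apply continuous_const
  · exact hc.fderiv_apply (𝕜 := ℝ) v

theorem IsWeakPartial.add {i : Fin 2} {f g f' g' : Plane → ℂ} (hf : LocL2 volume f)
    (hg : LocL2 volume g) (hf' : LocL2 volume f') (hg' : LocL2 volume g')
    (h : IsWeakPartial i f g) (h' : IsWeakPartial i f' g') :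
    IsWeakPartial i (f + f') (g + g') := by
  intro φ hφ hc
  simp only [Pi.add_apply, smul_add]
  rw [integral_add (integrable_fderiv_smul hf hφ hc _) (integrable_fderiv_smul hf' hφ hc _),
    integral_add (integrable_smul_of_locL2 hg hφ.continuous hc)
      (integrable_smul_of_locL2 hg' hφ.continuous hc), h φ hφ hc, h' φ hφ hc]
  ring

theorem IsWeakPartial.smul {i : Fin 2} {f g : Plane → ℂ} (c : ℂ) (h : IsWeakPartial i f g) :
    IsWeakPartial i (c • f) (c • g) := by
  intro φ hφ hc
  simp only [Pi.smul_apply, smul_comm _ c]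
  rw [integral_smul, integral_smul, h φ hφ hc, smul_neg]

/-- The Schrödinger operator `-Δ + q` on functions that are locally in `L²` together with their
weak derivatives up to the second order; `g i` is `∂ᵢ ψ`, and `h i j` is `∂ⱼ ∂ᵢ ψ`. -/
def schrodinger (q : Plane → ℝ) : PlaneOperator where
  μ := volume
  rel :=
    { carrier := {p | ∃ (g : Fin 2 → Plane → ℂ) (h : Fin 2 → Fin 2 → Plane → ℂ),
        LocL2 volume p.1 ∧ (∀ i, LocL2 volume (g i)) ∧ (∀ i j, LocL2 volume (h i j)) ∧
        (∀ i, IsWeakPartial i p.1 (g i)) ∧ (∀ i j, IsWeakPartial j (g i) (h i j)) ∧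
        p.2 =ᵐ[volume] fun x => -(h 0 0 x + h 1 1 x) + (q x : ℂ) * p.1 x}
      zero_mem' := ⟨0, 0, LocL2.zero, fun _ => LocL2.zero, fun _ _ => LocL2.zero,
        fun i φ _ _ => by simp, fun i j φ _ _ => by simp, by
          filter_upwards with x
          simp⟩
      add_mem' := by
        rintro ⟨ψ, η⟩ ⟨ψ', η'⟩ ⟨g, h, h1, h2, h3, h4, h5, h6⟩ ⟨g', h', h1', h2', h3', h4', h5', h6'⟩
        refine ⟨g + g', h + h', h1.add h1', fun i => (h2 i).add (h2' i),
          fun i j => (h3 i j).add (h3' i j), fun i => (h4 i).add h1 (h2 i) h1' (h2' i) (h4' i),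
          fun i j => (h5 i j).add (h2 i) (h3 i j) (h2' i) (h3' i j) (h5' i j), ?_⟩
        filter_upwards [h6, h6'] with x hx hy
        simp only [Prod.mk_add_mk, Pi.add_apply] at hx hy ⊢
        rw [hx, hy]; ring
      smul_mem' := by
        rintro c ⟨ψ, η⟩ ⟨g, h, h1, h2, h3, h4, h5, h6⟩
        refine ⟨c • g, c • h, h1.smul c, fun i => (h2 i).smul c, fun i j => (h3 i j).smul c,
          fun i => (h4 i).smul c, fun i j => (h5 i j).smul c, ?_⟩
        filter_upwards [h6] with x hx
        simp only [Prod.smul_mk, Pi.smul_apply, smul_eq_mul] at hx ⊢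
        rw [hx]; ring }

/-! ## Discrete Schrödinger operators -/

/-- A weighted graph embedded in the plane, with a real potential; only finitely many vertices lie
in the fundamental domain. -/
structure EmbeddedGraph where
  vertices : Set Plane
  graph : SimpleGraph vertices
  weight : vertices → vertices → ℝ
  potential : vertices → ℝ
  weight_pos : ∀ v u, graph.Adj v u → 0 < weight v u
  weight_symm : ∀ v u, weight v u = weight u v
  locally_finite : ∀ v, (graph.neighborSet v).Finite
  finite_cell : (vertices ∩ cell).Finite

/-- The operator `(H f)_v = ∑_{u ~ v} m_{v,u} (f_v - f_u) + q_v f_v`. -/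
def discreteSchrodinger (G : EmbeddedGraph) : PlaneOperator where
  μ := Measure.count.restrict G.vertices
  rel :=
    { carrier := {p | ∀ v : G.vertices, p.2 v =
        ∑ u ∈ (G.locally_finite v).toFinset, (G.weight v u : ℂ) * (p.1 v - p.1 u) +
          (G.potential v : ℂ) * p.1 v}
      zero_mem' := by intro v; simp
      add_mem' := by
        rintro ⟨ψ, η⟩ ⟨ψ', η'⟩ h h' v
        have e : ∀ u : G.vertices, (G.weight v u : ℂ) * ((ψ v + ψ' v) - (ψ u + ψ' u)) =
          (G.weight v u : ℂ) * (ψ v - ψ u) + (G.weight v u : ℂ) * (ψ' v - ψ' u) :=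
          fun u => by ring
        have := h v
        have := h' v
        simp only [Prod.mk_add_mk, Pi.add_apply, e, Finset.sum_add_distrib] at *
        simp only [*]; ring
      smul_mem' := by
        rintro c ⟨ψ, η⟩ h v
        have e : ∀ u : G.vertices, (G.weight v u : ℂ) * (c * ψ v - c * ψ u) =
          c * ((G.weight v u : ℂ) * (ψ v - ψ u)) := fun u => by ring
        have := h v
        simp only [Prod.smul_mk, Pi.smul_apply, smul_eq_mul, e, ← Finset.mul_sum] at *
        simp only [*]; ring }

/-- The operators with real coefficients that are considered: `-Δ + q` with a bounded real
potential, and discrete Schrödinger operators on graphs. -/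
inductive IsRealSchrodinger : PlaneOperator → Prop
  | continuous (q : Plane → ℝ) (hq : Measurable q) (hb : ∃ C, ∀ x, |q x| ≤ C) :
      IsRealSchrodinger (schrodinger q)
  | discrete (G : EmbeddedGraph) : IsRealSchrodinger (discreteSchrodinger G)

end Hexagonal

end

/-! Everything is read off from one family of bounded operators. Restriction to the cell identifies
all Bloch spaces with one Hilbert space. After the plane wave `exp (i δ·x)` with `δ = κ - κ₀` is
split off, `H(k)` becomes `exp (-i δ·x) H exp (i δ·x)` on the Bloch functions of quasimomentum `k₀`.
Near `δ = 0` the resolvent `S δ` of this operator at a real point `-c` is compact, symmetric and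
differentiable at `0`, with a derivative `L` (`IsResolventFamily`). An eigenvalue `z` of `H(k)`
corresponds to the eigenvalue `1 / (z + c)` of `S δ` with the same multiplicity, and there is no
other spectrum. For a graph, `S δ` comes from a finite matrix
(`EmbeddedGraph.exists_isResolventFamily`). For `-Δ + q` the Fourier series diagonalises the
Laplacian with eigenvalues `‖p + δ‖²`; relative to `‖p‖² + c`, the change `2 δ·p + ‖δ‖²` is a
bounded operator polynomial in `δ` (`schrodinger_isResolventFamily`).

Symmetry decomposition. The quasimomenta `k₀` are those for which the rotation acts on the Bloch
space. It is a unitary operator of order three that commutes with `S 0`, so its three eigenspaces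
reduce the operator. The reflection inverts the rotation, hence exchanges the eigenvalues `τ⁻¹` and
`τ⁻²`. The inversion sends `k₀` to `-k₀` and has to be followed by complex conjugation; the
resulting antilinear map commutes with the rotation and therefore also exchanges these two
eigenvalues. In both cases there is an (anti)unitary involution that commutes with `S 0` and
identifies `Q₁` with `Q₂` (`IsExchange`); an eigenvector of `Q₁` and its image are orthogonal. For
`-Δ + q` the component of `τ⁻¹` is not zero, because otherwise the rotation would fix every plane
wave.

Cone. At a double eigenvalue, first order perturbation theory is governed by the compression of `L
δ` to the eigenspace, a Hermitian 2 × 2 matrix that is linear in `δ`. The rotation conjugates the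
matrix at `δ` into the one at the rotated `δ`. Its trace is therefore an invariant linear form,
which vanishes since `1 + r + r² = 0` for the rotation `r` by a third of a turn. Minus its
determinant is an invariant nonnegative quadratic form, hence of the form `a² ‖δ‖²`
(`exists_coefficient`). So both eigenvalue shifts have squares close to `a² ‖δ‖²` and their sum is
of smaller order (`eigenvalue_pair_estimate`), which yields the branches `± a ‖δ‖`
(`exists_branches`). Passing back from `1 / (z + c)` to `z` multiplies the slope by `-(E₀ + c)²`.

Origin. For `k₀ = 0`, complex conjugation preserves the Bloch space and reverses `δ`, hence
anticommutes with `L δ`. In a real basis of the eigenspace the Hermitian matrix is then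
antisymmetric, and its single free entry is `i` times a real linear form in two variables. This form
has a nontrivial zero, so `a = 0` (`coefficient_eq_zero`). -/

open MeasureTheory Filter Topology
open scoped ContDiff

noncomputable section

namespace Hexagonal

/-! ### Unbounded operators given through a resolvent at a real point -/

section Resolvent

variable {E : Type*} [NormedAddCommGroup E] [InnerProductSpace ℂ E]

/-- `S` is the resolvent of the operator with graph `g` at the point `-c`. -/
def IsResolvent (g : Submodule ℂ (E × E)) (c : ℝ) (S : E →L[ℂ] E) : Prop :=
  ∀ f h : E, (f, h) ∈ g ↔ f = S (h + (c : ℂ) • f)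

theorem mem_eigenspace_iff {A : E →ₗ.[ℂ] E} {z : ℂ} {f : E} :
    f ∈ eigenspace A z ↔ (f, z • f) ∈ A.graph := Iff.rfl

theorem IsResolvent.mem_eigenspace {A : E →ₗ.[ℂ] E} {c : ℝ} {S : E →L[ℂ] E}
    (h : IsResolvent A.graph c S) {z : ℂ} {f : E} :
    f ∈ eigenspace A z ↔ f = (z + c) • S f := by
  rw [mem_eigenspace_iff, h, ← add_smul, map_smul]

theorem IsResolvent.mem_iff {g : Submodule ℂ (E × E)} {c : ℝ} {S : E →L[ℂ] E}
    (h : IsResolvent g c S) (f u : E) : f = S u ↔ (f, u - (c : ℂ) • f) ∈ g := by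
  rw [h, sub_add_cancel]

/-- A vector killed by `S` would be a value of the single-valued operator at `0`. -/
theorem IsResolvent.injective {A : E →ₗ.[ℂ] E} {c : ℝ} {S : E →L[ℂ] E}
    (h : IsResolvent A.graph c S) {u : E} (hu : S u = 0) : u = 0 := by
  have := (h.mem_iff 0 u).1 hu.symm
  exact A.graph_fst_eq_zero_snd (by simpa using this) rfl

/-- Symmetry of `S` is enough. A vector `u` orthogonal to the domain is orthogonal to `S (S u)`, so
`S u = 0`, and `u = 0` by injectivity. The pairs `(S v, v - c S v)` belong to the graph; testing the
adjoint relation on them gives exactly the resolvent equation. -/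
theorem IsResolvent.selfAdj [CompleteSpace E] {A : E →ₗ.[ℂ] E} {c : ℝ} {S : E →L[ℂ] E}
    (h : IsResolvent A.graph c S) (hS : (S : E →ₗ[ℂ] E).IsSymmetric) : SelfAdj A := by
  have hS' : ∀ x y, inner ℂ (S x) y = inner ℂ x (S y) := hS
  refine ⟨?_, ?_⟩
  · rw [Submodule.dense_iff_topologicalClosure_eq_top,
      Submodule.topologicalClosure_eq_top_iff, Submodule.eq_bot_iff]
    intro u hu
    rw [Submodule.mem_orthogonal] at hu
    refine h.injective ?_
    have hm : S (S u) ∈ A.domain :=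
      LinearPMap.mem_domain_of_mem_graph ((h.mem_iff (S (S u)) (S u)).1 rfl)
    have := hu _ hm
    rw [hS'] at this
    exact inner_self_eq_zero.1 this
  · ext ⟨x, y⟩
    rw [Submodule.mem_adjoint_iff, h]
    constructor
    · intro hxy
      refine ext_inner_left ℂ fun v => ?_
      have := hxy (S v) (v - (c : ℂ) • S v) ((h.mem_iff _ _).1 rfl)
      simp only [inner_sub_left, inner_smul_left, Complex.conj_ofReal, hS'] at this
      rw [map_add, map_smul, inner_add_right, inner_smul_right]
      linear_combination this
    · intro hx a b hab
      rw [h] at hab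
      have e1 : inner ℂ (b + (c : ℂ) • a) x = inner ℂ a (y + (c : ℂ) • x) := by
        conv_lhs => rw [hx, ← hS', ← hab]
      simp only [inner_add_left, inner_add_right, inner_smul_left, inner_smul_right,
        Complex.conj_ofReal] at e1 ⊢
      linear_combination e1

theorem IsResolvent.finiteDimensional_eigenspace [CompleteSpace E] {A : E →ₗ.[ℂ] E} {c : ℝ}
    {S : E →L[ℂ] E} (h : IsResolvent A.graph c S) (hc : IsCompactOperator S) (z : ℂ) :
    FiniteDimensional ℂ (eigenspace A z) := by
  by_cases hz : z + c = 0
  · have : eigenspace A z = ⊥ := by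
      rw [Submodule.eq_bot_iff]
      intro f hf
      rw [h.mem_eigenspace, hz, zero_smul] at hf
      exact hf
    rw [this]; infer_instance
  · have := ContinuousLinearMap.finite_dimensional_eigenspace hc (z + c)⁻¹ (inv_ne_zero hz)
    have e : eigenspace A z = Module.End.eigenspace S.toLinearMap (z + c)⁻¹ := by
      ext f
      rw [h.mem_eigenspace, Module.End.mem_eigenspace_iff]
      constructor
      · intro hf
        conv_rhs => rw [hf]
        simp [hz]
      · intro hf
        have hf' : S f = (z + c)⁻¹ • f := hf
        rw [hf', smul_smul, mul_inv_cancel₀ hz, one_smul]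
    rw [e]; exact this

/-- The inverse of `A - z` is `(1 - (z + c) S)⁻¹ S`, so it exists once `1 - (z + c) S` is
invertible. For compact `S` the only obstruction is the eigenvalue `(z + c)⁻¹`, by the Fredholm
alternative. -/
theorem IsResolvent.mem_spec_iff [CompleteSpace E] {A : E →ₗ.[ℂ] E} {c : ℝ}
    {S : E →L[ℂ] E} (h : IsResolvent A.graph c S) (hc : IsCompactOperator S) (z : ℂ) :
    z ∈ spec A ↔ eigenspace A z ≠ ⊥ := by
  constructor
  · contrapose
    intro hb
    rw [spec, Set.mem_ofPred_eq, not_not]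
    have hu : IsUnit (1 - (z + c) • S) := by
      by_cases hz : z + c = 0
      · simp [hz]
      · have hnot : ¬ Module.End.HasEigenvalue (S : Module.End ℂ E) (z + c)⁻¹ := by
          intro he
          obtain ⟨v, hv⟩ := he.exists_hasEigenvector
          have hv1 : S v = (z + c)⁻¹ • v := hv.apply_eq_smul
          have : v ∈ eigenspace A z := by
            rw [h.mem_eigenspace, hv1, smul_smul, mul_inv_cancel₀ hz, one_smul]
          rw [hb] at this
          exact hv.2 ((Submodule.mem_bot ℂ).1 this)
        have := (hc.hasEigenvalue_or_mem_resolventSet (inv_ne_zero hz)).resolve_left hnot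
        rw [spectrum.mem_resolventSet_iff] at this
        have h2 : (1 - (z + c) • S) =
            (Units.mk0 (z + c) hz) • (algebraMap ℂ (E →L[ℂ] E) (z + c)⁻¹ - S) := by
          ext x
          simp [Units.smul_def, Algebra.algebraMap_eq_smul_one, smul_sub, smul_smul, hz]
        rw [h2]
        exact (isUnit_smul_iff (Units.mk0 (z + c) hz) _).2 this
    obtain ⟨N, hN⟩ := hu
    refine ⟨(N⁻¹ : (E →L[ℂ] E)ˣ) * S, fun f u => ?_⟩
    rw [h]
    have key : f = S (u + z • f + (c : ℂ) • f) ↔ (N : E →L[ℂ] E) f = S u := by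
      have hNf : (N : E →L[ℂ] E) f = f - (z • S f + (c : ℂ) • S f) := by
        rw [hN, ← add_smul]; rfl
      rw [hNf, sub_eq_iff_eq_add]
      simp only [map_add, map_smul, add_assoc]
    rw [key]
    have e1 : ∀ x, (N⁻¹ : (E →L[ℂ] E)ˣ).1 (N.1 x) = x := fun x =>
      congrArg (fun B : E →L[ℂ] E => B x) N.inv_mul
    have e2 : ∀ x, N.1 ((N⁻¹ : (E →L[ℂ] E)ˣ).1 x) = x := fun x =>
      congrArg (fun B : E →L[ℂ] E => B x) N.mul_inv
    constructor
    · rintro rfl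
      exact e2 _
    · intro e
      change (N⁻¹ : (E →L[ℂ] E)ˣ).1 (S u) = f
      rw [← e, e1]
  · rintro hne ⟨B, hB⟩
    apply hne
    rw [Submodule.eq_bot_iff]
    intro f hf
    rw [mem_eigenspace_iff] at hf
    have := (hB f 0).2 (by simpa using hf)
    simpa using this.symm

/-- A nonzero space carries an eigenvector of an operator with compact resolvent. -/
theorem IsResolvent.exists_eigenvalue [CompleteSpace E] [Nontrivial E] {A : E →ₗ.[ℂ] E} {c : ℝ}
    {S : E →L[ℂ] E} (h : IsResolvent A.graph c S) (hc : IsCompactOperator S)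
    (hS : (S : E →ₗ[ℂ] E).IsSymmetric) : ∃ x : ℝ, eigenspace A x ≠ ⊥ := by
  have h1 := ContinuousLinearMap.eq_zero_of_forall_hasEigenvalue_eq_zero hc hS
  have h2 : S ≠ 0 := by
    rintro rfl
    obtain ⟨v, hv⟩ := exists_ne (0 : E)
    exact hv (h.injective rfl)
  rw [← not_iff_not] at h1
  obtain ⟨μ, hμ, hμ0⟩ : ∃ μ, Module.End.HasEigenvalue (S : Module.End ℂ E) μ ∧ μ ≠ 0 := by
    simpa using h1.2 h2
  have hreal : (μ.re : ℂ) = μ := Complex.conj_eq_iff_re.1 (hS.conj_eigenvalue_eq_self hμ)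
  obtain ⟨v, hv⟩ := hμ.exists_hasEigenvector
  refine ⟨μ.re⁻¹ - c, fun hb => hv.2 ?_⟩
  rw [← Submodule.mem_bot ℂ, ← hb, h.mem_eigenspace]
  have hv1 : S v = μ • v := hv.apply_eq_smul
  rw [hv1, smul_smul]
  push_cast
  rw [hreal, sub_add_cancel, inv_mul_cancel₀ hμ0, one_smul]

theorem IsResolvent.eigenvalue_real {A : E →ₗ.[ℂ] E} {c : ℝ}
    {S : E →L[ℂ] E} (h : IsResolvent A.graph c S) (hS : (S : E →ₗ[ℂ] E).IsSymmetric) {z : ℂ}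
    (hz : eigenspace A z ≠ ⊥) : (starRingEnd ℂ) z = z := by
  obtain ⟨v, hv, hv0⟩ := Submodule.exists_mem_ne_zero_of_ne_bot hz
  rw [h.mem_eigenspace] at hv
  have hzc : z + c ≠ 0 := by
    intro h0
    rw [h0, zero_smul] at hv
    exact hv0 hv
  have h1 : Module.End.HasEigenvalue (S : Module.End ℂ E) (z + c)⁻¹ := by
    refine Module.End.hasEigenvalue_of_hasEigenvector (x := v) ⟨?_, hv0⟩
    rw [Module.End.mem_eigenspace_iff]
    conv_rhs => rw [hv]
    simp [hzc]
  have := hS.conj_eigenvalue_eq_self h1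
  rw [map_inv₀, inv_inj, map_add, Complex.conj_ofReal] at this
  exact add_right_cancel this

/-- By linearity, single-valuedness at `0` is single-valuedness, which is what `toLinearPMap` needs
in order to have the graph `g`. -/
theorem graph_toLinearPMap {g : Submodule ℂ (E × E)}
    (hs : ∀ u, (0, u) ∈ g → u = 0) : g.toLinearPMap.graph = g := by
  refine Submodule.toLinearPMap_graph_eq _ ?_
  rintro ⟨x, y⟩ hxy rfl
  exact hs y hxy

end Resolvent

/-! ### Eigenvalues of compact symmetric operators and their stability -/

section CompactPerturbation

universe u

variable {E : Type u} [NormedAddCommGroup E] [InnerProductSpace ℂ E]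

/-- A compact symmetric operator has a Hilbert basis of eigenvectors. -/
theorem exists_hilbertBasis_eigenvectors [CompleteSpace E] {T : E →L[ℂ] E} (hc : IsCompactOperator T)
    (hs : (T : E →ₗ[ℂ] E).IsSymmetric) :
    ∃ (ι : Type u) (b : HilbertBasis ι ℂ E) (ν : ι → ℝ), ∀ i, T (b i) = (ν i : ℂ) • b i := by
  let K : ℂ → Submodule ℂ E := fun μ => Module.End.eigenspace (T : E →ₗ[ℂ] E) μ
  -- The kernel can be infinite-dimensional, so completeness of the eigenspaces is taken from
  -- closedness.
  have hK : ∀ μ, IsClosed (K μ : Set E) := fun μ => by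
    have : (K μ : Set E) = {x | T x = μ • x} := by
      ext x; exact Module.End.mem_eigenspace_iff
    rw [this]
    exact isClosed_eq T.continuous (continuous_const_smul μ)
  have hKc : ∀ μ, CompleteSpace (K μ) := fun μ => (hK μ).completeSpace_coe
  choose w b hb using fun μ => exists_hilbertBasis ℂ (K μ)
  have ho : Orthonormal ℂ fun a : Σ μ, w μ => (K a.1).subtypeₗᵢ ((b a.1) a.2) :=
    hs.orthogonalFamily_eigenspaces.orthonormal_sigma_orthonormal fun μ => (b μ).orthonormal
  -- A vector orthogonal to all chosen vectors is orthogonal to every eigenspace by density, and the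
  -- spectral theorem leaves only `0`.
  have hbot : (Submodule.span ℂ (Set.range fun a : Σ μ, w μ =>
      (K a.1).subtypeₗᵢ ((b a.1) a.2)))ᗮ = ⊥ := by
    rw [Submodule.eq_bot_iff]
    intro u hu
    rw [Submodule.mem_orthogonal] at hu
    have h1 : ∀ μ, ∀ x : K μ, inner ℂ u (x : E) = 0 := by
      intro μ x
      let φ : K μ →L[ℂ] ℂ := (innerSL ℂ u).comp (K μ).subtypeL
      have h2 : φ = 0 := by
        refine ContinuousLinearMap.ext_on (s := Set.range (b μ)) ?_ ?_
        · exact Submodule.dense_iff_topologicalClosure_eq_top.2 (b μ).dense_span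
        · rintro _ ⟨i, rfl⟩
          have := hu _ (Submodule.subset_span ⟨⟨μ, i⟩, rfl⟩)
          simpa [φ] using inner_eq_zero_symm.1 this
      exact congrArg (fun ψ => ψ x) h2
    have h3 : u ∈ (⨆ μ, K μ)ᗮ := by
      rw [← Submodule.iInf_orthogonal, Submodule.mem_iInf]
      intro μ
      rw [Submodule.mem_orthogonal']
      exact fun x hx => h1 μ ⟨x, hx⟩
    have h4 := ContinuousLinearMap.orthogonalComplement_iSup_eigenspaces_eq_bot hc hs
    rw [show (⨆ μ, K μ)ᗮ = ⊥ from h4] at h3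
    exact (Submodule.mem_bot ℂ).1 h3
  have hT : ∀ a : Σ μ, w μ, T ((b a.1) a.2 : E) = a.1 • ((b a.1) a.2 : E) := fun a =>
    Module.End.mem_eigenspace_iff.1 ((b a.1) a.2).2
  refine ⟨Σ μ, w μ, HilbertBasis.mkOfOrthogonalEqBot ho hbot, fun a => a.1.re, fun a => ?_⟩
  rw [HilbertBasis.coe_mkOfOrthogonalEqBot]
  have hne : ((b a.1) a.2 : E) ≠ 0 := by
    intro h0
    have := (ho.1 a)
    simp [h0] at this
  have hreal : (a.1.re : ℂ) = a.1 := Complex.conj_eq_iff_re.1 (hs.conj_eigenvalue_eq_self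
    (Module.End.hasEigenvalue_of_hasEigenvector ⟨((b a.1) a.2).2, hne⟩))
  rw [hreal]
  exact hT a

theorem HilbertBasis.hasSum_norm_sq {ι : Type*} (b : HilbertBasis ι ℂ E) (u : E) :
    HasSum (fun i => ‖inner ℂ (b i) u‖ ^ 2) (‖u‖ ^ 2) := by
  have h := b.hasSum_inner_mul_inner u u
  have h2 := Complex.hasSum_re h
  convert h2 using 1
  · ext i
    rw [← inner_conj_symm u (b i), mul_comm, Complex.mul_conj, Complex.ofReal_re,
      Complex.normSq_eq_norm_sq]
  · exact (inner_self_eq_norm_sq (𝕜 := ℂ) u).symm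

theorem inner_eigenbasis {T : E →L[ℂ] E} (hs : (T : E →ₗ[ℂ] E).IsSymmetric) {ι : Type*}
    {b : HilbertBasis ι ℂ E} {ν : ι → ℝ} (hb : ∀ i, T (b i) = (ν i : ℂ) • b i) (i : ι) (u : E) :
    inner ℂ (b i) (T u) = ν i * inner ℂ (b i) u := by
  have := hs (b i) u
  simp only [ContinuousLinearMap.coe_coe] at this
  rw [← this, hb, inner_smul_left, Complex.conj_ofReal]

/-- A compact operator is bounded below, after subtracting `μ`, on the complement of the kernel. -/
theorem exists_gap [CompleteSpace E] {T : E →L[ℂ] E} (hc : IsCompactOperator T)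
    (hs : (T : E →ₗ[ℂ] E).IsSymmetric) {μ : ℝ} (hμ : μ ≠ 0) :
    ∃ ρ > 0, ∀ u ∈ (Module.End.eigenspace (T : E →ₗ[ℂ] E) μ)ᗮ, ρ * ‖u‖ ≤ ‖T u - (μ : ℂ) • u‖ := by
  set N := Module.End.eigenspace (T : E →ₗ[ℂ] E) (μ : ℂ) with hN
  have hinv : ∀ u ∈ Nᗮ, (T : E →ₗ[ℂ] E) u ∈ Nᗮ := by
    intro u hu
    rw [Submodule.mem_orthogonal] at hu ⊢
    intro n hn
    rw [← hs n u, Module.End.mem_eigenspace_iff.1 hn, inner_smul_left, hu n hn, mul_zero]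
  let S : Nᗮ →L[ℂ] Nᗮ := T.restrict hinv
  have hSc : IsCompactOperator S := hc.restrict' hinv
  -- An eigenvector in `Nᗮ` would also lie in `N`. For a compact operator and `μ ≠ 0`, not being an
  -- eigenvalue already gives a lower bound for `S - μ`.
  have hno : ¬ Module.End.HasEigenvalue (S : Module.End ℂ Nᗮ) (μ : ℂ) := by
    intro he
    obtain ⟨v, hv⟩ := he.exists_hasEigenvector
    have hv1 : S v = (μ : ℂ) • v := hv.apply_eq_smul
    have hv2 : T (v : E) = (μ : ℂ) • (v : E) := congrArg Subtype.val hv1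
    have hvN : (v : E) ∈ N := Module.End.mem_eigenspace_iff.2 hv2
    have := (Submodule.mem_orthogonal N _).1 v.2 _ hvN
    exact hv.2 (Subtype.ext (inner_self_eq_zero.1 this))
  obtain ⟨ρ, hρ, h⟩ := antilipschitzWith_iff_exists_mul_le_norm.1
    (hSc.antilipschitz_of_not_hasEigenvalue (by exact_mod_cast hμ) hno)
  exact ⟨ρ, hρ, fun u hu => h ⟨u, hu⟩⟩

/-- Near a double eigenvalue `μ` of a compact symmetric operator, a nearby operator has two
eigenvalues, counted with multiplicity, and no others. -/
theorem exists_two_eigenvectors [CompleteSpace E] {T₀ T : E →L[ℂ] E} (hc : IsCompactOperator T)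
    (hs : (T : E →ₗ[ℂ] E).IsSymmetric) {μ ρ : ℝ} (hρ : 0 < ρ)
    (hgap : ∀ u ∈ (Module.End.eigenspace (T₀ : E →ₗ[ℂ] E) μ)ᗮ, ρ * ‖u‖ ≤ ‖T₀ u - (μ : ℂ) • u‖)
    (h2 : Module.finrank ℂ (Module.End.eigenspace (T₀ : E →ₗ[ℂ] E) μ) = 2)
    (hT : ‖T - T₀‖ ≤ ρ / 8) :
    ∃ (x : Fin 2 → E) (ν : Fin 2 → ℝ), Orthonormal ℂ x ∧ (∀ j, T (x j) = (ν j : ℂ) • x j) ∧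
      (∀ j, |ν j - μ| < ρ / 2) ∧ ν 0 ≤ ν 1 ∧
      ∀ w : ℂ, ‖w - μ‖ < ρ / 2 →
        FiniteDimensional ℂ (Module.End.eigenspace (T : E →ₗ[ℂ] E) w) ∧
        Module.finrank ℂ (Module.End.eigenspace (T : E →ₗ[ℂ] E) w) =
          (if w = ν 0 then 1 else 0) + (if w = ν 1 then 1 else 0) := by
  obtain ⟨ι, b, ν, hb⟩ := exists_hilbertBasis_eigenvectors hc hs
  set N := Module.End.eigenspace (T₀ : E →ₗ[ℂ] E) (μ : ℂ) with hN
  have hfin : FiniteDimensional ℂ N := Module.finite_of_finrank_pos (by omega)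
  -- The window has exactly two elements by two injections: the span of its eigenvectors projects
  -- injectively to `N`, and `N` embeds into the coordinates of the window.
  let I : Set ι := {i | |ν i - μ| < ρ / 2}
  have hcoef : ∀ (i : ι) (u : E), ‖inner ℂ (b i) (T u - (μ : ℂ) • u)‖ ^ 2 =
      (ν i - μ) ^ 2 * ‖inner ℂ (b i) u‖ ^ 2 := by
    intro i u
    rw [inner_sub_right, inner_smul_right, inner_eigenbasis hs hb, ← sub_mul, norm_mul, mul_pow,
      ← Complex.ofReal_sub, Complex.norm_real, Real.norm_eq_abs, sq_abs]
  have hup : ∀ u : E, (∀ i ∉ I, inner ℂ (b i) u = 0) → ‖T u - (μ : ℂ) • u‖ ≤ ρ / 2 * ‖u‖ := by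
    intro u hu
    have h1 := HilbertBasis.hasSum_norm_sq b (T u - (μ : ℂ) • u)
    have h3 := (HilbertBasis.hasSum_norm_sq b u).mul_left ((ρ / 2) ^ 2)
    have := hasSum_le (fun i => ?_) h1 h3
    · rw [← mul_pow] at this
      exact (sq_le_sq₀ (norm_nonneg _) (by positivity)).1 this
    · rw [hcoef]
      by_cases hi : i ∈ I
      · have hi' : |ν i - μ| < ρ / 2 := hi
        have : (ν i - μ) ^ 2 ≤ (ρ / 2) ^ 2 := sq_le_sq' (by linarith [(abs_lt.1 hi').1])
          (abs_lt.1 hi').2.le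
        gcongr
      · simp [hu i hi]
  have hlow : ∀ u : E, (∀ i ∈ I, inner ℂ (b i) u = 0) → ρ / 2 * ‖u‖ ≤ ‖T u - (μ : ℂ) • u‖ := by
    intro u hu
    have h1 := HilbertBasis.hasSum_norm_sq b (T u - (μ : ℂ) • u)
    have h3 := (HilbertBasis.hasSum_norm_sq b u).mul_left ((ρ / 2) ^ 2)
    have := hasSum_le (fun i => ?_) h3 h1
    · rw [← mul_pow] at this
      exact (sq_le_sq₀ (by positivity) (norm_nonneg _)).1 this
    · rw [hcoef]
      by_cases hi : i ∈ I
      · simp [hu i hi]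
      · have : (ρ / 2) ^ 2 ≤ (ν i - μ) ^ 2 := by
          rw [← sq_abs (ν i - μ)]
          exact pow_le_pow_left₀ (by positivity) (not_lt.1 hi) 2
        gcongr
  have hdiff : ∀ u : E, ‖T₀ u - (μ : ℂ) • u‖ ≤ ‖T u - (μ : ℂ) • u‖ + ρ / 8 * ‖u‖ ∧
      ‖T u - (μ : ℂ) • u‖ ≤ ‖T₀ u - (μ : ℂ) • u‖ + ρ / 8 * ‖u‖ := by
    intro u
    have h3 : ‖(T - T₀) u‖ ≤ ρ / 8 * ‖u‖ := (T - T₀).le_of_opNorm_le hT u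
    have h4 : T u - (μ : ℂ) • u = (T₀ u - (μ : ℂ) • u) + (T - T₀) u := by
      rw [sub_apply]; abel
    have h5 : T₀ u - (μ : ℂ) • u = (T u - (μ : ℂ) • u) - (T - T₀) u := by
      rw [sub_apply]; abel
    constructor
    · rw [h5]; exact (norm_sub_le _ _).trans (by gcongr)
    · rw [h4]; exact (norm_add_le _ _).trans (by gcongr)
  -- the projection of the eigenvectors in the window
  let P : E →ₗ[ℂ] N := (N.orthogonalProjectionOnto : E →L[ℂ] N)
  have hli0 : LinearIndependent ℂ (fun i : I => b i) :=
    b.orthonormal.linearIndependent.comp _ Subtype.val_injective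
  -- A combination `u` of window eigenvectors with zero projection lies in `Nᗮ`, so `ρ ‖u‖ ≤ (ρ / 2
  -- + ρ / 8) ‖u‖`, which forces `u = 0`.
  have hli : LinearIndependent ℂ (P ∘ fun i : I => b i) := by
    refine hli0.map ?_
    rw [Submodule.disjoint_def]
    intro u hu hk
    have hu1 : ∀ i ∉ I, inner ℂ (b i) u = 0 := by
      intro i hi
      clear hk
      induction hu using Submodule.span_induction with
      | mem y hy =>
        obtain ⟨j, rfl⟩ := hy
        exact b.orthonormal.2 (fun h => hi (h ▸ j.2))
      | zero => simp
      | add y z _ _ h1 h2 => rw [inner_add_right, h1, h2, add_zero]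
      | smul a y _ h1 => rw [inner_smul_right, h1, mul_zero]
    have hu2 : u ∈ Nᗮ := by
      have : N.orthogonalProjectionOnto u = 0 := hk
      exact Submodule.orthogonalProjectionOnto_eq_zero_iff.1 this
    have := hgap u hu2
    have h4 := hup u hu1
    have h5 := (hdiff u).1
    have : ‖u‖ = 0 := by nlinarith [norm_nonneg u]
    exact norm_eq_zero.1 this
  have hIfin : Finite I := hli.finite
  have := Fintype.ofFinite I
  have hcard1 : Fintype.card I ≤ 2 := h2 ▸ hli.fintype_card_le_finrank
  let Φ : N →ₗ[ℂ] (I → ℂ) := LinearMap.pi fun i => ((innerSL ℂ (b i)).toLinearMap).comp N.subtype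
  -- If `n` in `N` has no coordinate in the window, then `ρ / 2 ‖n‖ ≤ ‖T n - μ n‖ ≤ ρ / 8 ‖n‖`,
  -- because `T₀ n = μ n`.
  have hΦ : Function.Injective Φ := by
    rw [← LinearMap.ker_eq_bot, LinearMap.ker_eq_bot']
    intro n hn
    have h4 := hlow n (fun i hi => congrFun hn ⟨i, hi⟩)
    have h5 := (hdiff n).2
    have h6 : T₀ n - (μ : ℂ) • (n : E) = 0 := sub_eq_zero.2 (Module.End.mem_eigenspace_iff.1 n.2)
    rw [h6, norm_zero] at h5
    have : ‖(n : E)‖ = 0 := by nlinarith [norm_nonneg (n : E)]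
    exact Subtype.ext (norm_eq_zero.1 this)
  have hcard : Fintype.card I = 2 := by
    have := LinearMap.finrank_le_finrank_of_injective hΦ
    rw [h2, Module.finrank_fintype_fun_eq_card] at this
    omega
  obtain ⟨e, he⟩ : ∃ e : Fin 2 ≃ I, ν (e 0) ≤ ν (e 1) := by
    let e := (Fintype.equivFinOfCardEq hcard).symm
    rcases le_total (ν (e 0)) (ν (e 1)) with h | h
    · exact ⟨e, h⟩
    · exact ⟨(Equiv.swap 0 1).trans e, by simpa using h⟩
  have hortho : Orthonormal ℂ (fun j => b (e j)) :=
    b.orthonormal.comp _ (Subtype.val_injective.comp e.injective)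
  refine ⟨fun j => b (e j), fun j => ν (e j), hortho, fun j => hb _, fun j => (e j).2, he, ?_⟩
  intro w hw
  have hspan : Module.End.eigenspace (T : E →ₗ[ℂ] E) w =
      Submodule.span ℂ (Set.range fun j : {j : Fin 2 // w = ν (e j)} => b (e j)) := by
    apply le_antisymm
    · intro u hu
      have hu' : T u = w • u := Module.End.mem_eigenspace_iff.1 hu
      have hz : ∀ i, inner ℂ (b i) u ≠ 0 → ∃ j, i = e j ∧ w = ν (e j) := by
        intro i hi
        have h3 := inner_eigenbasis hs hb i u
        rw [hu', inner_smul_right] at h3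
        have h4 : w = ν i := mul_right_cancel₀ hi h3
        have h5 : i ∈ I := by
          rw [h4, ← Complex.ofReal_sub, Complex.norm_real] at hw
          exact hw
        exact ⟨e.symm ⟨i, h5⟩, by simp, by simpa using h4⟩
      have h3 := b.hasSum_repr u
      have h4 : ∀ i, b.repr u i • b i ∈ Submodule.span ℂ
          (Set.range fun j : {j : Fin 2 // w = ν (e j)} => b (e j)) := by
        intro i
        by_cases hi : inner ℂ (b i) u = 0
        · rw [b.repr_apply_apply, hi, zero_smul]; exact Submodule.zero_mem _
        · obtain ⟨j, rfl, hj⟩ := hz i hi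
          exact Submodule.smul_mem _ _ (Submodule.subset_span ⟨⟨j, hj⟩, rfl⟩)
      have : FiniteDimensional ℂ (Submodule.span ℂ
          (Set.range fun j : {j : Fin 2 // w = ν (e j)} => b (e j))) :=
        FiniteDimensional.span_of_finite ℂ (Set.finite_range _)
      have hcl := Submodule.closed_of_finiteDimensional (Submodule.span ℂ
          (Set.range fun j : {j : Fin 2 // w = ν (e j)} => b (e j)))
      exact hcl.mem_of_tendsto h3 (Eventually.of_forall fun s =>
        Submodule.sum_mem _ fun i _ => h4 i)
    · rw [Submodule.span_le]
      rintro _ ⟨j, rfl⟩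
      rw [SetLike.mem_coe, Module.End.mem_eigenspace_iff]
      exact (hb _).trans (by rw [← j.2])
  rw [hspan]
  refine ⟨FiniteDimensional.span_of_finite ℂ (Set.finite_range _), ?_⟩
  have hli2 : LinearIndependent ℂ (fun j : {j : Fin 2 // w = ν (e j)} => b (e j)) :=
    hortho.linearIndependent.comp _ Subtype.val_injective
  rw [finrank_span_eq_card hli2, Fintype.card_subtype, Finset.card_filter, Fin.sum_univ_two]

end CompactPerturbation

/-! ### First order perturbation theory of a double eigenvalue -/

section FirstOrder

/-- The vectors `a` and `b` are approximate eigenvectors of the traceless matrix `M` with rows `(m₀,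
m₁)` and `(m₂, -m₀)`. Since `M a ∧ b + a ∧ M b` is the trace times `a ∧ b`, hence zero, the product
of `s + t` and `a ∧ b` consists of remainders only, and `a ∧ b` is bounded below. -/
theorem sum_le_of_approx_eigenvectors {a₀ a₁ b₀ b₁ m₀ m₁ m₂ s t r₀ r₁ r₂ r₃ : ℂ} {R : ℝ}
    (h₀ : s * a₀ = m₀ * a₀ + m₁ * a₁ + r₀) (h₁ : s * a₁ = m₂ * a₀ - m₀ * a₁ + r₁)
    (h₂ : t * b₀ = m₀ * b₀ + m₁ * b₁ + r₂) (h₃ : t * b₁ = m₂ * b₀ - m₀ * b₁ + r₃)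
    (hr₀ : ‖r₀‖ ≤ R) (hr₁ : ‖r₁‖ ≤ R) (hr₂ : ‖r₂‖ ≤ R) (hr₃ : ‖r₃‖ ≤ R)
    (ha₀ : ‖a₀‖ ≤ 1) (ha₁ : ‖a₁‖ ≤ 1) (hb₀ : ‖b₀‖ ≤ 1) (hb₁ : ‖b₁‖ ≤ 1)
    (hω : 1 / 2 ≤ ‖a₀ * b₁ - a₁ * b₀‖) : ‖s + t‖ ≤ 8 * R := by
  have e : (s + t) * (a₀ * b₁ - a₁ * b₀) = r₀ * b₁ - r₁ * b₀ + a₀ * r₃ - a₁ * r₂ := by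
    linear_combination b₁ * h₀ - b₀ * h₁ + a₀ * h₃ - a₁ * h₂
  have hR : 0 ≤ R := (norm_nonneg _).trans hr₀
  have hb : ‖r₀ * b₁ - r₁ * b₀ + a₀ * r₃ - a₁ * r₂‖ ≤ 4 * R := by
    have k₀ : ‖r₀ * b₁‖ ≤ R := by rw [norm_mul]; nlinarith [norm_nonneg r₀, norm_nonneg b₁]
    have k₁ : ‖r₁ * b₀‖ ≤ R := by rw [norm_mul]; nlinarith [norm_nonneg r₁, norm_nonneg b₀]
    have k₂ : ‖a₀ * r₃‖ ≤ R := by rw [norm_mul]; nlinarith [norm_nonneg r₃, norm_nonneg a₀]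
    have k₃ : ‖a₁ * r₂‖ ≤ R := by rw [norm_mul]; nlinarith [norm_nonneg r₂, norm_nonneg a₁]
    have l₁ := norm_sub_le (r₀ * b₁) (r₁ * b₀)
    have l₂ := norm_add_le (r₀ * b₁ - r₁ * b₀) (a₀ * r₃)
    have l₃ := norm_sub_le (r₀ * b₁ - r₁ * b₀ + a₀ * r₃) (a₁ * r₂)
    linarith
  rw [← e, norm_mul] at hb
  nlinarith [norm_nonneg (s + t)]

/-- By Cayley–Hamilton the square of a traceless `M` is the scalar `m₀² + m₁ m₂`. Applying `M` twice
to the approximate eigenvector therefore compares `s²` with this scalar, at the price of the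
remainders `s r + M r`; one of the coordinates of `a` is at least `1 / 2` in norm. -/
theorem sq_sub_le_of_approx_eigenvector {a₀ a₁ m₀ m₁ m₂ s r₀ r₁ : ℂ} {R K : ℝ}
    (h₀ : s * a₀ = m₀ * a₀ + m₁ * a₁ + r₀) (h₁ : s * a₁ = m₂ * a₀ - m₀ * a₁ + r₁)
    (hr₀ : ‖r₀‖ ≤ R) (hr₁ : ‖r₁‖ ≤ R) (hm₀ : ‖m₀‖ ≤ K) (hm₁ : ‖m₁‖ ≤ K) (hm₂ : ‖m₂‖ ≤ K)
    (ha : 1 / 2 ≤ ‖a₀‖ ^ 2 + ‖a₁‖ ^ 2) :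
    ‖s ^ 2 - (m₀ ^ 2 + m₁ * m₂)‖ ≤ 2 * ((‖s‖ + 2 * K) * R) := by
  have e₀ : (s ^ 2 - (m₀ ^ 2 + m₁ * m₂)) * a₀ = s * r₀ + m₀ * r₀ + m₁ * r₁ := by
    linear_combination (s + m₀) * h₀ + m₁ * h₁
  have e₁ : (s ^ 2 - (m₀ ^ 2 + m₁ * m₂)) * a₁ = s * r₁ + m₂ * r₀ + (-m₀) * r₁ := by
    linear_combination (s - m₀) * h₁ + m₂ * h₀
  have hR : 0 ≤ R := (norm_nonneg _).trans hr₀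
  have hK : 0 ≤ K := (norm_nonneg _).trans hm₀
  have hbd : ∀ m m' u v w : ℂ, ‖m‖ ≤ K → ‖m'‖ ≤ K → ‖u‖ ≤ R → ‖v‖ ≤ R → ‖w‖ ≤ R →
      ‖s * u + m * v + m' * w‖ ≤ (‖s‖ + 2 * K) * R := by
    intro m m' u v w hm hm' hu hv hw
    have k₁ : ‖s * u‖ ≤ ‖s‖ * R := by rw [norm_mul]; gcongr
    have k₂ : ‖m * v‖ ≤ K * R := by rw [norm_mul]; gcongr
    have k₃ : ‖m' * w‖ ≤ K * R := by rw [norm_mul]; gcongr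
    have := norm_add₃_le (a := s * u) (b := m * v) (c := m' * w)
    linarith
  have hb₀ := hbd m₀ m₁ r₀ r₀ r₁ hm₀ hm₁ hr₀ hr₀ hr₁
  have hb₁ := hbd m₂ (-m₀) r₁ r₀ r₁ hm₂ (by rwa [norm_neg]) hr₁ hr₀ hr₁
  rw [← e₀, norm_mul] at hb₀
  rw [← e₁, norm_mul] at hb₁
  set X := ‖s ^ 2 - (m₀ ^ 2 + m₁ * m₂)‖
  have hX : 0 ≤ X := norm_nonneg _
  rcases le_total (1 / 2) ‖a₀‖ with h | h
  · nlinarith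
  · have : 1 / 2 ≤ ‖a₁‖ := by nlinarith [norm_nonneg a₀, norm_nonneg a₁]
    nlinarith

universe u
variable {E : Type u} [NormedAddCommGroup E] [InnerProductSpace ℂ E]

/-- The data of a pair `n` forming an orthonormal basis of the subspace `N`. -/
structure IsBasisPair (N : Submodule ℂ E) (n : Fin 2 → E) : Prop where
  orthonormal : Orthonormal ℂ n
  mem : ∀ i, n i ∈ N
  expand : ∀ u ∈ N, u = inner ℂ (n 0) u • n 0 + inner ℂ (n 1) u • n 1

theorem IsBasisPair.inner_self {N : Submodule ℂ E} {n : Fin 2 → E} (h : IsBasisPair N n)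
    (i : Fin 2) : inner ℂ (n i) (n i) = (1 : ℂ) := by
  rw [inner_self_eq_norm_sq_to_K, h.orthonormal.1]; simp

theorem IsBasisPair.inner_zero_one {N : Submodule ℂ E} {n : Fin 2 → E} (h : IsBasisPair N n) :
    inner ℂ (n 0) (n 1) = (0 : ℂ) := h.orthonormal.2 (by simp)

theorem IsBasisPair.inner_one_zero {N : Submodule ℂ E} {n : Fin 2 → E} (h : IsBasisPair N n) :
    inner ℂ (n 1) (n 0) = (0 : ℂ) := h.orthonormal.2 (by simp)

/-- The component in `Nᗮ`. -/
def orthPart (n : Fin 2 → E) (x : E) : E :=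
  x - (inner ℂ (n 0) x • n 0 + inner ℂ (n 1) x • n 1)

theorem IsBasisPair.inner_orthPart {N : Submodule ℂ E} {n : Fin 2 → E} (h : IsBasisPair N n)
    (x : E) (i : Fin 2) : inner ℂ (n i) (orthPart n x) = (0 : ℂ) := by
  fin_cases i <;>
  simp [orthPart, h.orthonormal.1, h.inner_zero_one, h.inner_one_zero]

theorem IsBasisPair.orthPart_mem {N : Submodule ℂ E} {n : Fin 2 → E} (h : IsBasisPair N n)
    (x : E) : orthPart n x ∈ Nᗮ := by
  rw [Submodule.mem_orthogonal]
  intro u hu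
  rw [h.expand u hu]
  simp [inner_add_left, inner_smul_left, h.inner_orthPart]

theorem IsBasisPair.inner_eq {N : Submodule ℂ E} {n : Fin 2 → E} (h : IsBasisPair N n)
    (x y : E) : inner ℂ x y = starRingEnd ℂ (inner ℂ (n 0) x) * inner ℂ (n 0) y +
      starRingEnd ℂ (inner ℂ (n 1) x) * inner ℂ (n 1) y +
        inner ℂ (orthPart n x) (orthPart n y) := by
  have e : ∀ i, inner ℂ (orthPart n x) (n i) = (0 : ℂ) := fun i =>
    inner_eq_zero_symm.1 (h.inner_orthPart x i)
  have hx : x = inner ℂ (n 0) x • n 0 + inner ℂ (n 1) x • n 1 + orthPart n x := by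
    simp [orthPart]
  have hy : y = inner ℂ (n 0) y • n 0 + inner ℂ (n 1) y • n 1 + orthPart n y := by
    simp [orthPart]
  conv_lhs => rw [hx, hy]
  simp only [inner_add_left, inner_add_right, inner_smul_left, inner_smul_right, h.inner_self,
    h.inner_zero_one, h.inner_one_zero, h.inner_orthPart, e]
  ring

theorem IsBasisPair.norm_sq_eq {N : Submodule ℂ E} {n : Fin 2 → E} (h : IsBasisPair N n)
    (x : E) : ‖x‖ ^ 2 = ‖inner ℂ (n 0) x‖ ^ 2 + ‖inner ℂ (n 1) x‖ ^ 2 + ‖orthPart n x‖ ^ 2 := by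
  have := h.inner_eq x x
  simp only [inner_self_eq_norm_sq_to_K, Complex.conj_mul'] at this
  apply Complex.ofReal_injective
  push_cast
  exact this

/-- First order perturbation theory for an eigenvector of an operator `T` near `T₀`. -/
theorem eigenvector_expansion {T₀ T L : E →L[ℂ] E} (hs₀ : (T₀ : E →ₗ[ℂ] E).IsSymmetric)
    {μ ρ : ℝ} (hρ : 0 < ρ) {n : Fin 2 → E}
    (hn : IsBasisPair (Module.End.eigenspace (T₀ : E →ₗ[ℂ] E) μ) n)
    (hgap : ∀ u ∈ (Module.End.eigenspace (T₀ : E →ₗ[ℂ] E) μ)ᗮ, ρ * ‖u‖ ≤ ‖T₀ u - (μ : ℂ) • u‖)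
    (hT : ‖T - T₀‖ ≤ ρ / 8) {x : E} {ν : ℝ} (hx : ‖x‖ = 1) (hTx : T x = (ν : ℂ) • x)
    (hν : |ν - μ| < ρ / 2) :
    ‖orthPart n x‖ ≤ 2 / ρ * ‖T - T₀‖ ∧ |ν - μ| ≤ 2 * ‖T - T₀‖ ∧
    ∀ i, ‖((ν - μ : ℝ) : ℂ) * inner ℂ (n i) x -
      (inner ℂ (n i) (L (n 0)) * inner ℂ (n 0) x + inner ℂ (n i) (L (n 1)) * inner ℂ (n 1) x)‖ ≤
        ‖L‖ * (2 / ρ * ‖T - T₀‖) + ‖T - T₀ - L‖ := by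
  have hT₀n : ∀ i, T₀ (n i) = (μ : ℂ) • n i := fun i =>
    Module.End.mem_eigenspace_iff.1 (hn.mem i)
  have hT₀i : ∀ i u, inner ℂ (n i) (T₀ u) = μ * inner ℂ (n i) u := by
    intro i u
    have := hs₀ (n i) u
    simp only [ContinuousLinearMap.coe_coe] at this
    rw [← this, hT₀n, inner_smul_left, Complex.conj_ofReal]
  set q := orthPart n x with hq
  have hqm := hn.orthPart_mem x
  have hD : ‖(T - T₀) x‖ ≤ ‖T - T₀‖ := by simpa [hx] using (T - T₀).le_opNorm x
  have hDi : ∀ i, inner ℂ (n i) ((T - T₀) x) = ((ν - μ : ℝ) : ℂ) * inner ℂ (n i) x := by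
    intro i
    rw [sub_apply, inner_sub_right, hTx, hT₀i, inner_smul_right]
    push_cast; ring
  have hxe : x = inner ℂ (n 0) x • n 0 + inner ℂ (n 1) x • n 1 + q := by simp [hq, orthPart]
  -- `T₀` acts as `μ` on the eigenspace, so the orthogonal component of `ν x - T₀ x` only sees `q`.
  have hDq : orthPart n ((T - T₀) x) = (ν : ℂ) • q - T₀ q := by
    rw [orthPart, hDi, hDi, sub_apply, hTx]
    have : T₀ x = inner ℂ (n 0) x • (μ : ℂ) • n 0 + inner ℂ (n 1) x • (μ : ℂ) • n 1 + T₀ q := by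
      conv_lhs => rw [hxe]
      simp only [map_add, map_smul, hT₀n]
    rw [this]
    have h2 : (ν : ℂ) • x = (ν : ℂ) • (inner ℂ (n 0) x • n 0 + inner ℂ (n 1) x • n 1) +
        (ν : ℂ) • q := by
      rw [← smul_add, ← hxe]
    rw [h2]
    push_cast
    module
  have hpy := hn.norm_sq_eq ((T - T₀) x)
  have hDsq : ‖(T - T₀) x‖ ^ 2 ≤ ‖T - T₀‖ ^ 2 := by gcongr
  have hq1 : ‖(ν : ℂ) • q - T₀ q‖ ≤ ‖T - T₀‖ := by
    rw [← hDq]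
    refine (sq_le_sq₀ (norm_nonneg _) (norm_nonneg _)).1 ?_
    nlinarith [sq_nonneg ‖inner ℂ (n 0) ((T - T₀) x)‖, sq_nonneg ‖inner ℂ (n 1) ((T - T₀) x)‖]
  -- The gap `ρ` at `μ` leaves `ρ / 2` at `ν`, as `|ν - μ| < ρ / 2`.
  have hq2 : ρ / 2 * ‖q‖ ≤ ‖T - T₀‖ := by
    have h1 := hgap q hqm
    have h2 : T₀ q - (μ : ℂ) • q = ((ν - μ : ℝ) : ℂ) • q - ((ν : ℂ) • q - T₀ q) := by
      push_cast; module
    have h3 := norm_sub_le (((ν - μ : ℝ) : ℂ) • q) ((ν : ℂ) • q - T₀ q)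
    rw [← h2, norm_smul, Complex.norm_real, Real.norm_eq_abs] at h3
    nlinarith [norm_nonneg q]
  have hq3 : ‖q‖ ≤ 2 / ρ * ‖T - T₀‖ := by
    have : ‖q‖ = 2 / ρ * (ρ / 2 * ‖q‖) := by field_simp
    rw [this]; gcongr
  refine ⟨hq3, ?_, fun i => ?_⟩
  -- The bound `ρ / 8` makes `‖q‖` at most `1 / 4`, so the eigenspace carries at least `15 / 16` of
  -- the squared norm of `x`; on these coordinates `T - T₀` acts as `ν - μ`.
  · have hx2 := hn.norm_sq_eq x
    rw [hx] at hx2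
    have hq4 : ‖q‖ ≤ 1 / 4 := by
      have : 2 / ρ * ‖T - T₀‖ ≤ 2 / ρ * (ρ / 8) := by gcongr
      have h8 : 2 / ρ * (ρ / 8) = 1 / 4 := by field_simp; norm_num
      linarith
    have hq5 : ‖q‖ ^ 2 ≤ 1 / 16 := by nlinarith [norm_nonneg q]
    rw [hDi, hDi, norm_mul, norm_mul, Complex.norm_real, Real.norm_eq_abs] at hpy
    have h1 : |ν - μ| ^ 2 * (15 / 16) ≤ ‖T - T₀‖ ^ 2 := by
      have : ‖inner ℂ (n 0) x‖ ^ 2 + ‖inner ℂ (n 1) x‖ ^ 2 ≥ 15 / 16 := by linarith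
      nlinarith [sq_nonneg ‖orthPart n ((T - T₀) x)‖, sq_nonneg |ν - μ|]
    refine (sq_le_sq₀ (abs_nonneg _) (by positivity)).1 ?_
    nlinarith [sq_nonneg |ν - μ|]
  -- Two errors arise on projecting `(ν - μ) x` to the eigenspace: `L` applied to the component `q`,
  -- and the deviation of `T - T₀` from `L`.
  · have e : ((ν - μ : ℝ) : ℂ) * inner ℂ (n i) x -
        (inner ℂ (n i) (L (n 0)) * inner ℂ (n 0) x + inner ℂ (n i) (L (n 1)) * inner ℂ (n 1) x) =
        inner ℂ (n i) (L q) + inner ℂ (n i) ((T - T₀ - L) x) := by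
      rw [← hDi]
      have h1 : (T - T₀ - L) x = (T - T₀) x - L x := rfl
      have h2 : L x = inner ℂ (n 0) x • L (n 0) + inner ℂ (n 1) x • L (n 1) + L q := by
        conv_lhs => rw [hxe]
        simp only [map_add, map_smul]
      rw [h1, h2, inner_sub_right, inner_add_right, inner_add_right, inner_smul_right,
        inner_smul_right]
      ring
    rw [e]
    refine (norm_add_le _ _).trans (add_le_add ?_ ?_)
    · refine (norm_inner_le_norm _ _).trans ?_
      rw [hn.orthonormal.1, one_mul]
      exact (L.le_opNorm q).trans (by gcongr)
    · refine (norm_inner_le_norm _ _).trans ?_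
      rw [hn.orthonormal.1, one_mul]
      simpa [hx] using (T - T₀ - L).le_opNorm x

/-- First order perturbation theory of a double eigenvalue, when the first order matrix has
trace zero. -/
theorem eigenvalue_pair_estimate {T₀ T L : E →L[ℂ] E} (hs₀ : (T₀ : E →ₗ[ℂ] E).IsSymmetric)
    {μ ρ : ℝ} (hρ : 0 < ρ) {n : Fin 2 → E}
    (hn : IsBasisPair (Module.End.eigenspace (T₀ : E →ₗ[ℂ] E) μ) n)
    (hgap : ∀ u ∈ (Module.End.eigenspace (T₀ : E →ₗ[ℂ] E) μ)ᗮ, ρ * ‖u‖ ≤ ‖T₀ u - (μ : ℂ) • u‖)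
    (hT : ‖T - T₀‖ ≤ ρ / 8) {x : Fin 2 → E} {ν : Fin 2 → ℝ} (hx : Orthonormal ℂ x)
    (hTx : ∀ j, T (x j) = (ν j : ℂ) • x j) (hν : ∀ j, |ν j - μ| < ρ / 2)
    (htr : inner ℂ (n 0) (L (n 0)) + inner ℂ (n 1) (L (n 1)) = (0 : ℂ)) :
    |(ν 0 - μ) + (ν 1 - μ)| ≤ 8 * (‖L‖ * (2 / ρ * ‖T - T₀‖) + ‖T - T₀ - L‖) ∧
    ∀ j, ‖(((ν j - μ) ^ 2 : ℝ) : ℂ) - (inner ℂ (n 0) (L (n 0)) ^ 2 +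
        inner ℂ (n 0) (L (n 1)) * inner ℂ (n 1) (L (n 0)))‖ ≤
      2 * ((2 * ‖T - T₀‖ + 2 * ‖L‖) * (‖L‖ * (2 / ρ * ‖T - T₀‖) + ‖T - T₀ - L‖)) := by
  set R := ‖L‖ * (2 / ρ * ‖T - T₀‖) + ‖T - T₀ - L‖ with hR
  have hR0 : 0 ≤ R := by positivity
  have key := fun j => eigenvector_expansion (L := L) hs₀ hρ hn hgap hT (hx.1 j) (hTx j) (hν j)
  have hq : ∀ j, ‖orthPart n (x j)‖ ≤ 1 / 4 := by
    intro j
    have h1 := (key j).1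
    have : 2 / ρ * ‖T - T₀‖ ≤ 2 / ρ * (ρ / 8) := by gcongr
    have h8 : 2 / ρ * (ρ / 8) = 1 / 4 := by field_simp; norm_num
    linarith
  have hq2 : ∀ j, ‖orthPart n (x j)‖ ^ 2 ≤ 1 / 16 := fun j => by
    nlinarith [norm_nonneg (orthPart n (x j)), hq j]
  have hsum : ∀ j, 15 / 16 ≤ ‖inner ℂ (n 0) (x j)‖ ^ 2 + ‖inner ℂ (n 1) (x j)‖ ^ 2 := by
    intro j
    have := hn.norm_sq_eq (x j)
    rw [hx.1] at this
    linarith [hq2 j]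
  have hle : ∀ i j, ‖inner ℂ (n i) (x j)‖ ≤ 1 := fun i j => by
    simpa [hn.orthonormal.1, hx.1] using norm_inner_le_norm (𝕜 := ℂ) (n i) (x j)
  have hm : ∀ i j, ‖inner ℂ (n i) (L (n j))‖ ≤ ‖L‖ := fun i j => by
    refine (norm_inner_le_norm _ _).trans ?_
    rw [hn.orthonormal.1, one_mul]
    simpa [hn.orthonormal.1] using L.le_opNorm (n j)
  have h11 : inner ℂ (n 1) (L (n 1)) = -inner ℂ (n 0) (L (n 0)) := by linear_combination htr
  set a : Fin 2 → Fin 2 → ℂ := fun i j => inner ℂ (n i) (x j) with ha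
  set r : Fin 2 → Fin 2 → ℂ := fun i j => ((ν j - μ : ℝ) : ℂ) * inner ℂ (n i) (x j) -
      (inner ℂ (n i) (L (n 0)) * inner ℂ (n 0) (x j) +
        inner ℂ (n i) (L (n 1)) * inner ℂ (n 1) (x j)) with hr
  have hrR : ∀ i j, ‖r i j‖ ≤ R := fun i j => (key j).2.2 i
  have h0 : ∀ j, ((ν j - μ : ℝ) : ℂ) * a 0 j = inner ℂ (n 0) (L (n 0)) * a 0 j +
      inner ℂ (n 0) (L (n 1)) * a 1 j + r 0 j := fun j => by simp only [ha, hr]; ring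
  have h1 : ∀ j, ((ν j - μ : ℝ) : ℂ) * a 1 j = inner ℂ (n 1) (L (n 0)) * a 0 j -
      inner ℂ (n 0) (L (n 0)) * a 1 j + r 1 j := fun j => by simp only [ha, hr, h11]; ring
  -- Lagrange's identity `e3` splits the product of the squared norms of the two coordinate vectors
  -- into the squared determinant and the squared Hermitian product. The latter product is small,
  -- since `x 0 ⟂ x 1` makes it minus the inner product of the orthogonal parts.
  have hω : 1 / 2 ≤ ‖a 0 0 * a 1 1 - a 1 0 * a 0 1‖ := by
    have e1 : starRingEnd ℂ (a 0 0) * a 0 1 + starRingEnd ℂ (a 1 0) * a 1 1 =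
        -inner ℂ (orthPart n (x 0)) (orthPart n (x 1)) := by
      have h := hn.inner_eq (x 0) (x 1)
      rw [hx.2 (by simp : (0 : Fin 2) ≠ 1)] at h
      linear_combination -h
    have e2 : ‖starRingEnd ℂ (a 0 0) * a 0 1 + starRingEnd ℂ (a 1 0) * a 1 1‖ ≤ 1 / 16 := by
      rw [e1, norm_neg]
      refine (norm_inner_le_norm _ _).trans ?_
      nlinarith [hq 0, hq 1, norm_nonneg (orthPart n (x 0)), norm_nonneg (orthPart n (x 1))]
    have e3 : ‖a 0 0 * a 1 1 - a 1 0 * a 0 1‖ ^ 2 +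
        ‖starRingEnd ℂ (a 0 0) * a 0 1 + starRingEnd ℂ (a 1 0) * a 1 1‖ ^ 2 =
        (‖a 0 0‖ ^ 2 + ‖a 1 0‖ ^ 2) * (‖a 0 1‖ ^ 2 + ‖a 1 1‖ ^ 2) := by
      simp only [← Complex.normSq_eq_norm_sq, Complex.normSq_apply, Complex.sub_re, Complex.sub_im,
        Complex.add_re, Complex.add_im, Complex.mul_re, Complex.mul_im, Complex.conj_re,
        Complex.conj_im]
      ring
    have e4 := hsum 0
    have e5 := hsum 1
    have e6 : (15 / 16 : ℝ) * (15 / 16) ≤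
        (‖a 0 0‖ ^ 2 + ‖a 1 0‖ ^ 2) * (‖a 0 1‖ ^ 2 + ‖a 1 1‖ ^ 2) := by
      apply mul_le_mul e4 e5 (by norm_num) (by positivity)
    have e7 : ‖starRingEnd ℂ (a 0 0) * a 0 1 + starRingEnd ℂ (a 1 0) * a 1 1‖ ^ 2 ≤ 1 / 16 := by
      nlinarith [norm_nonneg (starRingEnd ℂ (a 0 0) * a 0 1 + starRingEnd ℂ (a 1 0) * a 1 1)]
    refine (sq_le_sq₀ (by norm_num) (norm_nonneg _)).1 ?_
    linarith
  constructor
  · have := sum_le_of_approx_eigenvectors (h0 0) (h1 0) (h0 1) (h1 1) (hrR _ _) (hrR _ _)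
      (hrR _ _) (hrR _ _) (hle _ _) (hle _ _) (hle _ _) (hle _ _) hω
    rwa [← Complex.ofReal_add, Complex.norm_real] at this
  · intro j
    have := sq_sub_le_of_approx_eigenvector (h0 j) (h1 j) (hrR _ _) (hrR _ _) (hm _ _) (hm _ _)
      (hm _ _) ((by norm_num : (1 / 2 : ℝ) ≤ 15 / 16).trans (hsum j))
    push_cast at this ⊢
    refine this.trans ?_
    have h3 := (key j).2.1
    rw [← Complex.ofReal_sub, Complex.norm_real, Real.norm_eq_abs]
    gcongr

end FirstOrder

/-! ### Forms invariant under a rotation of order three, real bases, compressions -/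

section Dispersion

/-- The adjoint of the linear map `rot`. -/
def rotAdj (x : Plane) : Plane :=
  !₂[-(1 / 2) * x 0 - √3 / 2 * x 1, √3 / 2 * x 0 - 1 / 2 * x 1]

/-- The rotation `r` by a third of a turn satisfies `1 + r + r² = 0`. -/
theorem add_rotAdj_add_rotAdj (x : Plane) : x + rotAdj x + rotAdj (rotAdj x) = 0 := by
  have h3 : √3 * √3 = 3 := Real.mul_self_sqrt (by norm_num)
  ext i
  fin_cases i
  · simp [rotAdj]; linear_combination (-(x 0) / 4) * h3
  · simp [rotAdj]; linear_combination (-(x 1) / 4) * h3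

/-- The sum of `φ` over an orbit is both `3 φ x` and `φ 0`. -/
theorem eq_zero_of_rotAdj_invariant {F : Type*} [AddCommGroup F] [Module ℝ F]
    (φ : Plane →ₗ[ℝ] F) (h : ∀ x, φ (rotAdj x) = φ x) (x : Plane) : φ x = 0 := by
  have h1 := congrArg φ (add_rotAdj_add_rotAdj x)
  simp only [map_add, h, map_zero] at h1
  have : (3 : ℝ) • φ x = 0 := by rw [← h1]; module
  exact (smul_eq_zero.1 this).resolve_left (by norm_num)

/-- The three points of the orbit of `(1, 0)` already determine the form: equal values there force
`B = 0` and `A = C`. -/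
theorem quadratic_eq_of_rotAdj_invariant {f : Plane → ℝ} {A B C : ℝ}
    (hf : ∀ x, f x = A * x 0 ^ 2 + B * (x 0 * x 1) + C * x 1 ^ 2)
    (h : ∀ x, f (rotAdj x) = f x) (x : Plane) : f x = A * ‖x‖ ^ 2 := by
  have h3 : √3 ^ 2 = 3 := Real.sq_sqrt (by norm_num)
  have e1 := h !₂[1, 0]
  have e2 := h (rotAdj !₂[1, 0])
  rw [e1] at e2
  simp [hf, rotAdj, div_pow, h3] at e1 e2
  have hs1 : (2⁻¹ * 2⁻¹ - √3 / 2 * (√3 / 2) : ℝ) = -1 / 2 := by linear_combination (-1 / 4) * h3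
  have hs2 : -(√3 / 2 * 2⁻¹) - 2⁻¹ * (√3 / 2) = -(√3 / 2) := by ring
  rw [hs1, hs2, neg_sq, div_pow, div_pow √3, h3] at e2
  have hAC : A = C := by linarith
  have hB : B = 0 := by
    have : B * √3 = 0 := by linarith
    exact (mul_eq_zero.1 this).resolve_right (by positivity)
  rw [hf, EuclideanSpace.norm_sq_eq, Fin.sum_univ_two, hB, ← hAC]
  simp; ring

/-- Along a line through the origin the ratio of `‖φ‖` to the norm is constant, so it can only tend
to zero by being zero. -/
theorem eq_zero_of_homogeneous_isLittleO {V F : Type*} [NormedAddCommGroup V] [NormedSpace ℝ V]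
    [NormedAddCommGroup F] [NormedSpace ℝ F] {φ : V → F} (h1 : ∀ (t : ℝ) x, φ (t • x) = t • φ x)
    (h2 : φ =o[𝓝 0] (fun x : V => x)) (x : V) : φ x = 0 := by
  by_contra hne
  have hpos : 0 < ‖φ x‖ / (2 * (‖x‖ + 1)) := by positivity
  have h3 := h2.def hpos
  have h4 : Tendsto (fun t : ℝ => t • x) (𝓝[≠] 0) (𝓝 0) := by
    have : Tendsto (fun t : ℝ => t • x) (𝓝 0) (𝓝 ((0 : ℝ) • x)) :=
      (continuous_id.smul continuous_const).tendsto 0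
    rw [zero_smul] at this
    exact this.mono_left nhdsWithin_le_nhds
  obtain ⟨t, ht, ht0⟩ := ((h4.eventually h3).and self_mem_nhdsWithin).exists
  have ht0' : 0 < |t| := abs_pos.2 ht0
  rw [h1, norm_smul, norm_smul, Real.norm_eq_abs] at ht
  have h5 : ‖φ x‖ / (2 * (‖x‖ + 1)) * (|t| * ‖x‖) < |t| * ‖φ x‖ := by
    have : ‖φ x‖ / (2 * (‖x‖ + 1)) * ‖x‖ < ‖φ x‖ := by
      rw [div_mul_eq_mul_div, div_lt_iff₀ (by positivity)]
      nlinarith [norm_nonneg x, norm_pos_iff.2 hne]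
    nlinarith
  linarith

universe u
variable {E : Type u} [NormedAddCommGroup E] [InnerProductSpace ℂ E]

theorem IsBasisPair.of_orthonormal {N : Submodule ℂ E} (h2 : Module.finrank ℂ N = 2)
    {n : Fin 2 → E} (ho : Orthonormal ℂ n) (hm : ∀ i, n i ∈ N) : IsBasisPair N n := by
  refine ⟨ho, hm, fun u hu => ?_⟩
  have hfin : FiniteDimensional ℂ N := Module.finite_of_finrank_pos (by omega)
  have hli : LinearIndependent ℂ (fun i => (⟨n i, hm i⟩ : N)) :=
    LinearIndependent.of_comp N.subtype ho.linearIndependent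
  have hsp := hli.span_eq_top_of_card_eq_finrank' (by simp [h2])
  have hu' : (⟨u, hu⟩ : N) ∈ Submodule.span ℂ (Set.range fun i => (⟨n i, hm i⟩ : N)) := by
    rw [hsp]; trivial
  rw [Submodule.mem_span_range_iff_exists_fun] at hu'
  obtain ⟨c, hc⟩ := hu'
  have hc' : c 0 • n 0 + c 1 • n 1 = u := by
    have := congrArg Subtype.val hc
    simpa [Fin.sum_univ_two] using this
  have h01 : inner ℂ (n 0) (n 1) = (0 : ℂ) := ho.2 (by simp)
  have h10 : inner ℂ (n 1) (n 0) = (0 : ℂ) := ho.2 (by simp)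
  rw [← hc']
  simp [h01, h10, ho.1]

theorem exists_isBasisPair {N : Submodule ℂ E} (h2 : Module.finrank ℂ N = 2) :
    ∃ n, IsBasisPair N n := by
  have hfin : FiniteDimensional ℂ N := Module.finite_of_finrank_pos (by omega)
  let o := (stdOrthonormalBasis ℂ N).reindex (finCongr h2)
  refine ⟨fun i => (o i : E), IsBasisPair.of_orthonormal h2 ?_ fun i => (o i).2⟩
  exact o.orthonormal.comp_linearIsometry N.subtypeₗᵢ

/-- A two-dimensional space with a conjugation has an orthonormal basis whose vectors are real. -/
theorem exists_real_isBasisPair {N : Submodule ℂ E} (h2 : Module.finrank ℂ N = 2)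
    {C : E → E} (hadd : ∀ u v, C (u + v) = C u + C v)
    (hsmul : ∀ (z : ℂ) u, C (z • u) = (starRingEnd ℂ z) • C u)
    (hinner : ∀ u v, inner ℂ (C u) (C v) = inner ℂ v u) (hinv : ∀ u, C (C u) = u)
    (hN : ∀ u ∈ N, C u ∈ N) : ∃ n, IsBasisPair N n ∧ ∀ i, C (n i) = n i := by
  have real : ∀ M : Submodule ℂ E, (∀ u ∈ M, C u ∈ M) → ∀ w ∈ M, w ≠ 0 →
      ∃ v ∈ M, ‖v‖ = 1 ∧ C v = v := by
    intro M hM w hw hw0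
    obtain ⟨v, hv, hv0, hCv⟩ : ∃ v ∈ M, v ≠ 0 ∧ C v = v := by
      -- `w + C w` is real; if it vanishes, `w` is purely imaginary and `Complex.I • w` is real.
      by_cases h : w + C w = 0
      · refine ⟨Complex.I • w, M.smul_mem _ hw, smul_ne_zero Complex.I_ne_zero hw0, ?_⟩
        rw [hsmul, Complex.conj_I, eq_neg_of_add_eq_zero_right h]
        simp
      · exact ⟨w + C w, M.add_mem hw (hM w hw), h, by rw [hadd, hinv, add_comm]⟩
    refine ⟨((‖v‖⁻¹ : ℝ) : ℂ) • v, M.smul_mem _ hv, ?_, ?_⟩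
    · rw [norm_smul, Complex.norm_real, norm_inv, norm_norm, inv_mul_cancel₀ (norm_ne_zero_iff.2 hv0)]
    · rw [hsmul, Complex.conj_ofReal, hCv]
  obtain ⟨o, ho⟩ := exists_isBasisPair h2
  obtain ⟨v, hv, hv1, hCv⟩ := real N hN (o 0) (ho.mem 0) (by
    intro h; simpa [h] using ho.orthonormal.1 0)
  let M : Submodule ℂ E := N ⊓ (Submodule.span ℂ {v})ᗮ
  have hMm : ∀ u, u ∈ M ↔ u ∈ N ∧ inner ℂ v u = (0 : ℂ) := fun u => by
    rw [Submodule.mem_inf, Submodule.mem_orthogonal_singleton_iff_inner_right]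
  have hM : ∀ u ∈ M, C u ∈ M := by
    intro u hu
    rw [hMm] at hu ⊢
    refine ⟨hN u hu.1, ?_⟩
    rw [← hCv, hinner]
    exact inner_eq_zero_symm.1 hu.2
  -- The vector of `N` orthogonal to `v`, written in the basis `o`. The complement `M` is stable
  -- under `C`, so it contains a real unit vector as well.
  let w := inner ℂ v (o 1) • o 0 - inner ℂ v (o 0) • o 1
  have hw : w ∈ M := by
    rw [hMm]
    refine ⟨N.sub_mem (N.smul_mem _ (ho.mem 0)) (N.smul_mem _ (ho.mem 1)), ?_⟩
    simp only [w, inner_sub_right, inner_smul_right]; ring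
  have hw0 : w ≠ 0 := by
    intro h
    have h0 := congrArg (inner ℂ (o 0)) h
    have h1 := congrArg (inner ℂ (o 1)) h
    simp only [w, inner_sub_right, inner_smul_right, ho.inner_self, ho.inner_zero_one,
      ho.inner_one_zero, mul_one, mul_zero, sub_zero, zero_sub, inner_zero_right,
      neg_eq_zero] at h0 h1
    have h3 := ho.expand v hv
    rw [inner_eq_zero_symm.1 h0, inner_eq_zero_symm.1 h1] at h3
    rw [h3] at hv1
    simp at hv1
  obtain ⟨v', hv', hv'1, hCv'⟩ := real M hM w hw hw0
  rw [hMm] at hv'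
  refine ⟨![v, v'], IsBasisPair.of_orthonormal h2 ?_ ?_, ?_⟩
  · refine ⟨fun i => ?_, fun i j hij => ?_⟩
    · fin_cases i
      · exact hv1
      · exact hv'1
    · fin_cases i <;> fin_cases j
      · exact absurd rfl hij
      · exact hv'.2
      · exact inner_eq_zero_symm.1 hv'.2
      · exact absurd rfl hij
  · intro i
    fin_cases i
    · exact hv
    · exact hv'.1
  · intro i
    fin_cases i
    · exact hCv
    · exact hCv'

/-- The matrix of an operator compressed to the span of the pair `n`. -/
def compression (n : Fin 2 → E) (L : E →L[ℂ] E) : Matrix (Fin 2) (Fin 2) ℂ :=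
  Matrix.of fun i j => inner ℂ (n i) (L (n j))

/-- `R` restricts to a unitary map `U` of `N` and sends `Nᗮ` to vectors orthogonal to `N`. Hence the
compressions of `L` and `L'` are conjugate by `U`. -/
theorem compression_conj {N : Submodule ℂ E} {n : Fin 2 → E} (hn : IsBasisPair N n)
    {L L' : E →L[ℂ] E} (R : E ≃ₗᵢ[ℂ] E) (hR : ∀ u ∈ N, R u ∈ N) (hR' : ∀ u ∈ N, R.symm u ∈ N)
    (h : ∀ u, L' (R u) = R (L u)) :
    (compression n L').trace = (compression n L).trace ∧
      (compression n L').det = (compression n L).det := by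
  let U : Matrix (Fin 2) (Fin 2) ℂ := Matrix.of fun i j => inner ℂ (n i) (R (n j))
  have hU : U.conjTranspose * U = 1 := by
    ext i j
    have h1 : inner ℂ (R (n i)) (R (n j)) = (if i = j then 1 else 0 : ℂ) := by
      rw [R.inner_map_map, orthonormal_iff_ite.1 hn.orthonormal]
    rw [Matrix.one_apply, ← h1, Matrix.mul_apply, Fin.sum_univ_two]
    conv_rhs => rw [hn.expand _ (hR _ (hn.mem j)), inner_add_right, inner_smul_right,
      inner_smul_right]
    simp only [U, Matrix.conjTranspose_apply, Matrix.of_apply]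
    rw [← inner_conj_symm (R (n i)) (n 0), ← inner_conj_symm (R (n i)) (n 1)]
    simp only [RCLike.star_def]
    ring
  have hU' : U * U.conjTranspose = 1 := mul_eq_one_comm.1 hU
  have hperp : ∀ i q, q ∈ Nᗮ → inner ℂ (n i) (R q) = (0 : ℂ) := by
    intro i q hq
    have : n i = R (R.symm (n i)) := by simp
    rw [this, R.inner_map_map]
    exact (Submodule.mem_orthogonal N q).1 hq _ (hR' _ (hn.mem i))
  have hmul : compression n L' * U = U * compression n L := by
    ext i j
    rw [Matrix.mul_apply, Matrix.mul_apply, Fin.sum_univ_two, Fin.sum_univ_two]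
    simp only [compression, U, Matrix.of_apply]
    have h1 : inner ℂ (n i) (L' (R (n j))) = inner ℂ (n i) (R (L (n j))) := by rw [h]
    have e1 := hn.expand _ (hR _ (hn.mem j))
    have e2 : L (n j) = inner ℂ (n 0) (L (n j)) • n 0 + inner ℂ (n 1) (L (n j)) • n 1 +
      orthPart n (L (n j)) := by simp [orthPart]
    rw [e1, e2] at h1
    simp only [map_add, map_smul, inner_add_right, inner_smul_right,
      hperp i _ (hn.orthPart_mem _)] at h1
    linear_combination h1
  have heq : compression n L' = U * compression n L * U.conjTranspose := by
    rw [← hmul, Matrix.mul_assoc, hU', Matrix.mul_one]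
  constructor
  · rw [heq, Matrix.trace_mul_comm, ← Matrix.mul_assoc, hU, Matrix.one_mul]
  · rw [heq, Matrix.det_mul_comm, ← Matrix.mul_assoc, hU, Matrix.one_mul]

end Dispersion

/-! ### The first order matrix and the conical branches -/

section Dispersion

open Asymptotics

universe u
variable {E : Type u} [NormedAddCommGroup E] [InnerProductSpace ℂ E]

/-- `T` is, near `0`, a family of compact symmetric operators with first order term `L`. -/
structure IsCompactFamily (T : Plane → E →L[ℂ] E) (L : Plane →ₗ[ℝ] (E →L[ℂ] E)) : Prop where
  compact : ∀ᶠ δ in 𝓝 0, IsCompactOperator (T δ)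
  symm : ∀ᶠ δ in 𝓝 0, (T δ : E →ₗ[ℂ] E).IsSymmetric
  expand : (fun δ => T δ - T 0 - L δ) =o[𝓝 0] (fun δ => δ)

/-- The skew part of `L δ` is homogeneous in `δ`; it is also `o(δ)`, as all `T δ` near `0` are
symmetric. -/
theorem IsCompactFamily.symm_linear {T : Plane → E →L[ℂ] E} {L : Plane →ₗ[ℝ] (E →L[ℂ] E)}
    (h : IsCompactFamily T L) (δ : Plane) (u v : E) :
    inner ℂ (L δ u) v = inner ℂ u (L δ v) := by
  rw [← sub_eq_zero]
  refine eq_zero_of_homogeneous_isLittleO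
    (φ := fun δ => inner ℂ (L δ u) v - inner ℂ u (L δ v)) (fun t x => ?_) ?_ δ
  · simp only [map_smul, FunLike.coe_smul, Pi.smul_apply]
    rw [← Complex.coe_smul t, ← Complex.coe_smul t, inner_smul_left, inner_smul_right,
      Complex.conj_ofReal, Complex.real_smul]
    ring
  · refine IsBigO.trans_isLittleO ?_ h.expand
    refine IsBigO.of_bound (2 * (‖u‖ * ‖v‖)) ?_
    filter_upwards [h.symm] with x hx
    have h0 := h.symm.self_of_nhds u v
    have hx' := hx u v
    simp only [ContinuousLinearMap.coe_coe] at h0 hx'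
    set D := T x - T 0 - L x with hD
    have e : ∀ w, L x w = T x w - T 0 w - D w := fun w => by simp [hD]
    have e2 : inner ℂ (L x u) v - inner ℂ u (L x v) = inner ℂ u (D v) - inner ℂ (D u) v := by
      rw [e, e]
      simp only [inner_sub_left, inner_sub_right]
      rw [hx', h0]; ring
    rw [e2]
    refine (norm_sub_le _ _).trans ?_
    have k1 : ‖inner ℂ u (D v)‖ ≤ ‖u‖ * (‖D‖ * ‖v‖) :=
      (norm_inner_le_norm _ _).trans (by gcongr; exact D.le_opNorm v)
    have k2 : ‖inner ℂ (D u) v‖ ≤ (‖D‖ * ‖u‖) * ‖v‖ :=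
      (norm_inner_le_norm _ _).trans (by gcongr; exact D.le_opNorm u)
    nlinarith

theorem plane_eq (x : Plane) : x = x 0 • EuclideanSpace.single 0 1 + x 1 • EuclideanSpace.single 1 1 := by
  ext i; fin_cases i <;> simp

/-- Minus the determinant of the compressed first order term is a multiple of `‖δ‖²`. -/
theorem exists_coefficient {T : Plane → E →L[ℂ] E} {L : Plane →ₗ[ℝ] (E →L[ℂ] E)}
    (h : IsCompactFamily T L) {μ : ℝ} {n : Fin 2 → E}
    (hn : IsBasisPair (Module.End.eigenspace (T 0 : E →ₗ[ℂ] E) μ) n)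
    (R : E ≃ₗᵢ[ℂ] E) (hR0 : ∀ u, T 0 (R u) = R (T 0 u))
    (hRL : ∀ δ u, L (rotAdj δ) (R u) = R (L δ u)) :
    (∀ δ, inner ℂ (n 0) (L δ (n 0)) + inner ℂ (n 1) (L δ (n 1)) = (0 : ℂ)) ∧
    ∃ a : ℝ, 0 ≤ a ∧ ∀ δ, inner ℂ (n 0) (L δ (n 0)) ^ 2 +
        inner ℂ (n 0) (L δ (n 1)) * inner ℂ (n 1) (L δ (n 0)) = (((a * ‖δ‖) ^ 2 : ℝ) : ℂ) := by
  set N := Module.End.eigenspace (T 0 : E →ₗ[ℂ] E) (μ : ℂ) with hN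
  have hRN : ∀ u ∈ N, R u ∈ N := by
    intro u hu
    rw [hN, Module.End.mem_eigenspace_iff] at hu ⊢
    change T 0 u = _ at hu
    change T 0 (R u) = _
    rw [hR0, hu, map_smul]
  have hRN' : ∀ u ∈ N, R.symm u ∈ N := by
    intro u hu
    rw [hN, Module.End.mem_eigenspace_iff] at hu ⊢
    change T 0 u = _ at hu
    change T 0 (R.symm u) = _
    apply R.injective
    rw [← hR0, LinearIsometryEquiv.apply_symm_apply, hu, map_smul,
      LinearIsometryEquiv.apply_symm_apply]
  have hc := fun δ => compression_conj hn R hRN hRN' (hRL δ)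
  have entry_smul : ∀ (t : ℝ) (i j : Fin 2) δ, inner ℂ (n i) (L (t • δ) (n j)) =
      (t : ℂ) * inner ℂ (n i) (L δ (n j)) := by
    intro t i j δ
    rw [map_smul, FunLike.coe_smul, Pi.smul_apply, ← Complex.coe_smul t,
      inner_smul_right]
  have entry_add : ∀ (i j : Fin 2) δ δ', inner ℂ (n i) (L (δ + δ') (n j)) =
      inner ℂ (n i) (L δ (n j)) + inner ℂ (n i) (L δ' (n j)) := by
    intro i j δ δ'
    rw [map_add, add_apply, inner_add_right]
  have htr : ∀ δ, inner ℂ (n 0) (L δ (n 0)) + inner ℂ (n 1) (L δ (n 1)) = (0 : ℂ) := by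
    let φ : Plane →ₗ[ℝ] ℂ :=
      { toFun := fun δ => inner ℂ (n 0) (L δ (n 0)) + inner ℂ (n 1) (L δ (n 1))
        map_add' := fun x y => by simp only [entry_add]; ring
        map_smul' := fun t x => by
          simp only [entry_smul, RingHom.id_apply, Complex.real_smul]; ring }
    refine eq_zero_of_rotAdj_invariant φ fun x => ?_
    have := (hc x).1
    rw [Matrix.trace_fin_two, Matrix.trace_fin_two] at this
    exact this
  refine ⟨htr, ?_⟩
  have hconj : ∀ i j δ, inner ℂ (n i) (L δ (n j)) = starRingEnd ℂ (inner ℂ (n j) (L δ (n i))) := by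
    intro i j δ
    rw [inner_conj_symm, h.symm_linear]
  -- real-valued version
  have hdetc : ∀ δ, inner ℂ (n 0) (L δ (n 0)) ^ 2 +
      inner ℂ (n 0) (L δ (n 1)) * inner ℂ (n 1) (L δ (n 0)) = -(compression n (L δ)).det := by
    intro δ
    rw [Matrix.det_fin_two]
    simp only [compression, Matrix.of_apply]
    linear_combination (inner ℂ (n 0) (L δ (n 0))) * htr δ
  let e : Fin 2 → Plane := fun i => EuclideanSpace.single i 1
  let p : Fin 2 → ℝ := fun i => (inner ℂ (n 0) (L (e i) (n 0))).re
  let z : Fin 2 → ℂ := fun i => inner ℂ (n 0) (L (e i) (n 1))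
  have hre : ∀ δ, ((inner ℂ (n 0) (L δ (n 0))).re : ℂ) = inner ℂ (n 0) (L δ (n 0)) := fun δ =>
    Complex.conj_eq_iff_re.1 (hconj 0 0 δ).symm
  have hform : ∀ δ, inner ℂ (n 0) (L δ (n 0)) ^ 2 +
      inner ℂ (n 0) (L δ (n 1)) * inner ℂ (n 1) (L δ (n 0)) =
      (((p 0 ^ 2 + Complex.normSq (z 0)) * δ 0 ^ 2 +
        (2 * p 0 * p 1 + 2 * ((z 0).re * (z 1).re + (z 0).im * (z 1).im)) * (δ 0 * δ 1) +
        (p 1 ^ 2 + Complex.normSq (z 1)) * δ 1 ^ 2 : ℝ) : ℂ) := by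
    intro δ
    have e0 : inner ℂ (n 0) (L δ (n 0)) = ((δ 0 * p 0 + δ 1 * p 1 : ℝ) : ℂ) := by
      conv_lhs => rw [plane_eq δ, entry_add, entry_smul, entry_smul]
      rw [← hre, ← hre (EuclideanSpace.single 1 1)]
      push_cast; rfl
    have e1 : inner ℂ (n 0) (L δ (n 1)) = (δ 0 : ℂ) * z 0 + δ 1 * z 1 := by
      conv_lhs => rw [plane_eq δ, entry_add, entry_smul, entry_smul]
    rw [hconj 1 0, e0, e1, Complex.mul_conj]
    rw [← Complex.ofReal_pow, ← Complex.ofReal_add, Complex.ofReal_inj]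
    simp only [Complex.normSq_apply, Complex.add_re, Complex.add_im, Complex.mul_re,
      Complex.mul_im, Complex.ofReal_re, Complex.ofReal_im]
    ring
  -- Minus the determinant is `p(δ)² + |z(δ)|²`, with `p` the diagonal and `z` the off-diagonal
  -- entry. It is invariant because `R` conjugates the matrices at `x` and at `rotAdj x`.
  have hq := quadratic_eq_of_rotAdj_invariant (f := fun δ =>
      (p 0 ^ 2 + Complex.normSq (z 0)) * δ 0 ^ 2 +
        (2 * p 0 * p 1 + 2 * ((z 0).re * (z 1).re + (z 0).im * (z 1).im)) * (δ 0 * δ 1) +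
        (p 1 ^ 2 + Complex.normSq (z 1)) * δ 1 ^ 2) (fun _ => rfl) (fun x => by
      have h1 := hform (rotAdj x)
      rw [hdetc, (hc x).2, ← hdetc, hform] at h1
      exact (Complex.ofReal_injective h1).symm)
  -- The form is a sum of squares, so its value at the first unit vector is the square of a slope.
  refine ⟨√(p 0 ^ 2 + Complex.normSq (z 0)), Real.sqrt_nonneg _, fun δ => ?_⟩
  rw [hform, Complex.ofReal_inj, mul_pow, Real.sq_sqrt (by
    have := Complex.normSq_nonneg (z 0); positivity)]
  exact hq δ

/-- With a conjugation that reverses the first order term, the coefficient vanishes. -/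
theorem coefficient_eq_zero {T : Plane → E →L[ℂ] E} {L : Plane →ₗ[ℝ] (E →L[ℂ] E)}
    (h : IsCompactFamily T L) {n : Fin 2 → E} {C : E → E}
    (hinner : ∀ u v, inner ℂ (C u) (C v) = inner ℂ v u)
    (hCL : ∀ δ u, C (L δ u) = -L δ (C u)) (hn : ∀ i, C (n i) = n i) {a : ℝ}
    (ha : ∀ δ, inner ℂ (n 0) (L δ (n 0)) ^ 2 +
        inner ℂ (n 0) (L δ (n 1)) * inner ℂ (n 1) (L δ (n 0)) = (((a * ‖δ‖) ^ 2 : ℝ) : ℂ)) :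
    a = 0 := by
  -- In a basis fixed by `C`, the relation `C L = -L C` makes the matrix antisymmetric. As it is
  -- also Hermitian, its entries are imaginary.
  have hanti : ∀ i j δ, inner ℂ (n i) (L δ (n j)) = -inner ℂ (n j) (L δ (n i)) := by
    intro i j δ
    have h1 : inner ℂ (n j) (L δ (n i)) = inner ℂ (L δ (n j)) (n i) := (h.symm_linear δ _ _).symm
    rw [h1, ← hinner (n i), hCL, hn, hn, inner_neg_right, neg_neg]
  have h00 : ∀ δ, inner ℂ (n 0) (L δ (n 0)) = (0 : ℂ) := fun δ => by
    have := hanti 0 0 δ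
    linear_combination this / 2
  have hre : ∀ δ, (inner ℂ (n 0) (L δ (n 1))).re = 0 := by
    intro δ
    have h1 : inner ℂ (n 0) (L δ (n 1)) = starRingEnd ℂ (inner ℂ (n 1) (L δ (n 0))) := by
      rw [inner_conj_symm, h.symm_linear]
    rw [hanti 1 0] at h1
    have := congrArg Complex.re h1
    rw [Complex.conj_re, Complex.neg_re] at this
    linarith
  let s : Fin 2 → ℝ := fun i => (inner ℂ (n 0) (L (EuclideanSpace.single i 1) (n 1))).im
  -- The one remaining entry is `i` times a real linear form on the plane; on its kernel the cone
  -- has height zero.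
  obtain ⟨δ, hδ0, hδ⟩ : ∃ δ : Plane, δ ≠ 0 ∧ (inner ℂ (n 0) (L δ (n 1))).im = 0 := by
    have him : ∀ δ : Plane, (inner ℂ (n 0) (L δ (n 1))).im = δ 0 * s 0 + δ 1 * s 1 := by
      intro δ
      conv_lhs => rw [plane_eq δ, map_add, map_smul, map_smul, add_apply,
        FunLike.coe_smul, FunLike.coe_smul, Pi.smul_apply,
        Pi.smul_apply, inner_add_right, ← Complex.coe_smul (δ 0), ← Complex.coe_smul (δ 1),
        inner_smul_right, inner_smul_right]
      simp [s]
    by_cases hs : s 0 = 0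
    · exact ⟨!₂[1, 0], fun h0 => by simpa using congrArg (fun x : Plane => x 0) h0, by
        rw [him]; simp [hs]⟩
    · exact ⟨!₂[-s 1, s 0], fun h0 => hs (by simpa using congrArg (fun x : Plane => x 1) h0), by
        rw [him]; simp; ring⟩
  have h01 : inner ℂ (n 0) (L δ (n 1)) = (0 : ℂ) := Complex.ext (hre δ) hδ
  have := ha δ
  rw [h00, h01] at this
  have h4 : (a * ‖δ‖) ^ 2 = 0 := by
    apply Complex.ofReal_injective
    rw [← this]; simp
  have h5 := pow_eq_zero_iff (two_ne_zero) |>.1 h4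
  exact (mul_eq_zero.1 h5).resolve_right (norm_ne_zero_iff.2 hδ0)

/-- **Conical dispersion at a double eigenvalue.** -/
theorem exists_branches [CompleteSpace E] {T : Plane → E →L[ℂ] E} {L : Plane →ₗ[ℝ] (E →L[ℂ] E)}
    (h : IsCompactFamily T L) {μ : ℝ} (hμ : μ ≠ 0)
    (h2 : Module.finrank ℂ (Module.End.eigenspace (T 0 : E →ₗ[ℂ] E) μ) = 2) {n : Fin 2 → E}
    (hn : IsBasisPair (Module.End.eigenspace (T 0 : E →ₗ[ℂ] E) μ) n)
    (htr : ∀ δ, inner ℂ (n 0) (L δ (n 0)) + inner ℂ (n 1) (L δ (n 1)) = (0 : ℂ))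
    {a : ℝ} (ha0 : 0 ≤ a)
    (ha : ∀ δ, inner ℂ (n 0) (L δ (n 0)) ^ 2 +
        inner ℂ (n 0) (L δ (n 1)) * inner ℂ (n 1) (L δ (n 0)) = (((a * ‖δ‖) ^ 2 : ℝ) : ℂ)) :
    ∃ r > 0, ∃ ν : Plane → Fin 2 → ℝ,
      (∀ᶠ δ in 𝓝 0, ν δ 0 ≤ ν δ 1 ∧ ∀ w : ℂ, ‖w - μ‖ < r →
        Module.finrank ℂ (Module.End.eigenspace (T δ : E →ₗ[ℂ] E) w) =
          (if w = ν δ 0 then 1 else 0) + (if w = ν δ 1 then 1 else 0)) ∧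
      (fun δ => ν δ 1 - μ - a * ‖δ‖) =o[𝓝 0] (fun δ => ‖δ‖) ∧
      (fun δ => ν δ 0 - μ + a * ‖δ‖) =o[𝓝 0] (fun δ => ‖δ‖) := by
  have hs0 := h.symm.self_of_nhds
  obtain ⟨ρ, hρ, hgap⟩ := exists_gap h.compact.self_of_nhds hs0 hμ
  have hLO : (fun δ => L δ) =O[𝓝 0] (fun δ : Plane => δ) :=
    (LinearMap.toContinuousLinearMap L).isBigO_id _
  have hTO : (fun δ => T δ - T 0) =O[𝓝 0] (fun δ : Plane => δ) := by
    have := h.expand.isBigO.add hLO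
    simpa using this
  have hsmall : ∀ᶠ δ in 𝓝 0, ‖T δ - T 0‖ ≤ ρ / 8 := by
    have h1 : Tendsto (fun δ => T δ - T 0) (𝓝 0) (𝓝 0) := hTO.trans_tendsto tendsto_id
    have h3 := h1.norm
    rw [norm_zero] at h3
    exact (h3.eventually (gt_mem_nhds (by positivity : 0 < ρ / 8))).mono fun _ h => h.le
  -- The error of `eigenvalue_pair_estimate`: a product of two terms `O(δ)` plus a term `o(δ)`.
  let Rr : Plane → ℝ := fun δ => ‖L δ‖ * (2 / ρ * ‖T δ - T 0‖) + ‖T δ - T 0 - L δ‖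
  have hRo : Rr =o[𝓝 0] (fun δ : Plane => ‖δ‖) := by
    refine IsLittleO.add ?_ (h.expand.norm_left.norm_right)
    have h1 : (fun δ => ‖L δ‖ * (2 / ρ * ‖T δ - T 0‖)) =O[𝓝 0] (fun δ : Plane => ‖δ‖ * ‖δ‖) :=
      hLO.norm_left.norm_right.mul (hTO.norm_left.norm_right.const_mul_left _)
    refine h1.trans_isLittleO ?_
    have h3 : (fun δ : Plane => ‖δ‖) =o[𝓝 0] (fun _ : Plane => (1 : ℝ)) := by
      rw [isLittleO_one_iff]
      simpa using (continuous_norm (E := Plane)).tendsto 0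
    simpa using h3.mul_isBigO (isBigO_refl (fun δ : Plane => ‖δ‖) (𝓝 0))
  have hev : ∀ᶠ δ in 𝓝 (0 : Plane), ∃ ν : Fin 2 → ℝ, (ν 0 ≤ ν 1 ∧ ∀ w : ℂ, ‖w - μ‖ < ρ / 2 →
        Module.finrank ℂ (Module.End.eigenspace (T δ : E →ₗ[ℂ] E) w) =
          (if w = ν 0 then 1 else 0) + (if w = ν 1 then 1 else 0)) ∧
      |(ν 0 - μ) + (ν 1 - μ)| ≤ 8 * Rr δ ∧
      ∀ j, |(ν j - μ) ^ 2 - (a * ‖δ‖) ^ 2| ≤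
        2 * ((2 * ‖T δ - T 0‖ + 2 * ‖L δ‖) * Rr δ) := by
    filter_upwards [hsmall, h.compact, h.symm] with δ hδ hc hs
    obtain ⟨x, ν, hx, hTx, hν, hle, hw⟩ := exists_two_eigenvectors hc hs hρ hgap h2 hδ
    obtain ⟨k1, k2⟩ := eigenvalue_pair_estimate (L := L δ) hs0 hρ hn hgap hδ hx hTx hν (htr δ)
    refine ⟨ν, ⟨hle, fun w hw' => (hw w hw').2⟩, k1, fun j => ?_⟩
    have := k2 j
    rw [ha, ← Complex.ofReal_sub, Complex.norm_real] at this
    exact this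
  obtain ⟨ν, hν⟩ := hev.choice
  have hsum : (fun δ => (ν δ 0 - μ) + (ν δ 1 - μ)) =o[𝓝 0] (fun δ : Plane => ‖δ‖) := by
    refine IsBigO.trans_isLittleO (IsBigO.of_bound 8 ?_) hRo
    filter_upwards [hν] with δ hδ
    rw [Real.norm_eq_abs, Real.norm_eq_abs]
    exact hδ.2.1.trans (by gcongr; exact le_abs_self _)
  have hsq : ∀ j, (fun δ => (ν δ j - μ) ^ 2 - (a * ‖δ‖) ^ 2) =o[𝓝 0]
      (fun δ : Plane => ‖δ‖ ^ 2) := by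
    intro j
    have h1 : (fun δ => (2 * ‖T δ - T 0‖ + 2 * ‖L δ‖)) =O[𝓝 0] (fun δ : Plane => ‖δ‖) :=
      (hTO.norm_left.norm_right.const_mul_left 2).add (hLO.norm_left.norm_right.const_mul_left 2)
    have h3 := (h1.mul_isLittleO hRo).const_mul_left 2
    simp only [← sq] at h3
    refine IsBigO.trans_isLittleO (IsBigO.of_bound 1 ?_) h3
    filter_upwards [hν] with δ hδ
    rw [Real.norm_eq_abs, Real.norm_eq_abs, one_mul]
    exact (hδ.2.2 j).trans (le_abs_self _)
  -- For nonnegative `s` and `t`, `(s - t)² ≤ |s² - t²|`. Thus closeness of the squares to order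
  -- `o(‖δ‖²)` gives closeness to order `o(‖δ‖)`, also when `a = 0`.
  have habs : ∀ j, (fun δ => |ν δ j - μ| - a * ‖δ‖) =o[𝓝 0] (fun δ : Plane => ‖δ‖) := by
    intro j
    refine IsLittleO.of_pow (n := 2) ?_ two_ne_zero
    refine IsBigO.trans_isLittleO (IsBigO.of_bound 1 (Eventually.of_forall fun δ => ?_)) (hsq j)
    have hab : 0 ≤ a * ‖δ‖ := by positivity
    simp only [Pi.pow_apply, Real.norm_eq_abs, one_mul]
    have hA := abs_nonneg (ν δ j - μ)
    have hle : |(|ν δ j - μ| - a * ‖δ‖)| ≤ |ν δ j - μ| + a * ‖δ‖ := by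
      rw [abs_le]; constructor <;> linarith
    calc |(|ν δ j - μ| - a * ‖δ‖) ^ 2|
        = |(|ν δ j - μ| - a * ‖δ‖)| * |(|ν δ j - μ| - a * ‖δ‖)| := by rw [sq, abs_mul]
      _ ≤ (|ν δ j - μ| + a * ‖δ‖) * |(|ν δ j - μ| - a * ‖δ‖)| := by gcongr
      _ = |(ν δ j - μ) ^ 2 - (a * ‖δ‖) ^ 2| := by
        rw [← sq_abs (ν δ j - μ), sq_sub_sq, abs_mul, abs_of_nonneg (add_nonneg hA hab)]
  -- The signs come from the ordering and from the sum of the shifts. If the larger shift is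
  -- nonpositive, both are, and the small sum controls their sizes; the case of a nonnegative
  -- smaller shift is symmetric.
  refine ⟨ρ / 2, by positivity, ν, hν.mono fun δ hδ => hδ.1, ?_, ?_⟩
  · have h3 := (habs 1).norm_left.add hsum.norm_left
    refine IsBigO.trans_isLittleO (IsBigO.of_bound 1 ?_) h3
    filter_upwards [hν] with δ hδ
    have hle := hδ.1.1
    simp only [Real.norm_eq_abs, one_mul]
    rw [abs_of_nonneg (by positivity : 0 ≤ |(|ν δ 1 - μ| - a * ‖δ‖)| + |ν δ 0 - μ + (ν δ 1 - μ)|)]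
    rcases le_total 0 (ν δ 1 - μ) with h0 | h0
    · rw [abs_of_nonneg h0]
      linarith [abs_nonneg (ν δ 0 - μ + (ν δ 1 - μ))]
    · rw [abs_of_nonpos h0, abs_of_nonpos (by linarith : ν δ 0 - μ + (ν δ 1 - μ) ≤ 0)]
      rw [abs_le]
      have := abs_le.1 (le_refl |-(ν δ 1 - μ) - a * ‖δ‖|)
      constructor <;> linarith
  · have h3 := (habs 0).norm_left.add hsum.norm_left
    refine IsBigO.trans_isLittleO (IsBigO.of_bound 1 ?_) h3
    filter_upwards [hν] with δ hδ
    have hle := hδ.1.1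
    simp only [Real.norm_eq_abs, one_mul]
    rw [abs_of_nonneg (by positivity : 0 ≤ |(|ν δ 0 - μ| - a * ‖δ‖)| + |ν δ 0 - μ + (ν δ 1 - μ)|)]
    rcases le_total 0 (ν δ 0 - μ) with h0 | h0
    · rw [abs_of_nonneg h0, abs_of_nonneg (by linarith : 0 ≤ ν δ 0 - μ + (ν δ 1 - μ))]
      rw [abs_le]
      have := abs_le.1 (le_refl |(ν δ 0 - μ) - a * ‖δ‖|)
      constructor <;> linarith
    · rw [abs_of_nonpos h0]
      have h4 : |ν δ 0 - μ + a * ‖δ‖| = |-(ν δ 0 - μ) - a * ‖δ‖| := by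
        rw [← abs_neg]; congr 1; ring
      rw [h4]
      linarith [abs_nonneg (ν δ 0 - μ + (ν δ 1 - μ))]

end Dispersion

/-! ### From functions on the plane to the cell: translations, extension, symmetries -/

section Lattice

/-! ### The action of the lattice -/

/-- Shifts written as a group action make the theory of fundamental domains available for the cell.
-/
instance latticeAction : AddAction (ℤ × ℤ) Plane where
  vadd g x := shift g.1 g.2 x
  zero_vadd x := by
    change shift _ _ x = x
    simp [shift]
  add_vadd g h x := by
    change shift _ _ x = shift _ _ (shift _ _ x)
    simp only [shift, Prod.fst_add, Prod.snd_add, Int.cast_add]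
    module

theorem vadd_def (g : ℤ × ℤ) (x : Plane) : g +ᵥ x = shift g.1 g.2 x := rfl

theorem vadd_eq_add (g : ℤ × ℤ) (x : Plane) : g +ᵥ x = x + ((g.1 : ℝ) • a₁ + (g.2 : ℝ) • a₂) := rfl

theorem inner_plane (x y : Plane) : inner ℝ x y = x 0 * y 0 + x 1 * y 1 := by
  simp [PiLp.inner_apply, Fin.sum_univ_two, mul_comm]

theorem sqrt_three_mul_self : √3 * √3 = 3 := Real.mul_self_sqrt (by norm_num)

theorem inv_sqrt_three_mul : 1 / √3 * (√3 / 2) = 1 / 2 := by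
  have : √3 ≠ 0 := by positivity
  field_simp

theorem inner_b₁_a₁ : inner ℝ b₁ a₁ = 1 := by
  rw [inner_plane]; simp only [b₁, a₁]; simp
  have := inv_sqrt_three_mul
  rw [one_div] at this
  rw [this]; norm_num
theorem inner_b₁_a₂ : inner ℝ b₁ a₂ = 0 := by
  rw [inner_plane]; simp only [b₁, a₂]; simp
  have := inv_sqrt_three_mul
  rw [one_div] at this
  rw [this]; norm_num
theorem inner_b₂_a₁ : inner ℝ b₂ a₁ = 0 := by
  rw [inner_plane]; simp only [b₂, a₁]; simp
  have := inv_sqrt_three_mul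
  rw [one_div] at this
  rw [this]; norm_num
theorem inner_b₂_a₂ : inner ℝ b₂ a₂ = 1 := by
  rw [inner_plane]; simp only [b₂, a₂]; simp
  have := inv_sqrt_three_mul
  rw [one_div] at this
  rw [this]; norm_num

theorem inner_b₁_vadd (g : ℤ × ℤ) (x : Plane) : inner ℝ b₁ (g +ᵥ x) = inner ℝ b₁ x + g.1 := by
  rw [vadd_eq_add, inner_add_right, inner_add_right, inner_smul_right, inner_smul_right,
    inner_b₁_a₁, inner_b₁_a₂]; ring

theorem inner_b₂_vadd (g : ℤ × ℤ) (x : Plane) : inner ℝ b₂ (g +ᵥ x) = inner ℝ b₂ x + g.2 := by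
  rw [vadd_eq_add, inner_add_right, inner_add_right, inner_smul_right, inner_smul_right,
    inner_b₂_a₁, inner_b₂_a₂]; ring

/-- The lattice coordinates of the cell that contains `x`. -/
def floorPt (x : Plane) : ℤ × ℤ := (⌊inner ℝ b₁ x⌋, ⌊inner ℝ b₂ x⌋)

/-- The representative of `x` in the fundamental domain. -/
def basePt (x : Plane) : Plane := -floorPt x +ᵥ x

theorem mem_cell_iff (x : Plane) : x ∈ cell ↔ floorPt x = 0 := by
  simp only [cell, floorPt, Set.mem_Ico, Prod.ext_iff, Prod.fst_zero, Prod.snd_zero,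
    Int.floor_eq_zero_iff]
  rfl

theorem floorPt_vadd (g : ℤ × ℤ) (x : Plane) : floorPt (g +ᵥ x) = floorPt x + g := by
  simp only [floorPt, inner_b₁_vadd, inner_b₂_vadd, Int.floor_add_intCast]
  rfl

theorem basePt_mem (x : Plane) : basePt x ∈ cell := by
  rw [mem_cell_iff, basePt, floorPt_vadd, add_neg_cancel]

theorem basePt_vadd (g : ℤ × ℤ) (x : Plane) : basePt (g +ᵥ x) = basePt x := by
  rw [basePt, basePt, floorPt_vadd, vadd_vadd]
  congr 1
  abel

theorem basePt_of_mem {x : Plane} (h : x ∈ cell) : basePt x = x := by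
  rw [mem_cell_iff] at h
  rw [basePt, h, neg_zero, zero_vadd]

theorem vadd_mem_cell_iff (g : ℤ × ℤ) (x : Plane) : g +ᵥ x ∈ cell ↔ g = -floorPt x := by
  rw [mem_cell_iff, floorPt_vadd, add_comm, add_eq_zero_iff_eq_neg]

instance : MeasurableConstVAdd (ℤ × ℤ) Plane where
  measurable_const_vadd g := by
    have : (fun x : Plane => g +ᵥ x) = fun x => x + ((g.1 : ℝ) • a₁ + (g.2 : ℝ) • a₂) := rfl
    rw [this]
    fun_prop

theorem measurableSet_cell : MeasurableSet cell := by
  have h1 : Measurable fun x : Plane => inner ℝ b₁ x := by fun_prop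
  have h2 : Measurable fun x : Plane => inner ℝ b₂ x := by fun_prop
  exact (h1 measurableSet_Ico).inter (h2 measurableSet_Ico)

theorem isAddFundamentalDomain_cell (μ : Measure Plane) :
    IsAddFundamentalDomain (ℤ × ℤ) cell μ :=
  IsAddFundamentalDomain.mk' measurableSet_cell.nullMeasurableSet fun x =>
    ⟨-floorPt x, (vadd_mem_cell_iff _ _).2 rfl, fun _ h => (vadd_mem_cell_iff _ _).1 h⟩

/-- Finitely many cells cover a compact set. -/
theorem finite_floorPt_image {C : Set Plane} (hC : IsCompact C) : (floorPt '' C).Finite := by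
  have h : ∀ b : Plane, ((fun x : Plane => ⌊inner ℝ b x⌋) '' C).Finite := by
    intro b
    have hc : Continuous fun x : Plane => inner ℝ b x := by fun_prop
    obtain ⟨u, hu⟩ := (hC.image hc).bddAbove
    obtain ⟨l, hl⟩ := (hC.image hc).bddBelow
    refine (Set.finite_Icc ⌊l⌋ ⌊u⌋).subset ?_
    rintro _ ⟨x, hx, rfl⟩
    exact ⟨Int.floor_mono (hl ⟨x, hx, rfl⟩), Int.floor_mono (hu ⟨x, hx, rfl⟩)⟩
  refine ((h b₁).prod (h b₂)).subset ?_
  rintro _ ⟨x, hx, rfl⟩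
  exact ⟨⟨x, hx, rfl⟩, ⟨x, hx, rfl⟩⟩

/-! ### Bloch functions -/

/-- The character `exp (i (m k₁ + n k₂))` of the lattice. -/
def phase (k : Fin 2 → ℝ) (g : ℤ × ℤ) : ℂ := Complex.exp (Complex.I * (g.1 * k 0 + g.2 * k 1))

theorem phase_eq (k : Fin 2 → ℝ) (g : ℤ × ℤ) :
    phase k g = Complex.exp ((g.1 * k 0 + g.2 * k 1 : ℝ) * Complex.I) := by
  rw [phase]; push_cast; ring_nf

theorem norm_phase (k : Fin 2 → ℝ) (g : ℤ × ℤ) : ‖phase k g‖ = 1 := by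
  rw [phase_eq, Complex.norm_exp_ofReal_mul_I]

theorem phase_ne_zero (k : Fin 2 → ℝ) (g : ℤ × ℤ) : phase k g ≠ 0 := Complex.exp_ne_zero _

theorem phase_add (k : Fin 2 → ℝ) (g h : ℤ × ℤ) : phase k (g + h) = phase k g * phase k h := by
  rw [phase, phase, phase, ← Complex.exp_add]
  congr 1
  simp only [Prod.fst_add, Prod.snd_add, Int.cast_add]; ring

theorem phase_zero (k : Fin 2 → ℝ) : phase k 0 = 1 := by simp [phase]

theorem conj_phase (k : Fin 2 → ℝ) (g : ℤ × ℤ) : starRingEnd ℂ (phase k g) = phase k (-g) := by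
  rw [phase, phase, ← Complex.exp_conj]
  congr 1
  simp; ring

/-- `ψ` satisfies the Floquet condition at every point. -/
def IsQuasiPeriodic (k : Fin 2 → ℝ) (ψ : Plane → ℂ) : Prop :=
  ∀ (g : ℤ × ℤ) x, ψ (g +ᵥ x) = phase k g * ψ x

/-- The extension of a function on the cell that satisfies the Floquet condition. -/
def ext (k : Fin 2 → ℝ) (f : Plane → ℂ) (x : Plane) : ℂ := phase k (floorPt x) * f (basePt x)

theorem isQuasiPeriodic_ext (k : Fin 2 → ℝ) (f : Plane → ℂ) : IsQuasiPeriodic k (ext k f) := by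
  intro g x
  rw [ext, ext, floorPt_vadd, basePt_vadd, add_comm, phase_add, mul_assoc]

theorem ext_of_mem (k : Fin 2 → ℝ) (f : Plane → ℂ) {x : Plane} (hx : x ∈ cell) :
    ext k f x = f x := by
  rw [ext, basePt_of_mem hx, (mem_cell_iff x).1 hx, phase_zero, one_mul]

theorem ext_ae_cell (μ : Measure Plane) (k : Fin 2 → ℝ) (f : Plane → ℂ) :
    ext k f =ᵐ[μ.restrict cell] f := by
  rw [EventuallyEq, ae_restrict_iff' measurableSet_cell]
  exact Eventually.of_forall fun x hx => ext_of_mem k f hx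

variable {μ : Measure Plane} [VAddInvariantMeasure (ℤ × ℤ) Plane μ]

theorem ae_vadd {p : Plane → Prop} (h : ∀ᵐ x ∂μ, p x) : ∀ᵐ x ∂μ, ∀ g : ℤ × ℤ, p (g +ᵥ x) :=
  ae_all_iff.2 fun g => (measurePreserving_vadd g μ).quasiMeasurePreserving.ae h

omit [VAddInvariantMeasure (ℤ × ℤ) Plane μ] in
theorem ae_quasiPeriodic {k : Fin 2 → ℝ} {ψ : Plane → ℂ} (h : ψ ∈ blochSpace μ k) :
    ∀ᵐ x ∂μ, ∀ g : ℤ × ℤ, ψ (g +ᵥ x) = phase k g * ψ x :=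
  ae_all_iff.2 fun g => h.2 g.1 g.2

/-- Every point has a translate in the cell, the group is countable and its action preserves null
sets; the common phase can be cancelled. -/
theorem ae_eq_of_ae_eq_cell {k : Fin 2 → ℝ} {ψ φ : Plane → ℂ}
    (hψ : ∀ᵐ x ∂μ, ∀ g : ℤ × ℤ, ψ (g +ᵥ x) = phase k g * ψ x)
    (hφ : ∀ᵐ x ∂μ, ∀ g : ℤ × ℤ, φ (g +ᵥ x) = phase k g * φ x)
    (h : ψ =ᵐ[μ.restrict cell] φ) : ψ =ᵐ[μ] φ := by
  rw [EventuallyEq, ae_restrict_iff' measurableSet_cell] at h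
  filter_upwards [hψ, hφ, ae_vadd h] with x h1 h2 h3
  have := h3 (-floorPt x) (basePt_mem x)
  rw [h1, h2] at this
  exact mul_left_cancel₀ (phase_ne_zero _ _) this

omit [VAddInvariantMeasure (ℤ × ℤ) Plane μ] in
theorem IsQuasiPeriodic.ae {k : Fin 2 → ℝ} {ψ : Plane → ℂ} (h : IsQuasiPeriodic k ψ) :
    ∀ᵐ x ∂μ, ∀ g : ℤ × ℤ, ψ (g +ᵥ x) = phase k g * ψ x :=
  Eventually.of_forall fun x g => h g x

theorem ext_ae_eq {k : Fin 2 → ℝ} {ψ f : Plane → ℂ}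
    (hψ : ∀ᵐ x ∂μ, ∀ g : ℤ × ℤ, ψ (g +ᵥ x) = phase k g * ψ x)
    (h : ψ =ᵐ[μ.restrict cell] f) : ψ =ᵐ[μ] ext k f :=
  ae_eq_of_ae_eq_cell hψ (isQuasiPeriodic_ext k f).ae (h.trans (ext_ae_cell μ k f).symm)

theorem iUnion_vadd_cell : (⋃ g : ℤ × ℤ, (fun x : Plane => -g +ᵥ x) ⁻¹' cell) = Set.univ := by
  rw [Set.eq_univ_iff_forall]
  exact fun x => Set.mem_iUnion.2 ⟨floorPt x, basePt_mem x⟩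

theorem IsQuasiPeriodic.memLp_translate {k : Fin 2 → ℝ} {ψ : Plane → ℂ}
    (h : IsQuasiPeriodic k ψ) (hm : MemLp ψ 2 (μ.restrict cell)) (g : ℤ × ℤ) :
    MemLp ψ 2 (μ.restrict ((fun x : Plane => -g +ᵥ x) ⁻¹' cell)) := by
  have h1 := hm.comp_measurePreserving
    ((measurePreserving_vadd (-g) μ).restrict_preimage measurableSet_cell)
  have h2 : ψ = phase k g • (ψ ∘ fun x : Plane => -g +ᵥ x) := by
    ext x
    simp only [Pi.smul_apply, Function.comp, smul_eq_mul]
    rw [h, ← mul_assoc, ← phase_add, add_neg_cancel, phase_zero, one_mul]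
  rw [h2]
  exact h1.const_smul _

theorem IsQuasiPeriodic.aestronglyMeasurable {k : Fin 2 → ℝ} {ψ : Plane → ℂ}
    (h : IsQuasiPeriodic k ψ) (hm : MemLp ψ 2 (μ.restrict cell)) : AEStronglyMeasurable ψ μ := by
  rw [← Measure.restrict_univ (μ := μ), ← iUnion_vadd_cell, aestronglyMeasurable_iUnion_iff]
  exact fun g => (h.memLp_translate hm g).1

/-- A compact set meets finitely many translates of the cell, and on each of them the function is
its restriction to the cell up to a phase. -/
theorem IsQuasiPeriodic.locL2 {k : Fin 2 → ℝ} {ψ : Plane → ℂ}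
    (h : IsQuasiPeriodic k ψ) (hm : MemLp ψ 2 (μ.restrict cell)) : LocL2 μ ψ := by
  intro C hC
  have hm' := h.aestronglyMeasurable hm
  rw [memLp_two_iff_integrable_sq_norm hm'.restrict]
  have hsub : C ⊆ ⋃ g ∈ (finite_floorPt_image hC).toFinset,
      (fun x : Plane => -g +ᵥ x) ⁻¹' cell := by
    intro x hx
    rw [Set.mem_iUnion₂]
    exact ⟨floorPt x, by simpa using ⟨x, hx, rfl⟩, basePt_mem x⟩
  refine IntegrableOn.mono_set ?_ hsub
  rw [integrableOn_finset_iUnion]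
  intro g _
  exact (memLp_two_iff_integrable_sq_norm hm'.restrict).1 (h.memLp_translate hm g)

theorem IsQuasiPeriodic.mem_blochSpace {k : Fin 2 → ℝ} {ψ : Plane → ℂ}
    (h : IsQuasiPeriodic k ψ) (hm : MemLp ψ 2 (μ.restrict cell)) : ψ ∈ blochSpace μ k :=
  ⟨h.locL2 hm, fun m n => Eventually.of_forall fun x => h (m, n) x⟩

/-! ### Symmetries acting on the cell space -/

/-- `L²` of the fundamental domain. -/
abbrev CellL2 (μ : Measure Plane) : Type := Lp ℂ 2 (μ.restrict cell)

omit [VAddInvariantMeasure (ℤ × ℤ) Plane μ] in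
theorem memLp_ext (k : Fin 2 → ℝ) (f : CellL2 μ) : MemLp (ext k f) 2 (μ.restrict cell) :=
  (memLp_congr_ae (ext_ae_cell μ k f)).2 (Lp.memLp f)

theorem ext_mem_blochSpace (k : Fin 2 → ℝ) (f : CellL2 μ) : ext k f ∈ blochSpace μ k :=
  (isQuasiPeriodic_ext k f).mem_blochSpace (memLp_ext k f)

omit [VAddInvariantMeasure (ℤ × ℤ) Plane μ] in
theorem eq_of_ext_ae_eq {k : Fin 2 → ℝ} {f g : CellL2 μ} (h : ext k f =ᵐ[μ] ext k g) : f = g :=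
  Lp.ext (((ext_ae_cell μ k f).symm.trans (ae_restrict_of_ae h)).trans (ext_ae_cell μ k g))

theorem ext_congr_of_ae {k : Fin 2 → ℝ} {f g : Plane → ℂ} (h : f =ᵐ[μ.restrict cell] g) :
    ext k f =ᵐ[μ] ext k g :=
  ext_ae_eq (isQuasiPeriodic_ext k f).ae ((ext_ae_cell μ k f).trans h)

theorem ext_add_ae (k : Fin 2 → ℝ) (f g : CellL2 μ) :
    ext k (f + g : CellL2 μ) =ᵐ[μ] ext k f + ext k g := by
  refine (ext_congr_of_ae (Lp.coeFn_add f g)).trans (Eventually.of_forall fun x => ?_)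
  simp only [ext, Pi.add_apply]; ring

theorem ext_smul_ae (k : Fin 2 → ℝ) (c : ℂ) (f : CellL2 μ) :
    ext k (c • f : CellL2 μ) =ᵐ[μ] c • ext k f := by
  refine (ext_congr_of_ae (Lp.coeFn_smul c f)).trans (Eventually.of_forall fun x => ?_)
  simp only [ext, Pi.smul_apply, smul_eq_mul]; ring

/-- The map `ψ ↦ σ ∘ ψ ∘ T` preserves the Bloch functions of quasimomentum `k`. -/
structure BlochSymm (μ : Measure Plane) (k : Fin 2 → ℝ) (σ : ℂ →+* ℂ) (T : Plane → Plane) :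
    Prop where
  sigma : σ = RingHom.id ℂ ∨ σ = starRingEnd ℂ
  emb : MeasurableEmbedding T
  mp : MeasurePreserving T μ μ
  -- `T` normalises the lattice, and `σ` has to compensate for the resulting change of the character
  -- of `k`.
  lattice : ∃ e : (ℤ × ℤ) ≃ (ℤ × ℤ), ∀ g, (∀ x, T (e g +ᵥ x) = g +ᵥ T x) ∧
    σ (phase k g) = phase k (e g)

namespace BlochSymm

variable {k : Fin 2 → ℝ} {σ : ℂ →+* ℂ} {T : Plane → Plane}

omit [VAddInvariantMeasure (ℤ × ℤ) Plane μ] in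
theorem norm_sigma (h : BlochSymm μ k σ T) (z : ℂ) : ‖σ z‖ = ‖z‖ := by
  rcases h.sigma with rfl | rfl <;> simp

omit [VAddInvariantMeasure (ℤ × ℤ) Plane μ] in
theorem continuous_sigma (h : BlochSymm μ k σ T) : Continuous σ := by
  rcases h.sigma with rfl | rfl
  · exact continuous_id
  · exact Complex.continuous_conj

omit [VAddInvariantMeasure (ℤ × ℤ) Plane μ] in
theorem sigma_sigma (h : BlochSymm μ k σ T) (z : ℂ) : σ (σ z) = z := by
  rcases h.sigma with rfl | rfl <;> simp

omit [VAddInvariantMeasure (ℤ × ℤ) Plane μ] in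
theorem sigma_ofReal (h : BlochSymm μ k σ T) (c : ℝ) : σ c = c := by
  rcases h.sigma with rfl | rfl <;> simp

omit [VAddInvariantMeasure (ℤ × ℤ) Plane μ] in
theorem isQuasiPeriodic (h : BlochSymm μ k σ T) {ψ : Plane → ℂ} (hψ : IsQuasiPeriodic k ψ) :
    IsQuasiPeriodic k fun x => σ (ψ (T x)) := by
  obtain ⟨e, he⟩ := h.lattice
  intro g x
  have h1 := (he (e.symm g)).1 x
  have h2 := (he (e.symm g)).2
  rw [e.apply_symm_apply] at h1 h2
  simp only [h1, hψ _ _, map_mul, h2]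

omit [VAddInvariantMeasure (ℤ × ℤ) Plane μ] in
theorem isAddFundamentalDomain (h : BlochSymm μ k σ T) :
    IsAddFundamentalDomain (ℤ × ℤ) (T ⁻¹' cell) μ := by
  obtain ⟨e, he⟩ := h.lattice
  exact (isAddFundamentalDomain_cell μ).preimage_of_equiv h.mp.quasiMeasurePreserving e.bijective
    fun g x => (he g).1 x

theorem setIntegral_comp (h : BlochSymm μ k σ T) {G : Plane → ℂ}
    (hG : ∀ (g : ℤ × ℤ) x, G (g +ᵥ x) = G x) :
    ∫ x in cell, G (T x) ∂μ = ∫ x in cell, G x ∂μ := by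
  obtain ⟨e, he⟩ := h.lattice
  rw [← h.mp.setIntegral_preimage_emb h.emb G cell]
  refine (isAddFundamentalDomain_cell μ).setIntegral_eq h.isAddFundamentalDomain fun g x => ?_
  have h1 := (he (e.symm g)).1 x
  rw [e.apply_symm_apply] at h1
  rw [h1, hG]

theorem memLp (h : BlochSymm μ k σ T) (f : CellL2 μ) :
    MemLp (fun x => σ (ext k f (T x))) 2 (μ.restrict cell) := by
  have hq := isQuasiPeriodic_ext k f
  have hq' := h.isQuasiPeriodic hq
  have hm := hq.aestronglyMeasurable (memLp_ext k f)
  have hm' : AEStronglyMeasurable (fun x => σ (ext k f (T x))) μ :=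
    h.continuous_sigma.comp_aestronglyMeasurable (hm.comp_measurePreserving h.mp)
  rw [memLp_two_iff_integrable_sq_norm hm'.restrict]
  change IntegrableOn _ cell μ
  rw [(isAddFundamentalDomain_cell μ).integrableOn_iff h.isAddFundamentalDomain]
  · simp only [h.norm_sigma]
    have := (memLp_two_iff_integrable_sq_norm hm.restrict).1 (memLp_ext k f)
    exact (h.mp.integrableOn_comp_preimage h.emb).2 this
  · intro g x
    have := hq' g x
    simp only at this
    rw [this, norm_mul, norm_phase, one_mul]

/-- The operator `ψ ↦ σ ∘ ψ ∘ T`, in terms of the restrictions to the cell. -/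
def op (h : BlochSymm μ k σ T) (f : CellL2 μ) : CellL2 μ := (h.memLp f).toLp _

theorem ext_op (h : BlochSymm μ k σ T) (f : CellL2 μ) :
    ext k (h.op f) =ᵐ[μ] fun x => σ (ext k f (T x)) :=
  (ext_ae_eq (h.isQuasiPeriodic (isQuasiPeriodic_ext k f)).ae (h.memLp f).coeFn_toLp.symm).symm

theorem op_add (h : BlochSymm μ k σ T) (f g : CellL2 μ) : h.op (f + g) = h.op f + h.op g := by
  apply eq_of_ext_ae_eq (k := k)
  filter_upwards [h.ext_op (f + g), h.ext_op f, h.ext_op g, ext_add_ae k (h.op f) (h.op g),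
    h.mp.quasiMeasurePreserving.ae (ext_add_ae k f g)] with x h1 h2 h3 h4 h5
  rw [h1, h5, h4, Pi.add_apply, Pi.add_apply, h2, h3, map_add]

theorem op_smul (h : BlochSymm μ k σ T) (c : ℂ) (f : CellL2 μ) :
    h.op (c • f) = σ c • h.op f := by
  apply eq_of_ext_ae_eq (k := k)
  filter_upwards [h.ext_op (c • f), h.ext_op f, ext_smul_ae k (σ c) (h.op f),
    h.mp.quasiMeasurePreserving.ae (ext_smul_ae k c f)] with x h1 h2 h4 h5
  rw [h1, h5, h4, Pi.smul_apply, Pi.smul_apply, h2, smul_eq_mul, smul_eq_mul, map_mul]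

/-- The phases cancel in `conj f * g`, so the integrand is periodic and `setIntegral_comp` applies.
-/
theorem inner_op (h : BlochSymm μ k σ T) (f g : CellL2 μ) :
    inner ℂ (h.op f) (h.op g) = σ (inner ℂ f g) := by
  have e1 : inner ℂ (h.op f) (h.op g) =
      ∫ x in cell, σ (starRingEnd ℂ (ext k f (T x)) * ext k g (T x)) ∂μ := by
    rw [L2.inner_def]
    refine integral_congr_ae ?_
    filter_upwards [(h.memLp f).coeFn_toLp, (h.memLp g).coeFn_toLp] with x h1 h2
    have h1' : h.op f x = σ (ext k f (T x)) := h1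
    have h2' : h.op g x = σ (ext k g (T x)) := h2
    rw [h1', h2', RCLike.inner_apply', map_mul]
    rcases h.sigma with rfl | rfl <;> simp
  have e2 : inner ℂ f g = ∫ x in cell, starRingEnd ℂ (ext k f x) * ext k g x ∂μ := by
    rw [L2.inner_def]
    refine integral_congr_ae ?_
    filter_upwards [ext_ae_cell μ k f, ext_ae_cell μ k g] with x h1 h2
    rw [h1, h2, RCLike.inner_apply']
  have e3 : ∀ G : Plane → ℂ, ∫ x in cell, σ (G x) ∂μ = σ (∫ x in cell, G x ∂μ) := by
    intro G
    rcases h.sigma with rfl | rfl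
    · rfl
    · exact integral_conj
  rw [e1, e2, e3, h.setIntegral_comp (G := fun x => starRingEnd ℂ (ext k f x) * ext k g x)]
  intro g' x
  rw [isQuasiPeriodic_ext k f, isQuasiPeriodic_ext k g, map_mul, mul_mul_mul_comm,
    Complex.conj_mul', norm_phase]
  simp

theorem norm_op (h : BlochSymm μ k σ T) (f : CellL2 μ) : ‖h.op f‖ = ‖f‖ := by
  have h1 := congrArg norm (h.inner_op f f)
  rw [h.norm_sigma, inner_self_eq_norm_sq_to_K, inner_self_eq_norm_sq_to_K, norm_pow, norm_pow] at h1
  simpa using h1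

theorem op_op (h : BlochSymm μ k σ T) (hT : ∀ x, T (T x) = x) (f : CellL2 μ) :
    h.op (h.op f) = f := by
  apply eq_of_ext_ae_eq (k := k)
  filter_upwards [h.ext_op (h.op f), h.mp.quasiMeasurePreserving.ae (h.ext_op f)] with x h1 h2
  rw [h1, h2, h.sigma_sigma, hT]

end BlochSymm

end Lattice

/-! ### Multiplication by bounded functions -/

section Multiplication

variable {μ : Measure Plane}

/-- Multiplication by a bounded function. -/
def mulOp (μ : Measure Plane) {a : Plane → ℂ} (ha : Measurable a) {C : ℝ} (hC : ∀ x, ‖a x‖ ≤ C) :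
    CellL2 μ →L[ℂ] CellL2 μ :=
  (ContinuousLinearMap.mul ℂ ℂ).holderL (μ.restrict cell) ⊤ 2 2
    ((memLp_top_of_bound ha.aestronglyMeasurable C (Eventually.of_forall hC)).toLp a)

theorem mulOp_ae {a : Plane → ℂ} (ha : Measurable a) {C : ℝ} (hC : ∀ x, ‖a x‖ ≤ C) (f : CellL2 μ) :
    mulOp μ ha hC f =ᵐ[μ.restrict cell] fun x => a x * f x := by
  have h := (ContinuousLinearMap.mul ℂ ℂ).coeFn_holder (r := 2)
    ((memLp_top_of_bound (μ := μ.restrict cell) ha.aestronglyMeasurable C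
      (Eventually.of_forall hC)).toLp a) f
  filter_upwards [h, (memLp_top_of_bound (μ := μ.restrict cell) ha.aestronglyMeasurable C
    (Eventually.of_forall hC)).coeFn_toLp] with x h1 h2
  have h1' : mulOp μ ha hC f x = _ := h1
  rw [h1', h2]; rfl

end Multiplication

/-! ### Plane waves and the change of quasimomentum -/

section Gauge

/-- The plane wave `exp (i δ·x)`. -/
def planeWave (δ x : Plane) : ℂ := Complex.exp (Complex.I * (inner ℝ δ x : ℝ))

theorem norm_planeWave (δ x : Plane) : ‖planeWave δ x‖ = 1 := by
  rw [planeWave, mul_comm, Complex.norm_exp_ofReal_mul_I]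

theorem continuous_planeWave (δ : Plane) : Continuous (planeWave δ) := by
  unfold planeWave; fun_prop

theorem measurable_planeWave (δ : Plane) : Measurable (planeWave δ) :=
  (continuous_planeWave δ).measurable

theorem planeWave_zero (x : Plane) : planeWave 0 x = 1 := by simp [planeWave]

theorem planeWave_add (δ δ' x : Plane) : planeWave (δ + δ') x = planeWave δ x * planeWave δ' x := by
  rw [planeWave, planeWave, planeWave, ← Complex.exp_add, inner_add_left]
  congr 1; push_cast; ring

theorem planeWave_neg_mul (δ x : Plane) : planeWave (-δ) x * planeWave δ x = 1 := by
  rw [← planeWave_add, neg_add_cancel, planeWave_zero]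

theorem planeWave_ne_zero (δ x : Plane) : planeWave δ x ≠ 0 := Complex.exp_ne_zero _

theorem conj_planeWave (δ x : Plane) : starRingEnd ℂ (planeWave δ x) = planeWave (-δ) x := by
  rw [planeWave, planeWave, ← Complex.exp_conj]
  congr 1
  simp [inner_neg_left]

theorem inner_kappa_vadd (k : Fin 2 → ℝ) (g : ℤ × ℤ) (x : Plane) :
    inner ℝ (kappa k) (g +ᵥ x) = inner ℝ (kappa k) x + (g.1 * k 0 + g.2 * k 1) := by
  rw [kappa, inner_add_left, inner_add_left, inner_smul_left, inner_smul_left, inner_smul_left,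
    inner_smul_left, inner_b₁_vadd, inner_b₂_vadd]
  simp only [conj_trivial]; ring

/-- As `b₁`, `b₂` is dual to `a₁`, `a₂`, the plane wave with wave vector `κ - κ₀` converts the
character of `k₀` into that of `k`. -/
theorem planeWave_vadd (k k₀ : Fin 2 → ℝ) (g : ℤ × ℤ) (x : Plane) :
    phase k₀ g * planeWave (kappa k - kappa k₀) (g +ᵥ x) =
      phase k g * planeWave (kappa k - kappa k₀) x := by
  rw [phase, phase, planeWave, planeWave, ← Complex.exp_add, ← Complex.exp_add, inner_sub_left,
    inner_sub_left, inner_kappa_vadd, inner_kappa_vadd]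
  congr 1; push_cast; ring

variable {μ : Measure Plane}

/-- Multiplication by a plane wave, as a unitary operator of the cell space. -/
def gauge (μ : Measure Plane) (δ : Plane) : CellL2 μ →L[ℂ] CellL2 μ :=
  mulOp μ (measurable_planeWave δ) (C := 1) fun x => (norm_planeWave δ x).le

theorem gauge_ae (δ : Plane) (f : CellL2 μ) :
    gauge μ δ f =ᵐ[μ.restrict cell] fun x => planeWave δ x * f x := mulOp_ae _ _ f

theorem gauge_neg_gauge (δ : Plane) (f : CellL2 μ) : gauge μ (-δ) (gauge μ δ f) = f := by
  apply Lp.ext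
  filter_upwards [gauge_ae (-δ) (gauge μ δ f), gauge_ae δ f] with x h1 h2
  rw [h1, h2, ← mul_assoc, planeWave_neg_mul, one_mul]

theorem gauge_gauge_neg (δ : Plane) (f : CellL2 μ) : gauge μ δ (gauge μ (-δ) f) = f := by
  have := gauge_neg_gauge (-δ) f
  rwa [neg_neg] at this

theorem ext_gauge [VAddInvariantMeasure (ℤ × ℤ) Plane μ] (k k₀ : Fin 2 → ℝ) (f : CellL2 μ) :
    ext k (gauge μ (kappa k - kappa k₀) f) =ᵐ[μ]
      fun x => planeWave (kappa k - kappa k₀) x * ext k₀ f x := by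
  refine (ext_ae_eq (Eventually.of_forall fun x g => ?_) ?_).symm
  · rw [isQuasiPeriodic_ext, mul_left_comm, ← mul_assoc, planeWave_vadd, mul_assoc]
  · filter_upwards [gauge_ae (kappa k - kappa k₀) f, ext_ae_cell μ k₀ f] with x h1 h2
    rw [h1, h2]

end Gauge

/-! ### Twisted operators, their resolvents and their symmetries -/

namespace PlaneOperator

/-- Basic properties of the relation `(ψ, Hψ)`: it does not see null sets, it is single-valued and
it has real coefficients. -/
structure IsRegular (H : PlaneOperator) : Prop where
  congr : ∀ {ψ η ψ' η' : Plane → ℂ}, (ψ, η) ∈ H.rel → ψ =ᵐ[H.μ] ψ' → η =ᵐ[H.μ] η' →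
    (ψ', η') ∈ H.rel
  single : ∀ {η : Plane → ℂ}, (0, η) ∈ H.rel → η =ᵐ[H.μ] 0
  conj : ∀ {ψ η : Plane → ℂ}, (ψ, η) ∈ H.rel →
    ((fun x => starRingEnd ℂ (ψ x)), (fun x => starRingEnd ℂ (η x))) ∈ H.rel

variable {H : PlaneOperator}

theorem IsRegular.single_of_ae (hr : H.IsRegular) {ψ η : Plane → ℂ} (h : (ψ, η) ∈ H.rel)
    (hψ : ψ =ᵐ[H.μ] 0) : η =ᵐ[H.μ] 0 := hr.single (hr.congr h hψ EventuallyEq.rfl)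

theorem IsRegular.comp (hr : H.IsRegular) {k : Fin 2 → ℝ} {σ : ℂ →+* ℂ} {T : Plane → Plane}
    (h : BlochSymm H.μ k σ T) (hT : H.Invariant T) {ψ η : Plane → ℂ} (hψ : (ψ, η) ∈ H.rel) :
    ((fun x => σ (ψ (T x))), (fun x => σ (η (T x)))) ∈ H.rel := by
  rcases h.sigma with rfl | rfl
  · exact hT ψ η hψ
  · exact hr.conj (hT ψ η hψ)

variable [VAddInvariantMeasure (ℤ × ℤ) Plane H.μ]

/-- Membership in `floquetGraph` does not ask `Hψ` to be a Bloch function. This follows from shift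
invariance: `ψ ∘ g - phase k g • ψ` vanishes almost everywhere, hence so does its image, by
single-valuedness. -/
theorem IsRegular.mem_floquetGraph (hr : H.IsRegular) (hΓ : ∀ m n : ℤ, H.Invariant (shift m n))
    (k : Fin 2 → ℝ) (f g : H.CellSpace) :
    (f, g) ∈ H.floquetGraph k ↔ (ext k f, ext k g) ∈ H.rel := by
  constructor
  · rintro ⟨ψ, η, h1, h2, h3, h4⟩
    refine hr.congr h2 (ext_ae_eq (ae_quasiPeriodic h1) h3) (ext_ae_eq ?_ h4)
    rw [ae_all_iff]
    intro g'
    have h5 := H.rel.sub_mem (hΓ g'.1 g'.2 ψ η h2) (H.rel.smul_mem (phase k g') h2)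
    have h6 := hr.single_of_ae h5 (by
      filter_upwards [ae_quasiPeriodic h1] with x hx
      have := hx g'
      rw [vadd_def] at this
      simp [this])
    filter_upwards [h6] with x hx
    rw [vadd_def]
    simpa [sub_eq_zero] using hx
  · exact fun h => ⟨ext k f, ext k g, ext_mem_blochSpace k f, h, ext_ae_cell _ k f,
      ext_ae_cell _ k g⟩

/-- The operator `exp (-i δ·x) H exp (i δ·x)` on the Bloch functions of quasimomentum `k₀`. -/
def twistedRel (H : PlaneOperator) (k₀ : Fin 2 → ℝ) (δ : Plane) (f g : H.CellSpace) : Prop :=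
  ((fun x => planeWave δ x * ext k₀ f x), (fun x => planeWave δ x * ext k₀ g x)) ∈ H.rel

theorem IsRegular.twistedRel_iff (hr : H.IsRegular) (hΓ : ∀ m n : ℤ, H.Invariant (shift m n))
    (k k₀ : Fin 2 → ℝ) (f g : H.CellSpace) :
    H.twistedRel k₀ (kappa k - kappa k₀) f g ↔
      (gauge H.μ (kappa k - kappa k₀) f, gauge H.μ (kappa k - kappa k₀) g) ∈ H.floquetGraph k := by
  rw [hr.mem_floquetGraph hΓ]
  exact ⟨fun h => hr.congr h (ext_gauge k k₀ f).symm (ext_gauge k k₀ g).symm,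
    fun h => hr.congr h (ext_gauge k k₀ f) (ext_gauge k k₀ g)⟩

omit [VAddInvariantMeasure (ℤ × ℤ) Plane H.μ] in
theorem twistedRel_zero (k₀ : Fin 2 → ℝ) (f g : H.CellSpace) :
    H.twistedRel k₀ 0 f g ↔ (ext k₀ f, ext k₀ g) ∈ H.rel := by
  simp only [twistedRel, planeWave_zero, one_mul]

theorem IsRegular.floquetGraph_single (hr : H.IsRegular)
    (hΓ : ∀ m n : ℤ, H.Invariant (shift m n)) (k : Fin 2 → ℝ) {u : H.CellSpace}
    (h : (0, u) ∈ H.floquetGraph k) : u = 0 := by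
  rw [hr.mem_floquetGraph hΓ] at h
  have h0 : ext k (0 : H.CellSpace) =ᵐ[H.μ] 0 := by
    refine (ext_congr_of_ae (Lp.coeFn_zero ℂ 2 _)).trans (Eventually.of_forall fun x => ?_)
    simp [ext]
  exact eq_of_ext_ae_eq ((hr.single_of_ae h h0).trans h0.symm)

/-- A symmetry of `H` carries the plane wave of `δ` into that of `δ'`, hence conjugates the
corresponding twisted operators. -/
theorem IsRegular.twistedRel_op (hr : H.IsRegular) {k₀ : Fin 2 → ℝ} {σ : ℂ →+* ℂ}
    {T : Plane → Plane} (h : BlochSymm H.μ k₀ σ T) (hT : H.Invariant T) {δ δ' : Plane}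
    (hδ : ∀ x, σ (planeWave δ (T x)) = planeWave δ' x) {f g : H.CellSpace}
    (hfg : H.twistedRel k₀ δ f g) : H.twistedRel k₀ δ' (h.op f) (h.op g) := by
  refine hr.congr (hr.comp h hT hfg) ?_ ?_
  · filter_upwards [h.ext_op f] with x hx
    rw [hx, map_mul, hδ]
  · filter_upwards [h.ext_op g] with x hx
    rw [hx, map_mul, hδ]

/-- Near `k₀`, the operators `H(k)` have compact resolvents that depend differentiably on `k`,
after the plane wave has been split off. -/
structure IsResolventFamily (H : PlaneOperator) (k₀ : Fin 2 → ℝ) (c : ℝ)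
    (S : Plane → H.CellSpace →L[ℂ] H.CellSpace)
    (L : Plane →ₗ[ℝ] (H.CellSpace →L[ℂ] H.CellSpace)) : Prop where
  family : IsCompactFamily S L
  iff : ∀ᶠ δ in 𝓝 0, ∀ f g, H.twistedRel k₀ δ f g ↔ f = S δ (g + (c : ℂ) • f)

section Resolvent

variable {k₀ : Fin 2 → ℝ} {c : ℝ} {S : Plane → H.CellSpace →L[ℂ] H.CellSpace}
  {L : Plane →ₗ[ℝ] (H.CellSpace →L[ℂ] H.CellSpace)}

theorem floquet_graph (hr : H.IsRegular) (hΓ : ∀ m n : ℤ, H.Invariant (shift m n))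
    (k : Fin 2 → ℝ) : (H.floquet k).graph = H.floquetGraph k :=
  graph_toLinearPMap fun _ hu => hr.floquetGraph_single hΓ k hu

theorem IsResolventFamily.isResolvent_zero (hS : H.IsResolventFamily k₀ c S L) (hr : H.IsRegular)
    (hΓ : ∀ m n : ℤ, H.Invariant (shift m n)) : IsResolvent (H.floquetGraph k₀) c (S 0) := by
  intro f g
  rw [hr.mem_floquetGraph hΓ, ← twistedRel_zero]
  exact hS.iff.self_of_nhds f g

/-- The symmetry relates the graphs at `δ` and `ρ δ`, and these determine the resolvents. That `ρ`
preserves norms keeps `ρ δ` in the neighbourhood where the resolvent exists. -/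
theorem IsResolventFamily.op_apply (hS : H.IsResolventFamily k₀ c S L) (hr : H.IsRegular)
    {σ : ℂ →+* ℂ} {T : Plane → Plane} (h : BlochSymm H.μ k₀ σ T) (hT : H.Invariant T)
    {ρ : Plane → Plane} (hρn : ∀ δ, ‖ρ δ‖ = ‖δ‖)
    (hδ : ∀ δ x, σ (planeWave δ (T x)) = planeWave (ρ δ) x) :
    ∀ᶠ δ in 𝓝 0, ∀ u, h.op (S δ u) = S (ρ δ) (h.op u) := by
  have hρt : Tendsto ρ (𝓝 0) (𝓝 0) := by
    rw [tendsto_zero_iff_norm_tendsto_zero]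
    simpa [hρn] using (continuous_norm (E := Plane)).tendsto 0
  filter_upwards [hS.iff, hρt.eventually hS.iff] with δ h1 h2 u
  have h3 : H.twistedRel k₀ δ (S δ u) (u - (c : ℂ) • S δ u) := by
    rw [h1, sub_add_cancel]
  have h4 := hr.twistedRel_op h hT (hδ δ) h3
  have h5 : h.op (u - (c : ℂ) • S δ u) + (c : ℂ) • h.op (S δ u) = h.op u := by
    have h6 := h.op_smul (c : ℂ) (S δ u)
    rw [h.sigma_ofReal] at h6
    rw [← h6, ← h.op_add, sub_add_cancel]
  rw [h2, h5] at h4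
  exact h4

/-- The covariance of `S` passes to its first order term: the defect is homogeneous in `δ` and
`o(δ)`, so it vanishes. -/
theorem IsResolventFamily.op_apply_linear (hS : H.IsResolventFamily k₀ c S L) (hr : H.IsRegular)
    {σ : ℂ →+* ℂ} {T : Plane → Plane} (h : BlochSymm H.μ k₀ σ T) (hT : H.Invariant T)
    {ρ : Plane → Plane} (hρn : ∀ δ, ‖ρ δ‖ = ‖δ‖) (hρs : ∀ (t : ℝ) δ, ρ (t • δ) = t • ρ δ)
    (hδ : ∀ δ x, σ (planeWave δ (T x)) = planeWave (ρ δ) x) (δ : Plane) (u : H.CellSpace) :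
    h.op (L δ u) = L (ρ δ) (h.op u) := by
  have hρ0 : ρ 0 = 0 := by rw [← norm_eq_zero, hρn, norm_zero]
  have hρt : Tendsto ρ (𝓝 0) (𝓝 0) := by
    rw [tendsto_zero_iff_norm_tendsto_zero]
    simpa [hρn] using (continuous_norm (E := Plane)).tendsto 0
  have hsub : ∀ a b, h.op (a - b) = h.op a - h.op b := by
    intro a b
    rw [eq_sub_iff_add_eq, ← h.op_add, sub_add_cancel]
  have hreal : ∀ (t : ℝ) a, h.op (t • a) = t • h.op a := by
    intro t a
    have e : ∀ a : H.CellSpace, t • a = (t : ℂ) • a := fun a => (Complex.coe_smul t a).symm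
    rw [e, e, h.op_smul, h.sigma_ofReal]
  have ev := hS.op_apply hr h hT hρn hδ
  rw [← sub_eq_zero]
  refine eq_zero_of_homogeneous_isLittleO
    (φ := fun δ => h.op (L δ u) - L (ρ δ) (h.op u)) (fun t x => ?_) ?_ δ
  · simp only [hρs, map_smul, smul_sub, FunLike.coe_smul, Pi.smul_apply, hreal]
  · have d1 := hS.family.expand
    have d2 := d1.comp_tendsto hρt
    have d3 : (fun δ => ‖S (ρ δ) - S 0 - L (ρ δ)‖ + ‖S δ - S 0 - L δ‖) =o[𝓝 0]
        (fun δ : Plane => ‖δ‖) := by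
      refine Asymptotics.IsLittleO.add ?_ d1.norm_norm
      have := d2.norm_norm
      simp only [Function.comp_def, hρn] at this
      exact this
    rw [← Asymptotics.isLittleO_norm_right]
    refine Asymptotics.IsBigO.trans_isLittleO (Asymptotics.IsBigO.of_bound ‖u‖ ?_) d3
    filter_upwards [ev] with δ hev
    have h0 := ev.self_of_nhds u
    rw [hρ0] at h0
    have e : h.op (L δ u) - L (ρ δ) (h.op u) =
        (S (ρ δ) - S 0 - L (ρ δ)) (h.op u) - h.op ((S δ - S 0 - L δ) u) := by
      simp only [sub_apply, hsub, hev, h0]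
      abel
    rw [e]
    refine (norm_sub_le _ _).trans ?_
    have k1 := (S (ρ δ) - S 0 - L (ρ δ)).le_opNorm (h.op u)
    have k2 := (S δ - S 0 - L δ).le_opNorm u
    rw [h.norm_op] at k1 ⊢
    rw [Real.norm_of_nonneg (by positivity)]
    nlinarith

end Resolvent

end PlaneOperator

/-! ### The primitive cube root of unity -/

section CubeRoot

theorem tau_pow_three : tau ^ 3 = 1 := by
  rw [tau, ← Complex.exp_nat_mul, ← Complex.exp_two_pi_mul_I]
  congr 1; push_cast; ring

theorem tau_eq : tau = ⟨-1 / 2, √3 / 2⟩ := by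
  have h : tau = Complex.exp ((2 * Real.pi / 3 : ℝ) * Complex.I) := by
    rw [tau]; congr 1; push_cast; ring
  have h2 : (2 * Real.pi / 3 : ℝ) = Real.pi - Real.pi / 3 := by ring
  rw [h, h2]
  apply Complex.ext
  · rw [Complex.exp_ofReal_mul_I_re, Real.cos_pi_sub, Real.cos_pi_div_three]; norm_num
  · rw [Complex.exp_ofReal_mul_I_im, Real.sin_pi_sub, Real.sin_pi_div_three]

theorem tau_ne_one : tau ≠ 1 := by
  rw [tau_eq]
  intro h
  have := congrArg Complex.re h
  norm_num at this

theorem one_add_tau_add_tau_sq : 1 + tau + tau ^ 2 = 0 := by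
  have h : (tau - 1) * (1 + tau + tau ^ 2) = 0 := by linear_combination tau_pow_three
  exact (mul_eq_zero.1 h).resolve_left (sub_ne_zero.2 tau_ne_one)

theorem tau_ne_zero : tau ≠ 0 := Complex.exp_ne_zero _

theorem norm_tau : ‖tau‖ = 1 := by
  have h := congrArg norm tau_pow_three
  rw [norm_pow, norm_one] at h
  exact (pow_eq_one_iff_of_nonneg (norm_nonneg _) (by norm_num)).1 h

theorem inv_tau : tau⁻¹ = tau ^ 2 := by
  rw [inv_eq_iff_eq_inv]
  exact eq_inv_of_mul_eq_one_left (by rw [← tau_pow_three]; ring)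

theorem conj_tau : starRingEnd ℂ tau = tau ^ 2 := by
  rw [← inv_tau, Complex.inv_def, Complex.normSq_eq_norm_sq, norm_tau]; simp

end CubeRoot

/-! ### Reduction by a unitary operator of order three -/

section Isotypic

variable {E : Type*} [NormedAddCommGroup E] [InnerProductSpace ℂ E]

/-- `K 0`, `K 1`, `K 2` are the eigenspaces of a unitary operator `R` with `R³ = 1`. -/
structure IsIsotypic (R : E ≃ₗᵢ[ℂ] E) (K : Fin 3 → Submodule ℂ E) : Prop where
  cube : ∀ u, R (R (R u)) = u
  mem : ∀ j f, f ∈ K j ↔ R f = (tau⁻¹) ^ (j : ℕ) • f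

variable {R : E ≃ₗᵢ[ℂ] E} {K : Fin 3 → Submodule ℂ E}

/-- The components are eigenspaces of a unitary operator for distinct eigenvalues. -/
theorem IsIsotypic.isOrtho (h : IsIsotypic R K) {i j : Fin 3} (hij : i ≠ j) : K i ⟂ K j := by
  rw [Submodule.isOrtho_iff_inner_eq]
  intro u hu v hv
  rw [h.mem] at hu hv
  have h1 := R.inner_map_map u v
  rw [hu, hv, inner_smul_left, inner_smul_right, inv_tau, map_pow, map_pow, conj_tau] at h1
  have h2 : (1 - ((tau ^ 2) ^ 2) ^ (i : ℕ) * (tau ^ 2) ^ (j : ℕ)) * inner ℂ u v = 0 := by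
    linear_combination -h1
  refine (mul_eq_zero.1 h2).resolve_left ?_
  have t1 : 1 - tau ≠ 0 := sub_ne_zero.2 tau_ne_one.symm
  have t2 : 1 - tau ^ 2 ≠ 0 := by
    have : 1 - tau ^ 2 = (1 - tau) * (1 + tau) := by ring
    rw [this]
    refine mul_ne_zero t1 fun h0 => tau_ne_zero ?_
    have := one_add_tau_add_tau_sq
    rw [h0, zero_add] at this
    exact pow_eq_zero_iff (two_ne_zero) |>.1 this
  have t4 : tau ^ 4 = tau := by rw [show tau ^ 4 = tau ^ 3 * tau by ring, tau_pow_three, one_mul]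
  have t8 : tau ^ 8 = tau ^ 2 := by rw [show tau ^ 8 = (tau ^ 4) ^ 2 by ring, t4]
  have t10 : tau ^ 10 = tau := by
    rw [show tau ^ 10 = tau ^ 8 * tau ^ 2 by ring, t8, ← pow_add, t4]
  clear hu hv h1 h2
  fin_cases i <;> fin_cases j <;> simp at hij <;> simp <;> ring_nf <;>
    (try simp only [t4, t8, t10]) <;> first | exact t1 | exact t2

theorem IsIsotypic.exists_sum (h : IsIsotypic R K) (f : E) :
    ∃ p : Fin 3 → E, (∀ j, p j ∈ K j) ∧ f = p 0 + p 1 + p 2 := by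
  -- The projections `1/3 Σₗ τ^(j l) Rˡ`; they add up to the identity since `1 + τ + τ² = 0`.
  refine ⟨fun j => (1 / 3 : ℂ) • (f + tau ^ (j : ℕ) • R f + (tau ^ (j : ℕ)) ^ 2 • R (R f)),
    fun j => ?_, ?_⟩
  · rw [h.mem]
    simp only [map_smul, map_add, h.cube, smul_add, smul_smul]
    have hj : (tau⁻¹ : ℂ) ^ (j : ℕ) * tau ^ (j : ℕ) = 1 := by
      rw [← mul_pow, inv_mul_cancel₀ tau_ne_zero, one_pow]
    have hj3 : (tau ^ (j : ℕ)) ^ 3 = 1 := by rw [← pow_mul, mul_comm, pow_mul, tau_pow_three, one_pow]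
    have hj' : (tau⁻¹ : ℂ) ^ (j : ℕ) = (tau ^ (j : ℕ)) ^ 2 := by
      rw [inv_tau, ← pow_mul, ← pow_mul, mul_comm]
    rw [hj']
    generalize tau ^ (j : ℕ) = t at hj3
    have e1 : t ^ 2 * (1 / 3 * t) = 1 / 3 := by linear_combination hj3 / 3
    have e2 : t ^ 2 * (1 / 3 * t ^ 2) = 1 / 3 * t := by linear_combination t * hj3 / 3
    have e3 : t ^ 2 * (1 / 3) = 1 / 3 * t ^ 2 := by ring
    rw [e1, e2, e3]
    abel
  · have e : tau ^ 2 = -1 - tau := by linear_combination one_add_tau_add_tau_sq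
    have e4 : (tau ^ 2) ^ 2 = tau := by
      rw [← pow_mul, show tau ^ (2 * 2) = tau ^ 3 * tau by ring, tau_pow_three, one_mul]
    simp only [Fin.val_zero, Fin.val_one, Fin.val_two, pow_zero, pow_one, one_pow, one_smul, e4]
    rw [e]
    module

theorem IsIsotypic.eq_zero_of_sum_eq_zero (h : IsIsotypic R K) {d : Fin 3 → E}
    (hd : ∀ j, d j ∈ K j) (hs : ∑ j, d j = 0) (i : Fin 3) : d i = 0 := by
  have h1 : inner ℂ (d i) (∑ j, d j) = (0 : ℂ) := by rw [hs, inner_zero_right]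
  rw [inner_sum, Finset.sum_eq_single i] at h1
  · exact inner_self_eq_zero.1 h1
  · exact fun j _ hj => Submodule.isOrtho_iff_inner_eq.1 (h.isOrtho hj.symm) _ (hd i) _ (hd j)
  · simp

theorem IsIsotypic.isClosed (h : IsIsotypic R K) (j : Fin 3) : IsClosed (K j : Set E) := by
  have : (K j : Set E) = {f | R f = (tau⁻¹) ^ (j : ℕ) • f} := by
    ext f; exact h.mem j f
  rw [this]
  exact isClosed_eq R.continuous (continuous_const_smul _)

theorem IsIsotypic.map_mem (h : IsIsotypic R K) {S : E →L[ℂ] E} (hSR : ∀ u, S (R u) = R (S u))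
    (j : Fin 3) (u : E) (hu : u ∈ K j) : S u ∈ K j := by
  rw [h.mem] at hu ⊢
  rw [← hSR, hu, map_smul]

theorem graph_partIn {g : Submodule ℂ (E × E)} (hs : ∀ u, (0, u) ∈ g → u = 0)
    (N : Submodule ℂ E) : (partIn g N).graph = g.comap (N.subtype.prodMap N.subtype) :=
  graph_toLinearPMap fun u hu => Subtype.ext (hs u hu)

theorem mem_graph_partIn {g : Submodule ℂ (E × E)} (hs : ∀ u, (0, u) ∈ g → u = 0)
    {N : Submodule ℂ E} {u v : N} : (u, v) ∈ (partIn g N).graph ↔ ((u : E), (v : E)) ∈ g := by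
  rw [graph_partIn hs]; rfl

/-- `S` preserves every component, so the equation `f = S (g + c f)` holds for a sum exactly if it
holds in each component; domains are included, as this equation describes the graph. -/
theorem IsIsotypic.isOrthogonalSum (h : IsIsotypic R K) {A : E →ₗ.[ℂ] E} {c : ℝ} {S : E →L[ℂ] E}
    (hA : IsResolvent A.graph c S) (hSR : ∀ u, S (R u) = R (S u)) :
    IsOrthogonalSum A K fun j => partIn A.graph (K j) := by
  refine ⟨fun i j => h.isOrtho, ?_, fun f g => ?_⟩
  · rw [eq_top_iff]
    intro f _
    obtain ⟨p, hp, rfl⟩ := h.exists_sum f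
    exact add_mem (add_mem (Submodule.mem_iSup_of_mem 0 (hp 0)) (Submodule.mem_iSup_of_mem 1 (hp 1)))
      (Submodule.mem_iSup_of_mem 2 (hp 2))
  · have hs : ∀ u, (0, u) ∈ A.graph → u = 0 := fun u hu => A.graph_fst_eq_zero_snd hu rfl
    simp only [mem_graph_partIn hs, hA _ _]
    constructor
    · intro hsum j
      rw [← sub_eq_zero]
      refine h.eq_zero_of_sum_eq_zero
        (d := fun j => (f j : E) - S ((g j : E) + (c : ℂ) • (f j : E))) (fun j => ?_) ?_ j
      · exact sub_mem (f j).2 (h.map_mem hSR j _ (add_mem (g j).2 ((K j).smul_mem _ (f j).2)))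
      · rw [Finset.sum_sub_distrib, sub_eq_zero, hsum, ← map_sum, Finset.sum_add_distrib,
          Finset.smul_sum]
    · intro hj
      conv_lhs => rw [Finset.sum_congr rfl fun j _ => hj j]
      rw [← map_sum, Finset.sum_add_distrib, Finset.smul_sum]

/-- The restriction of an operator to an invariant subspace. -/
def restrictTo (S : E →L[ℂ] E) (N : Submodule ℂ E) (hN : ∀ u ∈ N, S u ∈ N) : N →L[ℂ] N :=
  (S.comp N.subtypeL).codRestrict N fun u => hN u u.2

theorem isCompactOperator_restrictTo {S : E →L[ℂ] E} (hS : IsCompactOperator S)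
    {N : Submodule ℂ E} [CompleteSpace N] (hN : ∀ u ∈ N, S u ∈ N) :
    IsCompactOperator (restrictTo S N hN) :=
  hS.restrict' (f := (S : E →ₗ[ℂ] E)) hN

theorem isSymmetric_restrictTo {S : E →L[ℂ] E} (hS : (S : E →ₗ[ℂ] E).IsSymmetric)
    {N : Submodule ℂ E} (hN : ∀ u ∈ N, S u ∈ N) :
    (restrictTo S N hN : N →ₗ[ℂ] N).IsSymmetric := fun u v => hS u v

theorem IsResolvent.restrictTo {A : E →ₗ.[ℂ] E} {c : ℝ} {S : E →L[ℂ] E}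
    (hA : IsResolvent A.graph c S) {N : Submodule ℂ E} (hN : ∀ u ∈ N, S u ∈ N) :
    IsResolvent (partIn A.graph N).graph c (Hexagonal.restrictTo S N hN) := by
  intro f g
  rw [mem_graph_partIn fun u hu => A.graph_fst_eq_zero_snd hu rfl, hA]
  exact ⟨fun h => Subtype.ext h, fun h => congrArg Subtype.val h⟩

theorem mem_eigenspace_partIn {A : E →ₗ.[ℂ] E} {N : Submodule ℂ E} {z : ℂ} {u : N} :
    u ∈ eigenspace (partIn A.graph N) z ↔ (u : E) ∈ eigenspace A z := by
  rw [mem_eigenspace_iff, mem_eigenspace_iff,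
    mem_graph_partIn fun u hu => A.graph_fst_eq_zero_snd hu rfl]
  rfl

end Isotypic

/-! ### Two components exchanged by an (anti)unitary involution -/

section Isospectral

variable {E : Type} [NormedAddCommGroup E] [InnerProductSpace ℂ E]
  {R : E ≃ₗᵢ[ℂ] E} {K : Fin 3 → Submodule ℂ E}

/-- An (anti)unitary involution that exchanges two isotypic components and commutes with `S`. -/
structure IsExchange (K : Fin 3 → Submodule ℂ E) (S : E →L[ℂ] E) (σ : ℂ →+* ℂ) (J : E → E) :
    Prop where
  sigma : σ = RingHom.id ℂ ∨ σ = starRingEnd ℂ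
  add : ∀ u v, J (u + v) = J u + J v
  smul : ∀ (z : ℂ) u, J (z • u) = σ z • J u
  invol : ∀ u, J (J u) = u
  comm : ∀ u, J (S u) = S (J u)
  left : ∀ u ∈ K 1, J u ∈ K 2
  right : ∀ u ∈ K 2, J u ∈ K 1

theorem IsExchange.map_eigenspace {S : E →L[ℂ] E} {σ : ℂ →+* ℂ} {J : E → E}
    (hJ : IsExchange K S σ J) {A : E →ₗ.[ℂ] E} {c : ℝ} (hA : IsResolvent A.graph c S) {z : ℂ}
    (hz : starRingEnd ℂ z = z) {u : E} (hu : u ∈ eigenspace A z) : J u ∈ eigenspace A z := by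
  rw [hA.mem_eigenspace] at hu ⊢
  conv_lhs => rw [hu]
  rw [hJ.smul, hJ.comm]
  congr 1
  rcases hJ.sigma with h | h <;> simp [h, hz]

variable [CompleteSpace E]

/-- At real `z` the map `J` is a bijection of the eigenspaces, linear up to `σ`, which suffices for
equal rank. At other `z` both eigenspaces are zero, and the spectra consist of eigenvalues. -/
theorem IsExchange.isospectral {S : E →L[ℂ] E} {σ : ℂ →+* ℂ} {J : E → E}
    (hJ : IsExchange K S σ J) (h : IsIsotypic R K) {A : E →ₗ.[ℂ] E} {c : ℝ}
    (hA : IsResolvent A.graph c S) (hc : IsCompactOperator S)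
    (hS : (S : E →ₗ[ℂ] E).IsSymmetric) (hSR : ∀ u, S (R u) = R (S u)) :
    Isospectral (partIn A.graph (K 1)) (partIn A.graph (K 2)) := by
  have hcl : ∀ j, CompleteSpace (K j) := fun j => (h.isClosed j).completeSpace_coe
  have hres := fun j => hA.restrictTo (h.map_mem hSR j)
  have hcomp := fun j => isCompactOperator_restrictTo hc (h.map_mem hSR j)
  have hsymm := fun j => isSymmetric_restrictTo hS (h.map_mem hSR j)
  have hrank : ∀ z : ℂ, Module.rank ℂ (eigenspace (partIn A.graph (K 1)) z) =
      Module.rank ℂ (eigenspace (partIn A.graph (K 2)) z) := by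
    intro z
    by_cases hz : starRingEnd ℂ z = z
    · have hσ : Function.Bijective σ := by
        rcases hJ.sigma with rfl | rfl
        · exact Function.bijective_id
        · exact (starRingAut (R := ℂ)).bijective
      refine rank_eq_of_equiv_equiv σ
        { toFun := fun u => ⟨⟨J u.1.1, hJ.left _ u.1.2⟩, mem_eigenspace_partIn.2
            (hJ.map_eigenspace hA hz (mem_eigenspace_partIn.1 u.2))⟩
          invFun := fun u => ⟨⟨J u.1.1, hJ.right _ u.1.2⟩, mem_eigenspace_partIn.2
            (hJ.map_eigenspace hA hz (mem_eigenspace_partIn.1 u.2))⟩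
          left_inv := fun u => Subtype.ext (Subtype.ext (hJ.invol _))
          right_inv := fun u => Subtype.ext (Subtype.ext (hJ.invol _))
          map_add' := fun u v => Subtype.ext (Subtype.ext (hJ.add _ _)) } hσ ?_
      exact fun r u => Subtype.ext (Subtype.ext (hJ.smul _ _))
    · have hb : ∀ j, eigenspace (partIn A.graph (K j)) z = ⊥ := fun j => by
        by_contra hne
        exact hz ((hres j).eigenvalue_real (hsymm j) hne)
      rw [hb, hb, rank_bot, rank_bot]
  refine ⟨?_, hrank⟩
  ext z
  rw [(hres 1).mem_spec_iff (hcomp 1), (hres 2).mem_spec_iff (hcomp 2), not_iff_not,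
    ← Submodule.rank_eq_zero, ← Submodule.rank_eq_zero, hrank]

/-- An eigenvector and its image under `J` lie in orthogonal components. -/
theorem IsExchange.two_le_multiplicity {S : E →L[ℂ] E} {σ : ℂ →+* ℂ} {J : E → E}
    (hJ : IsExchange K S σ J) (h : IsIsotypic R K) {A : E →ₗ.[ℂ] E} {c : ℝ}
    (hA : IsResolvent A.graph c S) (hc : IsCompactOperator S)
    (hS : (S : E →ₗ[ℂ] E).IsSymmetric) (hSR : ∀ u, S (R u) = R (S u)) {z : ℂ}
    (hz : eigenspace (partIn A.graph (K 1)) z ≠ ⊥) : 2 ≤ multiplicity A z := by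
  have hr := (hA.restrictTo (h.map_mem hSR 1)).eigenvalue_real
    (isSymmetric_restrictTo hS (h.map_mem hSR 1)) hz
  obtain ⟨v, hv, hv0⟩ := Submodule.exists_mem_ne_zero_of_ne_bot hz
  have hv1 := mem_eigenspace_partIn.1 hv
  have hv2 := hJ.map_eigenspace hA hr hv1
  have hv0' : (v : E) ≠ 0 := fun h0 => hv0 (Subtype.ext h0)
  have hJ0 : J 0 = 0 := by
    have := hJ.smul 0 0
    simpa using this
  have hJv0 : J v ≠ 0 := by
    intro h0
    have := hJ.invol v
    rw [h0, hJ0] at this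
    exact hv0' this.symm
  have horth : inner ℂ (v : E) (J v) = (0 : ℂ) :=
    Submodule.isOrtho_iff_inner_eq.1 (h.isOrtho (i := 1) (j := 2) (by decide)) _ v.2 _
      (hJ.left _ v.2)
  have hfin := hA.finiteDimensional_eigenspace hc z
  have hli : LinearIndependent ℂ ![(⟨v, hv1⟩ : eigenspace A z), ⟨J v, hv2⟩] := by
    rw [LinearIndependent.pair_iff]
    intro s t hst
    have hst' : s • (v : E) + t • J v = 0 := congrArg Subtype.val hst
    have e1 := congrArg (inner ℂ (v : E)) hst'
    have e2 := congrArg (inner ℂ (J v)) hst'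
    rw [inner_add_right, inner_smul_right, inner_smul_right, inner_zero_right] at e1 e2
    rw [horth, mul_zero, add_zero] at e1
    rw [← inner_conj_symm, horth, map_zero, mul_zero, zero_add] at e2
    exact ⟨(mul_eq_zero.1 e1).resolve_right (inner_self_ne_zero.2 hv0'),
      (mul_eq_zero.1 e2).resolve_right (inner_self_ne_zero.2 hJv0)⟩
  simpa [multiplicity] using hli.fintype_card_le_finrank

theorem IsIsotypic.exists_eigenvalue (h : IsIsotypic R K) {S : E →L[ℂ] E} {A : E →ₗ.[ℂ] E} {c : ℝ}
    (hA : IsResolvent A.graph c S) (hc : IsCompactOperator S)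
    (hS : (S : E →ₗ[ℂ] E).IsSymmetric) (hSR : ∀ u, S (R u) = R (S u)) {j : Fin 3}
    (hK : K j ≠ ⊥) : ∃ x : ℝ, eigenspace (partIn A.graph (K j)) x ≠ ⊥ := by
  have hcl : CompleteSpace (K j) := (h.isClosed j).completeSpace_coe
  have hn : Nontrivial (K j) := Submodule.nontrivial_iff_ne_bot.2 hK
  exact (hA.restrictTo (h.map_mem hSR j)).exists_eigenvalue
    (isCompactOperator_restrictTo hc (h.map_mem hSR j))
    (isSymmetric_restrictTo hS (h.map_mem hSR j))

theorem IsIsotypic.selfAdj (h : IsIsotypic R K) {S : E →L[ℂ] E} {A : E →ₗ.[ℂ] E} {c : ℝ}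
    (hA : IsResolvent A.graph c S)
    (hS : (S : E →ₗ[ℂ] E).IsSymmetric) (hSR : ∀ u, S (R u) = R (S u)) (j : Fin 3) :
    SelfAdj (partIn A.graph (K j)) := by
  have hcl : CompleteSpace (K j) := (h.isClosed j).completeSpace_coe
  exact (hA.restrictTo (h.map_mem hSR j)).selfAdj (isSymmetric_restrictTo hS (h.map_mem hSR j))

end Isospectral

/-! ### Rotation, reflection, inversion and conjugation at the symmetric quasimomenta -/

section PointSymmetries

theorem continuous_rot : Continuous rot := by unfold rot; fun_prop
theorem continuous_reflect : Continuous reflect := by unfold reflect; fun_prop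
theorem continuous_invert : Continuous invert := continuous_neg

theorem rot_rot_rot (x : Plane) : rot (rot (rot x)) = x := by
  have h3 : √3 ^ 2 = 3 := Real.sq_sqrt (by norm_num)
  ext i
  fin_cases i
  · simp [rot]; linear_combination (3 / 8 * x 0 - √3 / 8 * x 1) * h3
  · simp [rot]; linear_combination (3 / 8 * x 1 + √3 / 8 * x 0) * h3

theorem reflect_reflect (x : Plane) : reflect (reflect x) = x := by
  ext i; fin_cases i <;> simp [reflect]

theorem invert_invert (x : Plane) : invert (invert x) = x := neg_neg x

theorem reflect_rot (x : Plane) : reflect (rot x) = rot (rot (reflect x)) := by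
  have h3 : √3 ^ 2 = 3 := Real.sq_sqrt (by norm_num)
  ext i
  fin_cases i
  · simp [rot, reflect]; ring_nf; rw [h3]; ring
  · simp [rot, reflect]; ring_nf; rw [h3]; ring

theorem invert_rot (x : Plane) : invert (rot x) = rot (invert x) := by
  ext i; fin_cases i <;> simp [rot, invert] <;> ring

theorem measurableEmbedding_rot : MeasurableEmbedding rot :=
  continuous_rot.measurableEmbedding (Function.LeftInverse.injective (g := fun x => rot (rot x)) rot_rot_rot)

theorem measurableEmbedding_reflect : MeasurableEmbedding reflect :=
  continuous_reflect.measurableEmbedding (Function.LeftInverse.injective reflect_reflect)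

theorem measurableEmbedding_invert : MeasurableEmbedding invert :=
  continuous_invert.measurableEmbedding (Function.LeftInverse.injective invert_invert)

theorem rot_vadd (g : ℤ × ℤ) (x : Plane) :
    rot ((g.2, -g.1 - g.2) +ᵥ x : Plane) = g +ᵥ rot x := by
  have h3 : √3 ^ 2 = 3 := Real.sq_sqrt (by norm_num)
  ext i
  fin_cases i
  · simp [rot, vadd_eq_add, a₁, a₂]; ring
  · simp [rot, vadd_eq_add, a₁, a₂]; ring_nf; rw [h3]; ring

theorem reflect_vadd (g : ℤ × ℤ) (x : Plane) :
    reflect ((-g.2, -g.1) +ᵥ x : Plane) = g +ᵥ reflect x := by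
  ext i
  fin_cases i
  · simp [reflect, vadd_eq_add, a₁, a₂]; ring
  · simp [reflect, vadd_eq_add, a₁, a₂]; ring

theorem invert_vadd (g : ℤ × ℤ) (x : Plane) : invert (-g +ᵥ x : Plane) = g +ᵥ invert x := by
  simp only [invert, vadd_eq_add, Prod.fst_neg, Prod.snd_neg, Int.cast_neg]
  module

/-- The quasimomenta that are fixed by the rotation. -/
structure IsRotationPoint (k : Fin 2 → ℝ) : Prop where
  snd : k 1 = -k 0
  fst : ∃ n : ℤ, 3 * k 0 = n * (2 * Real.pi)

theorem isRotationPoint_of_eq {k : Fin 2 → ℝ} (h : k = kStar ∨ k = -kStar ∨ k = 0) :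
    IsRotationPoint k := by
  rcases h with rfl | rfl | rfl
  · exact ⟨by simp [kStar], 1, by simp [kStar]; ring⟩
  · exact ⟨by simp [kStar], -1, by simp [kStar]; ring⟩
  · exact ⟨by simp, 0, by simp⟩

variable {μ : Measure Plane} {k : Fin 2 → ℝ}

theorem blochSymm_rot (hk : IsRotationPoint k) (h : MeasurePreserving rot μ μ) :
    BlochSymm μ k (RingHom.id ℂ) rot where
  sigma := Or.inl rfl
  emb := measurableEmbedding_rot
  mp := h
  lattice := by
    refine ⟨⟨fun g => (g.2, -g.1 - g.2), fun g => (-g.1 - g.2, g.1), fun g => ?_, fun g => ?_⟩,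
      fun g => ⟨rot_vadd g, ?_⟩⟩
    · ext <;> simp only <;> ring
    · ext <;> simp
    · obtain ⟨n, hn⟩ := hk.fst
      rw [RingHom.id_apply, phase, phase, Complex.exp_eq_exp_iff_exists_int]
      -- With `k 1 = -k 0` the two exponents differ by `-3 g.2 (k 0)` times `i`, and `3 (k 0)` is
      -- `2π n`.
      refine ⟨-g.2 * n, ?_⟩
      have hn' : 3 * (k 0 : ℂ) = n * (2 * Real.pi) := by exact_mod_cast hn
      have h1 : (k 1 : ℂ) = -k 0 := by rw [hk.snd]; push_cast; rfl
      simp only [Equiv.coe_fn_mk, h1]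
      push_cast
      linear_combination -Complex.I * g.2 * hn'

theorem blochSymm_reflect (hk : IsRotationPoint k) (h : MeasurePreserving reflect μ μ) :
    BlochSymm μ k (RingHom.id ℂ) reflect where
  sigma := Or.inl rfl
  emb := measurableEmbedding_reflect
  mp := h
  lattice := by
    refine ⟨⟨fun g => (-g.2, -g.1), fun g => (-g.2, -g.1), fun g => ?_, fun g => ?_⟩,
      fun g => ⟨reflect_vadd g, ?_⟩⟩
    · ext <;> simp
    · ext <;> simp
    · rw [RingHom.id_apply, phase, phase]
      simp only [Equiv.coe_fn_mk, hk.snd]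
      congr 1; push_cast; ring

/-- Inversion alone sends `k` to `-k`; conjugation brings it back, for every `k`. Therefore the
inversion acts antilinearly. -/
theorem blochSymm_invert (h : MeasurePreserving invert μ μ) :
    BlochSymm μ k (starRingEnd ℂ) invert where
  sigma := Or.inr rfl
  emb := measurableEmbedding_invert
  mp := h
  lattice := ⟨Equiv.neg _, fun g => ⟨invert_vadd g, conj_phase k g⟩⟩

/-- Without a point map the character itself has to be real, as it is at `0`. -/
theorem blochSymm_conj (μ : Measure Plane) : BlochSymm μ 0 (starRingEnd ℂ) id where
  sigma := Or.inr rfl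
  emb := MeasurableEmbedding.id
  mp := MeasurePreserving.id μ
  lattice := ⟨Equiv.refl _, fun g => ⟨fun _ => rfl, by simp [phase]⟩⟩

end PointSymmetries

/-! ### Commutation relations of the symmetries on the cell space -/

section CellOperators

variable {μ : Measure Plane} [VAddInvariantMeasure (ℤ × ℤ) Plane μ] {k : Fin 2 → ℝ}

theorem BlochSymm.ext_op_op {σ σ' : ℂ →+* ℂ} {T T' : Plane → Plane} (h : BlochSymm μ k σ T)
    (h' : BlochSymm μ k σ' T') (f : CellL2 μ) :
    ext k (h.op (h'.op f)) =ᵐ[μ] fun x => σ (σ' (ext k f (T' (T x)))) := by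
  filter_upwards [h.ext_op (h'.op f), h.mp.quasiMeasurePreserving.ae (h'.ext_op f)] with x h1 h2
  rw [h1, h2]

theorem BlochSymm.op_rot_cube (h : BlochSymm μ k (RingHom.id ℂ) rot) (f : CellL2 μ) :
    h.op (h.op (h.op f)) = f := by
  apply eq_of_ext_ae_eq (k := k)
  filter_upwards [h.ext_op_op h (h.op f),
    (h.mp.comp h.mp).quasiMeasurePreserving.ae (h.ext_op f)] with x h1 h2
  rw [h1, RingHom.id_apply, RingHom.id_apply, ← Function.comp_apply (f := rot) (g := rot), h2,
    Function.comp_apply, rot_rot_rot, RingHom.id_apply]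

/-- The rotation as a unitary operator of the cell space. -/
def rotOp (h : BlochSymm μ k (RingHom.id ℂ) rot) : CellL2 μ ≃ₗᵢ[ℂ] CellL2 μ where
  toFun := h.op
  invFun f := h.op (h.op f)
  left_inv := h.op_rot_cube
  right_inv := h.op_rot_cube
  map_add' := h.op_add
  map_smul' c f := h.op_smul c f
  norm_map' := h.norm_op

theorem isIsotypic_rotOp {H : PlaneOperator} [VAddInvariantMeasure (ℤ × ℤ) Plane H.μ]
    (h : BlochSymm H.μ k (RingHom.id ℂ) rot) : IsIsotypic (rotOp h) (H.isotypic k) where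
  cube := h.op_rot_cube
  mem j f := by
    change _ ↔ h.op f = _
    constructor
    · rintro ⟨ψ, h1, h2, h3⟩
      have h4 := ext_ae_eq (ae_quasiPeriodic h1) h2
      apply eq_of_ext_ae_eq (k := k)
      filter_upwards [h.ext_op f, ext_smul_ae k (tau⁻¹ ^ (j : ℕ)) f, h3, h4,
        h.mp.quasiMeasurePreserving.ae h4] with x e1 e2 e3 e4 e5
      rw [e1, e2, RingHom.id_apply, ← e5, e3, e4, Pi.smul_apply, smul_eq_mul]
    · intro hf
      refine ⟨ext k f, ext_mem_blochSpace k f, ext_ae_cell _ k f, ?_⟩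
      have e1 := h.ext_op f
      rw [hf] at e1
      filter_upwards [e1, ext_smul_ae k (tau⁻¹ ^ (j : ℕ)) f] with x e1 e2
      rw [RingHom.id_apply] at e1
      rw [← e1, e2, Pi.smul_apply, smul_eq_mul]

theorem BlochSymm.rotOp_op_reflect (h : BlochSymm μ k (RingHom.id ℂ) rot)
    (hF : BlochSymm μ k (RingHom.id ℂ) reflect) (f : CellL2 μ) :
    rotOp h (hF.op f) = hF.op (rotOp h (rotOp h f)) := by
  change h.op (hF.op f) = hF.op (h.op (h.op f))
  apply eq_of_ext_ae_eq (k := k)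
  filter_upwards [h.ext_op_op hF f, hF.ext_op_op h (h.op f),
    (h.mp.comp hF.mp).quasiMeasurePreserving.ae (h.ext_op f)] with x h1 h2 h3
  simp only [Function.comp_apply, RingHom.id_apply] at *
  rw [h1, h2, h3, reflect_rot]

theorem BlochSymm.rotOp_op_invert (h : BlochSymm μ k (RingHom.id ℂ) rot)
    (hV : BlochSymm μ k (starRingEnd ℂ) invert) (f : CellL2 μ) :
    rotOp h (hV.op f) = hV.op (rotOp h f) := by
  change h.op (hV.op f) = hV.op (h.op f)
  apply eq_of_ext_ae_eq (k := k)
  filter_upwards [h.ext_op_op hV f, hV.ext_op_op h f] with x h1 h2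
  simp only [RingHom.id_apply] at *
  rw [h1, h2, invert_rot]

variable {E : Type*} [NormedAddCommGroup E] [InnerProductSpace ℂ E]

theorem tau_inv_pow_facts : (tau⁻¹ * tau⁻¹ = tau⁻¹ ^ 2) ∧ (tau⁻¹ ^ 2 * tau⁻¹ ^ 2 = tau⁻¹) ∧
    starRingEnd ℂ tau⁻¹ = tau⁻¹ ^ 2 ∧ starRingEnd ℂ (tau⁻¹ ^ 2) = tau⁻¹ := by
  have h : tau⁻¹ ^ 3 = 1 := by rw [inv_pow, tau_pow_three, inv_one]
  have h2 : starRingEnd ℂ tau⁻¹ = tau⁻¹ ^ 2 := by rw [map_inv₀, conj_tau, inv_pow]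
  refine ⟨by ring, by linear_combination tau⁻¹ * h, h2, ?_⟩
  rw [map_pow, h2]
  linear_combination tau⁻¹ * h

/-- The relation `R F = F R²` turns an eigenvector of `R` for `τ⁻¹` into one for `τ⁻²`, and
conversely. -/
theorem isExchange_reflect {H : PlaneOperator} [VAddInvariantMeasure (ℤ × ℤ) Plane H.μ]
    (h : BlochSymm H.μ k (RingHom.id ℂ) rot) (hF : BlochSymm H.μ k (RingHom.id ℂ) reflect)
    {S : H.CellSpace →L[ℂ] H.CellSpace} (hS : ∀ u, hF.op (S u) = S (hF.op u)) :
    IsExchange (H.isotypic k) S (RingHom.id ℂ) hF.op where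
  sigma := Or.inl rfl
  add := hF.op_add
  smul := hF.op_smul
  invol := hF.op_op reflect_reflect
  comm := hS
  left u hu := by
    rw [(isIsotypic_rotOp h).mem] at hu ⊢
    rw [h.rotOp_op_reflect hF, hu, map_smul, hu, smul_smul, hF.op_smul]
    congr 1
    simpa using tau_inv_pow_facts.1
  right u hu := by
    rw [(isIsotypic_rotOp h).mem] at hu ⊢
    rw [h.rotOp_op_reflect hF, hu, map_smul, hu, smul_smul, hF.op_smul]
    congr 1
    simpa using tau_inv_pow_facts.2.1

/-- The antilinear map commutes with the rotation, hence replaces an eigenvalue `τ⁻¹` by its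
conjugate `τ⁻²`. -/
theorem isExchange_invert {H : PlaneOperator} [VAddInvariantMeasure (ℤ × ℤ) Plane H.μ]
    (h : BlochSymm H.μ k (RingHom.id ℂ) rot) (hV : BlochSymm H.μ k (starRingEnd ℂ) invert)
    {S : H.CellSpace →L[ℂ] H.CellSpace} (hS : ∀ u, hV.op (S u) = S (hV.op u)) :
    IsExchange (H.isotypic k) S (starRingEnd ℂ) hV.op where
  sigma := Or.inr rfl
  add := hV.op_add
  smul := hV.op_smul
  invol := hV.op_op invert_invert
  comm := hS
  left u hu := by
    rw [(isIsotypic_rotOp h).mem] at hu ⊢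
    rw [h.rotOp_op_invert hV, hu, hV.op_smul]
    congr 1
    simpa using tau_inv_pow_facts.2.2.1
  right u hu := by
    rw [(isIsotypic_rotOp h).mem] at hu ⊢
    rw [h.rotOp_op_invert hV, hu, hV.op_smul]
    congr 1
    simpa using tau_inv_pow_facts.2.2.2

end CellOperators

/-! ### Action of the symmetries on wave vectors -/

section PlaneWaveSymmetries

theorem planeWave_rot (δ x : Plane) : planeWave δ (rot x) = planeWave (rotAdj δ) x := by
  rw [planeWave, planeWave, inner_plane, inner_plane]
  congr 3
  simp [rot, rotAdj]; ring

theorem norm_rotAdj (δ : Plane) : ‖rotAdj δ‖ = ‖δ‖ := by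
  have h3 : √3 ^ 2 = 3 := Real.sq_sqrt (by norm_num)
  rw [EuclideanSpace.norm_eq, EuclideanSpace.norm_eq]
  congr 1
  simp only [Fin.sum_univ_two, Real.norm_eq_abs, sq_abs]
  simp [rotAdj]; ring_nf; rw [h3]; ring

theorem rotAdj_smul (t : ℝ) (δ : Plane) : rotAdj (t • δ) = t • rotAdj δ := by
  ext i; fin_cases i <;> simp [rotAdj] <;> ring

theorem norm_reflect (δ : Plane) : ‖reflect δ‖ = ‖δ‖ := by
  rw [EuclideanSpace.norm_eq, EuclideanSpace.norm_eq]
  simp [reflect]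

theorem planeWave_reflect (δ x : Plane) : planeWave δ (reflect x) = planeWave (reflect δ) x := by
  rw [planeWave, planeWave, inner_plane, inner_plane]
  congr 3
  simp [reflect]

/-- Inversion and conjugation each reverse the wave vector; together they fix it. -/
theorem conj_planeWave_invert (δ x : Plane) :
    starRingEnd ℂ (planeWave δ (invert x)) = planeWave δ x := by
  rw [conj_planeWave, planeWave, planeWave, invert, inner_neg_neg]

end PlaneWaveSymmetries

/-! ### Passing from eigenvalues of the resolvent to eigenvalues of the operator -/

section Branches

variable {E : Type*} [NormedAddCommGroup E] [InnerProductSpace ℂ E]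

theorem IsResolvent.eigenspace_eq {A : E →ₗ.[ℂ] E} {c : ℝ} {S : E →L[ℂ] E}
    (h : IsResolvent A.graph c S) {z : ℂ} (hz : z + c ≠ 0) :
    eigenspace A z = Module.End.eigenspace (S : E →ₗ[ℂ] E) (z + c)⁻¹ := by
  ext f
  rw [h.mem_eigenspace, Module.End.mem_eigenspace_iff]
  constructor
  · intro hf
    conv_rhs => rw [hf]
    simp [hz]
  · intro hf
    have hf' : S f = (z + c)⁻¹ • f := hf
    rw [hf', smul_smul, mul_inv_cancel₀ hz, one_smul]

theorem IsResolvent.eigenspace_eq_bot {A : E →ₗ.[ℂ] E} {c : ℝ} {S : E →L[ℂ] E}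
    (h : IsResolvent A.graph c S) {z : ℂ} (hz : z + c = 0) : eigenspace A z = ⊥ := by
  rw [Submodule.eq_bot_iff]
  intro f hf
  rw [h.mem_eigenspace, hz, zero_smul] at hf
  exact hf

theorem IsResolvent.mem_spec_iff_multiplicity_ne_zero [CompleteSpace E] {A : E →ₗ.[ℂ] E} {c : ℝ}
    {S : E →L[ℂ] E} (h : IsResolvent A.graph c S) (hc : IsCompactOperator S) (z : ℂ) :
    z ∈ spec A ↔ multiplicity A z ≠ 0 := by
  have := h.finiteDimensional_eigenspace hc z
  rw [h.mem_spec_iff hc, multiplicity, ne_eq, ne_eq, Submodule.finrank_eq_zero]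

variable {V : Type*} [NormedAddCommGroup V]

theorem tendsto_of_isLittleO_norm {ν : V → ℝ} {μ b : ℝ}
    (h : (fun δ => ν δ - μ - b * ‖δ‖) =o[𝓝 0] (fun δ => ‖δ‖)) : Tendsto ν (𝓝 0) (𝓝 μ) := by
  have h0 : Tendsto (fun δ : V => ‖δ‖) (𝓝 0) (𝓝 0) := by
    simpa using (continuous_norm (E := V)).tendsto 0
  have h1 := ((h.trans_tendsto h0).add (h0.const_mul b)).add_const μ
  simpa using h1

/-- The derivative of the inversion at `μ` is `-1 / μ²`, so the slope `b` becomes `-b / μ²`. -/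
theorem inv_branch_isLittleO {ν : V → ℝ} {μ b : ℝ} (hμ : μ ≠ 0)
    (h : (fun δ => ν δ - μ - b * ‖δ‖) =o[𝓝 0] (fun δ => ‖δ‖)) :
    (fun δ => (ν δ)⁻¹ - μ⁻¹ + b / μ ^ 2 * ‖δ‖) =o[𝓝 0] (fun δ => ‖δ‖) := by
  have hd := (hasDerivAt_inv hμ).isLittleO
  have ht := tendsto_of_isLittleO_norm h
  have h1 := hd.comp_tendsto ht
  have h2 : (fun δ => ν δ - μ) =O[𝓝 0] (fun δ => ‖δ‖) := by
    have := h.isBigO.add ((Asymptotics.isBigO_refl (fun δ : V => ‖δ‖) (𝓝 0)).const_mul_left b)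
    simpa using this
  have h3 := h1.trans_isBigO h2
  have h4 := h3.sub (h.const_mul_left ((μ ^ 2)⁻¹))
  refine h4.congr_left fun δ => ?_
  simp only [Function.comp_apply, smul_eq_mul]
  ring

theorem sq_isLittleO {α : Type*} {l : Filter α} {x t : α → ℝ} {A : ℝ}
    (h : (fun k => x k - A * t k) =o[l] t) :
    (fun k => x k ^ 2 - A ^ 2 * t k ^ 2) =o[l] (fun k => t k ^ 2) := by
  have h1 : (fun k => x k + A * t k) =O[l] t := by
    have := h.isBigO.add ((Asymptotics.isBigO_refl t l).const_mul_left (2 * A))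
    refine this.congr_left fun k => ?_
    ring
  refine (h.mul_isBigO h1).congr (fun k => ?_) fun k => ?_ <;> ring

end Branches

/-! ### The plane wave as an automorphism -/

section Gauge

variable {μ : Measure Plane}

/-- Multiplication by a plane wave as a linear automorphism of the cell space. -/
def gaugeEquiv (μ : Measure Plane) (δ : Plane) : CellL2 μ ≃ₗ[ℂ] CellL2 μ where
  toFun := gauge μ δ
  invFun := gauge μ (-δ)
  left_inv := gauge_neg_gauge δ
  right_inv := gauge_gauge_neg δ
  map_add' := map_add _
  map_smul' := map_smul _

end Gauge

/-! ### Dispersion relation and decomposition for a family of resolvents -/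

namespace PlaneOperator

variable {H : PlaneOperator} [VAddInvariantMeasure (ℤ × ℤ) Plane H.μ]
  {k₀ : Fin 2 → ℝ} {c : ℝ} {S : Plane → H.CellSpace →L[ℂ] H.CellSpace}
  {L : Plane →ₗ[ℝ] (H.CellSpace →L[ℂ] H.CellSpace)}

omit [VAddInvariantMeasure (ℤ × ℤ) Plane H.μ] in
theorem tendsto_kappa_sub (k₀ : Fin 2 → ℝ) :
    Tendsto (fun k => kappa k - kappa k₀) (𝓝 k₀) (𝓝 0) := by
  have hc : Continuous fun k => kappa k - kappa k₀ := by unfold kappa; fun_prop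
  simpa using hc.tendsto k₀

theorem isResolvent_gauge (hr : H.IsRegular) (hΓ : ∀ m n : ℤ, H.Invariant (shift m n))
    {k : Fin 2 → ℝ} {B : H.CellSpace →L[ℂ] H.CellSpace}
    (hB : ∀ f g, H.twistedRel k₀ (kappa k - kappa k₀) f g ↔ f = B (g + (c : ℂ) • f)) :
    IsResolvent (H.floquet k).graph c
      ((gauge H.μ (kappa k - kappa k₀)).comp (B.comp (gauge H.μ (-(kappa k - kappa k₀))))) := by
  intro f g
  rw [floquet_graph hr hΓ]
  have h1 := hr.twistedRel_iff hΓ k k₀ (gauge H.μ (-(kappa k - kappa k₀)) f)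
    (gauge H.μ (-(kappa k - kappa k₀)) g)
  rw [gauge_gauge_neg, gauge_gauge_neg] at h1
  rw [← h1, hB]
  simp only [ContinuousLinearMap.comp_apply, map_add, map_smul]
  constructor
  · intro h
    have := congrArg (gauge H.μ (kappa k - kappa k₀)) h
    rwa [gauge_gauge_neg, map_add, map_smul] at this
  · intro h
    conv_lhs => rw [h]
    rw [map_add, map_smul, gauge_neg_gauge, gauge_neg_gauge]

omit [VAddInvariantMeasure (ℤ × ℤ) Plane H.μ] in
theorem finrank_eigenspace_gauge (δ : Plane) (B : H.CellSpace →L[ℂ] H.CellSpace) (w : ℂ) :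
    Module.finrank ℂ (Module.End.eigenspace
      ((gauge H.μ δ).comp (B.comp (gauge H.μ (-δ))) : H.CellSpace →ₗ[ℂ] H.CellSpace) w) =
    Module.finrank ℂ (Module.End.eigenspace (B : H.CellSpace →ₗ[ℂ] H.CellSpace) w) := by
  have h := (gaugeEquiv H.μ δ).finrank_map_eq
    (Module.End.eigenspace (B : H.CellSpace →ₗ[ℂ] H.CellSpace) w)
  have e : Module.End.eigenspace
      ((gauge H.μ δ).comp (B.comp (gauge H.μ (-δ))) : H.CellSpace →ₗ[ℂ] H.CellSpace) w =
      (Module.End.eigenspace (B : H.CellSpace →ₗ[ℂ] H.CellSpace) w).map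
        (gaugeEquiv H.μ δ : H.CellSpace →ₗ[ℂ] H.CellSpace) := by
   ext f
   rw [Module.End.mem_eigenspace_iff, Submodule.mem_map]
   constructor
   · intro hf
     have hf' : gauge H.μ δ (B (gauge H.μ (-δ) f)) = w • f := hf
     refine ⟨gauge H.μ (-δ) f, ?_, gauge_gauge_neg δ f⟩
     rw [Module.End.mem_eigenspace_iff]
     have := congrArg (gauge H.μ (-δ)) hf'
     rwa [gauge_neg_gauge, map_smul] at this
   · rintro ⟨u, hu, rfl⟩
     rw [Module.End.mem_eigenspace_iff] at hu
     have hu' : B u = w • u := hu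
     change gauge H.μ δ (B (gauge H.μ (-δ) (gauge H.μ δ u))) = w • gauge H.μ δ u
     rw [gauge_neg_gauge, hu', map_smul]
  rw [e, h]

/-- The map `z ↦ (z + c)⁻¹` takes a small disc at `E₀` into the window at `(E₀ + c)⁻¹` and matches
the eigenspaces, which the gauge transformation only moves. It reverses the order of reals of one
sign, so the lower branch comes from `ν · 1` and the upper one from `ν · 0`. -/
theorem IsResolventFamily.isLocalDispersion (hS : H.IsResolventFamily k₀ c S L) (hr : H.IsRegular)
    (hΓ : ∀ m n : ℤ, H.Invariant (shift m n)) {E₀ : ℝ} (hE : E₀ + c ≠ 0)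
    {r : ℝ} (hr0 : 0 < r) {ν : Plane → Fin 2 → ℝ}
    (hν : ∀ᶠ δ in 𝓝 0, ν δ 0 ≤ ν δ 1 ∧ ∀ w : ℂ, ‖w - ((E₀ + c)⁻¹ : ℝ)‖ < r →
      Module.finrank ℂ (Module.End.eigenspace (S δ : H.CellSpace →ₗ[ℂ] H.CellSpace) w) =
        (if w = ν δ 0 then 1 else 0) + (if w = ν δ 1 then 1 else 0))
    (h0 : Tendsto (fun δ => ν δ 0) (𝓝 0) (𝓝 (E₀ + c)⁻¹))
    (h1 : Tendsto (fun δ => ν δ 1) (𝓝 0) (𝓝 (E₀ + c)⁻¹)) :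
    H.IsLocalDispersion k₀ E₀ (fun k => (ν (kappa k - kappa k₀) 1)⁻¹ - c)
      (fun k => (ν (kappa k - kappa k₀) 0)⁻¹ - c) := by
  have hEc : (E₀ : ℂ) + c ≠ 0 := by exact_mod_cast hE
  have hcont : ContinuousAt (fun z : ℂ => (z + c)⁻¹) E₀ :=
    (continuousAt_id.add continuousAt_const).inv₀ hEc
  have hwin : ∀ᶠ z : ℂ in 𝓝 E₀, z + c ≠ 0 ∧ ‖(z + c)⁻¹ - ((E₀ + c)⁻¹ : ℝ)‖ < r := by
    refine ((continuousAt_id.add continuousAt_const).eventually_ne hEc).and ?_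
    have := Metric.tendsto_nhds.1 hcont r hr0
    filter_upwards [this] with z hz
    rw [dist_eq_norm] at hz
    push_cast
    exact hz
  obtain ⟨d, hd, hball⟩ := Metric.eventually_nhds_iff.1 hwin
  have hi0 : Tendsto (fun δ => (ν δ 0)⁻¹ - c) (𝓝 0) (𝓝 E₀) := by
    simpa using (h0.inv₀ (inv_ne_zero hE)).sub_const c
  have hi1 : Tendsto (fun δ => (ν δ 1)⁻¹ - c) (𝓝 0) (𝓝 E₀) := by
    simpa using (h1.inv₀ (inv_ne_zero hE)).sub_const c
  have hpos : ∀ᶠ δ in 𝓝 0, 0 < ν δ 0 * ν δ 1 := by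
    refine (h0.mul h1).eventually (lt_mem_nhds ?_)
    exact mul_self_pos.2 (inv_ne_zero hE)
  have hinv : ∀ {z : ℂ} {x : ℝ}, z = ((x⁻¹ - c : ℝ) : ℂ) ↔ (z + c)⁻¹ = x := by
    intro z x
    rw [inv_eq_iff_eq_inv, ← eq_sub_iff_add_eq]
    push_cast
    rfl
  refine ⟨d, hd, ?_⟩
  have ht := tendsto_kappa_sub k₀
  filter_upwards [ht.eventually hν, ht.eventually hpos, ht.eventually hS.iff,
    ht.eventually hS.family.compact,
    ht.eventually (Metric.tendsto_nhds.1 hi0 d hd), ht.eventually (Metric.tendsto_nhds.1 hi1 d hd)]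
    with k hk hkpos hiff hcomp hd0 hd1
  have hres := isResolvent_gauge hr hΓ hiff
  have hcomp' : IsCompactOperator ((gauge H.μ (kappa k - kappa k₀)).comp
      ((S (kappa k - kappa k₀)).comp (gauge H.μ (-(kappa k - kappa k₀))))) :=
    (hcomp.comp_clm (gauge H.μ (-(kappa k - kappa k₀)))).clm_comp (gauge H.μ (kappa k - kappa k₀))
  refine ⟨?_, hd1, hd0, fun z hz => ?_⟩
  · refine sub_le_sub_right ?_ c
    rcases mul_pos_iff.1 hkpos with ⟨p0, p1⟩ | ⟨p0, p1⟩
    · exact inv_anti₀ p0 hk.1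
    · exact (inv_le_inv_of_neg p1 p0).2 hk.1
  · obtain ⟨hzc, hzr⟩ := hball (by rwa [dist_eq_norm])
    have hm : multiplicity (H.floquet k) z =
        (if z = (((ν (kappa k - kappa k₀) 1)⁻¹ - c : ℝ) : ℂ) then 1 else 0) +
          (if z = (((ν (kappa k - kappa k₀) 0)⁻¹ - c : ℝ) : ℂ) then 1 else 0) := by
      rw [multiplicity, hres.eigenspace_eq hzc, finrank_eigenspace_gauge, hk.2 _ hzr]
      simp only [hinv]
      rw [add_comm]
    refine ⟨?_, hm⟩
    rw [hres.mem_spec_iff_multiplicity_ne_zero hcomp', hm]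
    by_cases e0 : z = (((ν (kappa k - kappa k₀) 0)⁻¹ - c : ℝ) : ℂ) <;>
      by_cases e1 : z = (((ν (kappa k - kappa k₀) 1)⁻¹ - c : ℝ) : ℂ) <;>
      simp only [e0, e1, if_true, if_false, or_true, true_or, or_false] <;>
      norm_num

/-- The resolvents of a family commute with the rotation. -/
theorem IsResolventFamily.comm_op (hS : H.IsResolventFamily k₀ c S L) (hr : H.IsRegular)
    {σ : ℂ →+* ℂ} {T : Plane → Plane} (h : BlochSymm H.μ k₀ σ T) (hT : H.Invariant T)
    {ρ : Plane → Plane} (hρn : ∀ δ, ‖ρ δ‖ = ‖δ‖)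
    (hδ : ∀ δ x, σ (planeWave δ (T x)) = planeWave (ρ δ) x) (u : H.CellSpace) :
    h.op (S 0 u) = S 0 (h.op u) := by
  have hρ0 : ρ 0 = 0 := by rw [← norm_eq_zero, hρn, norm_zero]
  have := (hS.op_apply hr h hT hρn hδ).self_of_nhds u
  rwa [hρ0] at this

/-- The dispersion relation at a double eigenvalue. -/
theorem IsResolventFamily.dispersion (hS : H.IsResolventFamily k₀ c S L) (hr : H.IsRegular)
    (hΓ : ∀ m n : ℤ, H.Invariant (shift m n)) (hR : H.Invariant rot)
    (hk₀ : IsRotationPoint k₀) (hmR : MeasurePreserving rot H.μ H.μ) (E₀ : ℝ)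
    (h2 : multiplicity (H.floquet k₀) E₀ = 2) :
    ∃ (α : ℂ) (lm lp : (Fin 2 → ℝ) → ℝ), H.IsLocalDispersion k₀ E₀ lm lp ∧
        (fun k => (lp k - E₀) ^ 2 - ‖α‖ ^ 2 * ‖kappa k - kappa k₀‖ ^ 2) =o[𝓝 k₀]
          (fun k => ‖kappa k - kappa k₀‖ ^ 2) ∧
        (fun k => (lm k - E₀) ^ 2 - ‖α‖ ^ 2 * ‖kappa k - kappa k₀‖ ^ 2) =o[𝓝 k₀]
          (fun k => ‖kappa k - kappa k₀‖ ^ 2) ∧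
        (fun k => lp k - E₀ - ‖α‖ * ‖kappa k - kappa k₀‖) =o[𝓝 k₀]
          (fun k => ‖kappa k - kappa k₀‖) ∧
        (fun k => lm k - E₀ + ‖α‖ * ‖kappa k - kappa k₀‖) =o[𝓝 k₀]
          (fun k => ‖kappa k - kappa k₀‖) ∧ (k₀ = 0 → α = 0) := by
  have hA : IsResolvent (H.floquet k₀).graph c (S 0) := by
    rw [floquet_graph hr hΓ]
    exact hS.isResolvent_zero hr hΓ
  have hsym := hS.family.symm.self_of_nhds
  have hE : E₀ + c ≠ 0 := by
    intro h0
    have hb := hA.eigenspace_eq_bot (z := E₀) (by exact_mod_cast h0)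
    rw [multiplicity, hb, finrank_bot] at h2
    omega
  have hEc : (E₀ : ℂ) + c ≠ 0 := by exact_mod_cast hE
  have hμ : (E₀ + c)⁻¹ ≠ 0 := inv_ne_zero hE
  have hN := hA.eigenspace_eq hEc
  have hcast : ((E₀ : ℂ) + c)⁻¹ = (((E₀ + c)⁻¹ : ℝ) : ℂ) := by push_cast; rfl
  rw [multiplicity, hN, hcast] at h2
  set N := Module.End.eigenspace (S 0 : H.CellSpace →ₗ[ℂ] H.CellSpace) (((E₀ + c)⁻¹ : ℝ) : ℂ)
    with hNdef
  let hB := blochSymm_rot hk₀ hmR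
  have hRδ : ∀ δ x, RingHom.id ℂ (planeWave δ (rot x)) = planeWave (rotAdj δ) x :=
    fun δ x => planeWave_rot δ x
  have hR0 : ∀ u, S 0 (rotOp hB u) = rotOp hB (S 0 u) :=
    fun u => (hS.comm_op hr hB hR norm_rotAdj hRδ u).symm
  have hRL : ∀ δ u, L (rotAdj δ) (rotOp hB u) = rotOp hB (L δ u) :=
    fun δ u => (hS.op_apply_linear hr hB hR norm_rotAdj rotAdj_smul hRδ δ u).symm
  -- At `k₀ = 0` the basis is chosen real, so that the same basis serves for the cone and for the
  -- vanishing of its slope.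
  obtain ⟨n, hn, hreal⟩ : ∃ n, IsBasisPair N n ∧
      (k₀ = 0 → ∃ C : H.CellSpace → H.CellSpace, (∀ u v, inner ℂ (C u) (C v) = inner ℂ v u) ∧
        (∀ δ u, C (L δ u) = -L δ (C u)) ∧ ∀ i, C (n i) = n i) := by
    by_cases h0 : k₀ = 0
    · subst h0
      let hC := blochSymm_conj H.μ
      have hid : H.Invariant id := fun ψ η h => h
      have hCδ : ∀ δ x, starRingEnd ℂ (planeWave δ (id x)) = planeWave (-δ) x :=
        fun δ x => conj_planeWave δ x
      have hC0 := hS.comm_op hr hC hid norm_neg hCδ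
      have hinner : ∀ u v, inner ℂ (hC.op u) (hC.op v) = inner ℂ v u := fun u v => by
        rw [hC.inner_op, inner_conj_symm]
      obtain ⟨n, hn, hnC⟩ := exists_real_isBasisPair h2 hC.op_add hC.op_smul hinner
        (hC.op_op fun _ => rfl) (fun u hu => by
          rw [hNdef, Module.End.mem_eigenspace_iff] at hu ⊢
          have hu' : S 0 u = (((E₀ + c)⁻¹ : ℝ) : ℂ) • u := hu
          change S 0 (hC.op u) = _
          rw [← hC0, hu', hC.op_smul, hC.sigma_ofReal])
      refine ⟨n, hn, fun _ => ⟨hC.op, hinner, fun δ u => ?_, hnC⟩⟩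
      rw [hS.op_apply_linear hr hC hid norm_neg (fun t δ => (smul_neg t δ).symm) hCδ, map_neg]
      rfl
    · obtain ⟨n, hn⟩ := exists_isBasisPair h2
      exact ⟨n, hn, fun h => absurd h h0⟩
  obtain ⟨htr, a, ha0, ha⟩ := exists_coefficient hS.family hn (rotOp hB) hR0 hRL
  obtain ⟨r, hr0, ν, hν, hν1, hν0⟩ := exists_branches hS.family hμ h2 hn htr ha0 ha
  have hν0' : (fun δ => ν δ 0 - (E₀ + c)⁻¹ - -a * ‖δ‖) =o[𝓝 0] (fun δ : Plane => ‖δ‖) := by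
    refine hν0.congr_left fun δ => ?_
    ring
  have ht := tendsto_kappa_sub k₀
  -- The factor `(E₀ + c) ^ 2` is the size of the derivative of `w ↦ w⁻¹ - c` at `(E₀ + c)⁻¹`.
  have hα : ‖((a * (E₀ + c) ^ 2 : ℝ) : ℂ)‖ = a * (E₀ + c) ^ 2 := by
    rw [Complex.norm_real, Real.norm_of_nonneg (by positivity)]
  have hp : (fun k => (ν (kappa k - kappa k₀) 0)⁻¹ - c - E₀ -
      ‖((a * (E₀ + c) ^ 2 : ℝ) : ℂ)‖ * ‖kappa k - kappa k₀‖) =o[𝓝 k₀]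
      (fun k => ‖kappa k - kappa k₀‖) := by
    refine ((inv_branch_isLittleO hμ hν0').comp_tendsto ht).congr_left fun k => ?_
    simp only [Function.comp_apply, hα]
    field_simp
    ring
  have hm : (fun k => (ν (kappa k - kappa k₀) 1)⁻¹ - c - E₀ +
      ‖((a * (E₀ + c) ^ 2 : ℝ) : ℂ)‖ * ‖kappa k - kappa k₀‖) =o[𝓝 k₀]
      (fun k => ‖kappa k - kappa k₀‖) := by
    refine ((inv_branch_isLittleO hμ hν1).comp_tendsto ht).congr_left fun k => ?_
    simp only [Function.comp_apply, hα]
    field_simp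
    ring
  refine ⟨((a * (E₀ + c) ^ 2 : ℝ) : ℂ), _, _, hS.isLocalDispersion hr hΓ hE hr0 hν
    (tendsto_of_isLittleO_norm hν0') (tendsto_of_isLittleO_norm hν1), sq_isLittleO hp, ?_, hp, hm,
    fun h0 => ?_⟩
  · have hm' : (fun k => (ν (kappa k - kappa k₀) 1)⁻¹ - c - E₀ -
        -‖((a * (E₀ + c) ^ 2 : ℝ) : ℂ)‖ * ‖kappa k - kappa k₀‖) =o[𝓝 k₀]
        (fun k => ‖kappa k - kappa k₀‖) := by
      refine hm.congr_left fun k => ?_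
      ring
    simpa only [neg_sq] using sq_isLittleO hm'
  · obtain ⟨C, hinner, hCL, hnC⟩ := hreal h0
    rw [coefficient_eq_zero hS.family hinner hCL hnC ha]
    simp

/-- The conclusions about the symmetry decomposition. -/
theorem IsResolventFamily.decomposition (hS : H.IsResolventFamily k₀ c S L) (hr : H.IsRegular)
    (hΓ : ∀ m n : ℤ, H.Invariant (shift m n)) (hR : H.Invariant rot)
    (hk₀ : IsRotationPoint k₀) (hmR : MeasurePreserving rot H.μ H.μ)
    (hFV : (H.Invariant reflect ∧ MeasurePreserving reflect H.μ H.μ) ∨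
      (H.Invariant invert ∧ MeasurePreserving invert H.μ H.μ)) :
    (IsOrthogonalSum (H.floquet k₀) (H.isotypic k₀) (H.Q k₀) ∧ ∀ j, SelfAdj (H.Q k₀ j)) ∧
    (Isospectral (H.Q k₀ 1) (H.Q k₀ 2) ∧
      (∀ z : ℂ, eigenspace (H.Q k₀ 1) z ≠ ⊥ → 2 ≤ multiplicity (H.floquet k₀) z) ∧
      (H.isotypic k₀ 1 ≠ ⊥ → ∃ E : ℝ, eigenspace (H.Q k₀ 1) E ≠ ⊥ ∧
          2 ≤ multiplicity (H.floquet k₀) E)) := by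
  have hA : IsResolvent (H.floquet k₀).graph c (S 0) := by
    rw [floquet_graph hr hΓ]
    exact hS.isResolvent_zero hr hΓ
  have hc := hS.family.compact.self_of_nhds
  have hsym := hS.family.symm.self_of_nhds
  let hB := blochSymm_rot hk₀ hmR
  have hR0 : ∀ u, S 0 (rotOp hB u) = rotOp hB (S 0 u) :=
    fun u => (hS.comm_op hr hB hR norm_rotAdj (fun δ x => planeWave_rot δ x) u).symm
  have hK : IsIsotypic (rotOp hB) (H.isotypic k₀) := isIsotypic_rotOp hB
  have hQ : ∀ j, H.Q k₀ j = partIn (H.floquet k₀).graph (H.isotypic k₀ j) := fun j => by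
    rw [floquet_graph hr hΓ]; rfl
  obtain ⟨J, σ, hJ⟩ : ∃ J σ, IsExchange (H.isotypic k₀) (S 0) σ J := by
    rcases hFV with ⟨hF, hmF⟩ | ⟨hV, hmV⟩
    · let hb := blochSymm_reflect hk₀ hmF
      exact ⟨_, _, isExchange_reflect hB hb (hS.comm_op hr hb hF norm_reflect
        fun δ x => planeWave_reflect δ x)⟩
    · let hb : BlochSymm H.μ k₀ (starRingEnd ℂ) invert := blochSymm_invert hmV
      exact ⟨_, _, isExchange_invert hB hb (hS.comm_op hr hb hV (ρ := id) (fun _ => rfl)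
        conj_planeWave_invert)⟩
  have h2 : ∀ z : ℂ, eigenspace (H.Q k₀ 1) z ≠ ⊥ → 2 ≤ multiplicity (H.floquet k₀) z := by
    intro z hz
    rw [hQ] at hz
    exact hJ.two_le_multiplicity hK hA hc hsym hR0 hz
  refine ⟨⟨?_, fun j => ?_⟩, ?_, h2, fun hne => ?_⟩
  · have := hK.isOrthogonalSum hA hR0
    simpa only [← hQ] using this
  · rw [hQ]
    exact hK.selfAdj hA hsym hR0 j
  · rw [hQ, hQ]
    exact hJ.isospectral hK hA hc hsym hR0
  · obtain ⟨x, hx⟩ := hK.exists_eigenvalue hA hc hsym hR0 hne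
    rw [← hQ] at hx
    exact ⟨x, hx, h2 _ hx⟩

end PlaneOperator

/-! ### Differentiable families of inverses -/

section OperatorCalculus

variable {E : Type*} [NormedAddCommGroup E] [InnerProductSpace ℂ E]

theorem DifferentiableAt.ringInverse_clm [CompleteSpace E] {A : Plane → E →L[ℂ] E} {δ : Plane}
    (hA : DifferentiableAt ℝ A δ) (hu : IsUnit (A δ)) :
    DifferentiableAt ℝ (fun x => Ring.inverse (A x)) δ :=
  ((differentiableAt_inverse (𝕜 := ℂ) hu).restrictScalars ℝ).comp δ hA

theorem DifferentiableAt.mul_clm {A B : Plane → E →L[ℂ] E} {δ : Plane}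
    (hA : DifferentiableAt ℝ A δ) (hB : DifferentiableAt ℝ B δ) :
    DifferentiableAt ℝ (fun x => A x * B x) δ := by
  have hb : Differentiable ℂ (fun p : (E →L[ℂ] E) × (E →L[ℂ] E) => p.1 * p.2) :=
    differentiable_fst.mul differentiable_snd
  exact ((hb (A δ, B δ)).restrictScalars ℝ).comp δ (hA.prodMk hB)

theorem IsCompactFamily.of_differentiableAt {T : Plane → E →L[ℂ] E}
    (hc : ∀ᶠ δ in 𝓝 0, IsCompactOperator (T δ))
    (hs : ∀ᶠ δ in 𝓝 0, (T δ : E →ₗ[ℂ] E).IsSymmetric) (hd : DifferentiableAt ℝ T 0) :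
    IsCompactFamily T (fderiv ℝ T 0 : Plane →ₗ[ℝ] (E →L[ℂ] E)) := by
  refine ⟨hc, hs, ?_⟩
  have := hd.hasFDerivAt.isLittleO
  simpa using this

theorem isUnit_add_algebraMap [CompleteSpace E] {A : E →L[ℂ] E} (c : ℝ) (hA : ‖A‖ < c) :
    IsUnit (A + algebraMap ℂ (E →L[ℂ] E) c) := by
  have hc : 0 < c := (norm_nonneg A).trans_lt hA
  have h1 : ‖-((c : ℂ)⁻¹ • A)‖ < 1 := by
    rw [norm_neg, norm_smul, norm_inv, Complex.norm_real, Real.norm_of_nonneg hc.le,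
      inv_mul_lt_iff₀ hc, mul_one]
    exact hA
  have h2 := isUnit_one_sub_of_norm_lt_one h1
  have hc' : (c : ℂ) ≠ 0 := by exact_mod_cast hc.ne'
  have h3 : A + algebraMap ℂ (E →L[ℂ] E) c = Units.mk0 (c : ℂ) hc' • (1 - -((c : ℂ)⁻¹ • A)) := by
    ext u
    simp [Units.smul_def, Algebra.algebraMap_eq_smul_one, smul_smul, hc', add_comm]
  rw [h3]
  exact (isUnit_smul_iff _ _).2 h2

theorem ringInverse_mul_apply {A : E →L[ℂ] E} (h : IsUnit A) (u : E) :
    Ring.inverse A (A u) = u :=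
  congrArg (fun B : E →L[ℂ] E => B u) (Ring.inverse_mul_cancel A h)

theorem mul_ringInverse_apply {A : E →L[ℂ] E} (h : IsUnit A) (u : E) :
    A (Ring.inverse A u) = u :=
  congrArg (fun B : E →L[ℂ] E => B u) (Ring.mul_inverse_cancel A h)

theorem isSymmetric_ringInverse {A : E →L[ℂ] E} (h : IsUnit A)
    (hA : (A : E →ₗ[ℂ] E).IsSymmetric) : ((Ring.inverse A : E →L[ℂ] E) : E →ₗ[ℂ] E).IsSymmetric := by
  intro u v
  have h1 := hA (Ring.inverse A u) (Ring.inverse A v)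
  change inner ℂ (A (Ring.inverse A u)) _ = inner ℂ _ (A (Ring.inverse A v)) at h1
  rw [mul_ringInverse_apply h, mul_ringInverse_apply h] at h1
  exact h1.symm

/-- A differentiable family of symmetric operators on a finite-dimensional space. -/
theorem PlaneOperator.exists_isResolventFamily_of_finiteDimensional {H : PlaneOperator}
    {k₀ : Fin 2 → ℝ} [FiniteDimensional ℂ H.CellSpace]
    {T : Plane → H.CellSpace →L[ℂ] H.CellSpace} (hd : DifferentiableAt ℝ T 0)
    (hs : ∀ δ, (T δ : H.CellSpace →ₗ[ℂ] H.CellSpace).IsSymmetric)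
    (h : ∀ δ f g, H.twistedRel k₀ δ f g ↔ g = T δ f) :
    ∃ c S L, H.IsResolventFamily k₀ c S L := by
  -- With `c` above the norm, a Neumann series inverts `T δ + c` for all small `δ`.
  obtain ⟨c, hc⟩ := exists_gt ‖T 0‖
  have hev : ∀ᶠ δ in 𝓝 0, ‖T δ‖ < c := hd.continuousAt.norm.eventually (gt_mem_nhds hc)
  let A : Plane → H.CellSpace →L[ℂ] H.CellSpace :=
    fun δ => T δ + algebraMap ℂ (H.CellSpace →L[ℂ] H.CellSpace) c
  have hAs : ∀ δ, (A δ : H.CellSpace →ₗ[ℂ] H.CellSpace).IsSymmetric := by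
    intro δ u v
    have h1 : inner ℂ (T δ u) v = inner ℂ u (T δ v) := hs δ u v
    change inner ℂ (T δ u + (c : ℂ) • u) v = inner ℂ u (T δ v + (c : ℂ) • v)
    rw [inner_add_left, inner_add_right, h1, inner_smul_left, inner_smul_right, Complex.conj_ofReal]
  have hA : ∀ᶠ δ in 𝓝 0, IsUnit (A δ) := by
    filter_upwards [hev] with δ hδ
    exact isUnit_add_algebraMap c hδ
  have hAd : DifferentiableAt ℝ A 0 := hd.add_const _
  refine ⟨c, fun δ => Ring.inverse (A δ), _, IsCompactFamily.of_differentiableAt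
    (Eventually.of_forall fun δ => ?_) ?_
    (DifferentiableAt.ringInverse_clm hAd hA.self_of_nhds), ?_⟩
  · have := FiniteDimensional.proper ℂ H.CellSpace
    refine ⟨Metric.closedBall 0 1, isCompact_closedBall 0 1, ?_⟩
    refine (Ring.inverse (A δ)).continuous.continuousAt ?_
    rw [map_zero]
    exact Metric.closedBall_mem_nhds 0 one_pos
  · filter_upwards [hA] with δ hδ
    exact isSymmetric_ringInverse hδ (hAs δ)
  · filter_upwards [hA] with δ hδ f g
    rw [h]
    have e : ∀ f, A δ f = T δ f + (c : ℂ) • f := fun f => rfl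
    constructor
    · rintro rfl
      rw [← e, ringInverse_mul_apply hδ]
    · intro hf
      have := congrArg (A δ) hf
      rw [mul_ringInverse_apply hδ, e] at this
      exact (add_right_cancel this).symm

end OperatorCalculus

/-! ### The matrix of a discrete operator and its invariance -/

namespace EmbeddedGraph

variable (G : EmbeddedGraph)

/-- The value of `Hψ` at a vertex. -/
def app (v : G.vertices) : (Plane → ℂ) →ₗ[ℂ] ℂ where
  toFun ψ := ∑ u ∈ (G.locally_finite v).toFinset, (G.weight v u : ℂ) * (ψ v - ψ u) +
    (G.potential v : ℂ) * ψ v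
  map_add' ψ φ := by
    have e : ∀ u : G.vertices, (G.weight v u : ℂ) * ((ψ v + φ v) - (ψ u + φ u)) =
      (G.weight v u : ℂ) * (ψ v - ψ u) + (G.weight v u : ℂ) * (φ v - φ u) := fun u => by ring
    simp only [Pi.add_apply, e, Finset.sum_add_distrib]; ring
  map_smul' c ψ := by
    have e : ∀ u : G.vertices, (G.weight v u : ℂ) * (c * ψ v - c * ψ u) =
      c * ((G.weight v u : ℂ) * (ψ v - ψ u)) := fun u => by ring
    simp only [Pi.smul_apply, smul_eq_mul, e, ← Finset.mul_sum, RingHom.id_apply]; ring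

theorem app_def (v : G.vertices) (ψ : Plane → ℂ) :
    G.app v ψ = ∑ u ∈ (G.locally_finite v).toFinset, (G.weight v u : ℂ) * (ψ v - ψ u) +
      (G.potential v : ℂ) * ψ v := rfl

theorem mem_rel {ψ η : Plane → ℂ} :
    (ψ, η) ∈ (discreteSchrodinger G).rel ↔ ∀ v : G.vertices, η v = G.app v ψ := Iff.rfl

theorem app_congr (v : G.vertices) {ψ φ : Plane → ℂ} (h : ∀ u : G.vertices, ψ u = φ u) :
    G.app v ψ = G.app v φ := by simp only [app_def, h]

theorem app_conj (v : G.vertices) (ψ : Plane → ℂ) :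
    G.app v (fun x => starRingEnd ℂ (ψ x)) = starRingEnd ℂ (G.app v ψ) := by
  simp [app_def]

open scoped Classical in
/-- The matrix of the operator. -/
def kernel (x y : Plane) : ℂ :=
  if hx : x ∈ G.vertices then G.app ⟨x, hx⟩ (Pi.single y 1) else 0

theorem kernel_of_mem (v : G.vertices) (y : Plane) :
    G.kernel v y = G.app v (Pi.single y 1) := by
  simp [kernel]

theorem kernel_eq_zero_of_left {x y : Plane} (hx : x ∉ G.vertices) : G.kernel x y = 0 := by
  simp [kernel, hx]

theorem kernel_eq_zero_of_right {x y : Plane} (hy : y ∉ G.vertices) : G.kernel x y = 0 := by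
  by_cases hx : x ∈ G.vertices
  · rw [G.kernel_of_mem ⟨x, hx⟩, G.app_congr (φ := 0), map_zero]
    intro u
    have : (u : Plane) ≠ y := fun h => hy (h ▸ u.2)
    simp [this]
  · exact G.kernel_eq_zero_of_left hx

theorem mem_of_kernel_ne_zero {x y : Plane} (h : G.kernel x y ≠ 0) :
    x ∈ G.vertices ∧ y ∈ G.vertices :=
  ⟨by_contra fun hx => h (G.kernel_eq_zero_of_left hx),
    by_contra fun hy => h (G.kernel_eq_zero_of_right hy)⟩

theorem conj_kernel (x y : Plane) : starRingEnd ℂ (G.kernel x y) = G.kernel x y := by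
  by_cases hx : x ∈ G.vertices
  · rw [G.kernel_of_mem ⟨x, hx⟩, ← app_conj]
    congr 1
    ext u
    by_cases h : u = y <;> simp [h]
  · rw [G.kernel_eq_zero_of_left hx, map_zero]

theorem kernel_of_ne {v u : G.vertices} (h : v ≠ u) : G.kernel v u =
    if u ∈ (G.locally_finite v).toFinset then -(G.weight v u : ℂ) else 0 := by
  have h' : (v : Plane) ≠ u := fun e => h (Subtype.ext e)
  rw [kernel_of_mem, app_def, Pi.single_eq_of_ne h', mul_zero, add_zero]
  by_cases hu : u ∈ (G.locally_finite v).toFinset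
  · rw [if_pos hu, Finset.sum_eq_single u]
    · simp
    · intro w _ hw
      have : (w : Plane) ≠ u := fun e => hw (Subtype.ext e)
      simp [this]
    · exact fun h => absurd hu h
  · rw [if_neg hu]
    refine Finset.sum_eq_zero fun w hw => ?_
    have : (w : Plane) ≠ u := fun e => hu (Subtype.ext e ▸ hw)
    simp [this]

theorem kernel_symm (x y : Plane) : G.kernel x y = G.kernel y x := by
  by_cases hxy : x = y
  · rw [hxy]
  by_cases hx : x ∈ G.vertices
  · by_cases hy : y ∈ G.vertices
    · have hne : (⟨x, hx⟩ : G.vertices) ≠ ⟨y, hy⟩ := fun e => hxy (congrArg Subtype.val e)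
      have h1 := G.kernel_of_ne hne
      have h2 := G.kernel_of_ne hne.symm
      simp only at h1 h2
      rw [h1, h2, G.weight_symm]
      have : (⟨y, hy⟩ : G.vertices) ∈ (G.locally_finite ⟨x, hx⟩).toFinset ↔
          (⟨x, hx⟩ : G.vertices) ∈ (G.locally_finite ⟨y, hy⟩).toFinset := by
        simp [SimpleGraph.adj_comm]
      simp only [this]
    · rw [G.kernel_eq_zero_of_right hy, G.kernel_eq_zero_of_left hy]
  · rw [G.kernel_eq_zero_of_right hx, G.kernel_eq_zero_of_left hx]

open scoped Classical in
theorem exists_app_eq_sum (v : G.vertices) : ∃ B : Finset Plane, ∀ ψ : Plane → ℂ,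
    G.app v ψ = ∑ y ∈ B, G.kernel v y * ψ y := by
  refine ⟨insert (v : Plane) ((G.locally_finite v).toFinset.image Subtype.val), fun ψ => ?_⟩
  set B := insert (v : Plane) ((G.locally_finite v).toFinset.image Subtype.val) with hB
  have h1 : G.app v ψ = G.app v (∑ y ∈ B, ψ y • Pi.single y (1 : ℂ)) := by
    have h2 : ∀ x ∈ B, (∑ y ∈ B, ψ y • (Pi.single y (1 : ℂ) : Plane → ℂ)) x = ψ x := by
      intro x hx
      rw [Finset.sum_apply, Finset.sum_eq_single x]
      · simp
      · intro y _ hy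
        simp [Pi.single_eq_of_ne hy.symm]
      · exact fun h => absurd hx h
    rw [app_def, app_def, h2 v (Finset.mem_insert_self _ _)]
    congr 1
    refine Finset.sum_congr rfl fun u hu => ?_
    rw [h2 u (Finset.mem_insert_of_mem (Finset.mem_image_of_mem _ hu))]
  rw [h1, map_sum]
  refine Finset.sum_congr rfl fun y _ => ?_
  rw [map_smul, ← kernel_of_mem, smul_eq_mul, mul_comm]

theorem finite_kernel (x : Plane) : {y | G.kernel x y ≠ 0}.Finite := by
  by_cases hx : x ∈ G.vertices
  · obtain ⟨B, hB⟩ := G.exists_app_eq_sum ⟨x, hx⟩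
    refine B.finite_toSet.subset fun y hy => ?_
    by_contra hyB
    refine hy ?_
    have h1 := hB (Pi.single y 1)
    rw [← G.kernel_of_mem ⟨x, hx⟩] at h1
    rw [h1]
    refine Finset.sum_eq_zero fun z hz => ?_
    have : z ≠ y := fun e => hyB (e ▸ hz)
    rw [Pi.single_eq_of_ne this, mul_zero]
  · simp [G.kernel_eq_zero_of_left hx]

/-- The vertices that interact with `x`. -/
def neighbours (x : Plane) : Finset Plane := (G.finite_kernel x).toFinset

theorem mem_neighbours {x y : Plane} : y ∈ G.neighbours x ↔ G.kernel x y ≠ 0 := by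
  simp [neighbours]

theorem app_eq_sum (v : G.vertices) (ψ : Plane → ℂ) :
    G.app v ψ = ∑ y ∈ G.neighbours v, G.kernel v y * ψ y := by
  obtain ⟨B, hB⟩ := G.exists_app_eq_sum v
  classical
  have h1 : ∑ y ∈ B, G.kernel v y * ψ y = ∑ y ∈ B ∪ G.neighbours v, G.kernel v y * ψ y := by
    refine Finset.sum_subset Finset.subset_union_left fun y hy hyB => ?_
    have h2 := hB (Pi.single y 1)
    rw [← kernel_of_mem] at h2
    rw [h2, Finset.sum_eq_zero, zero_mul]
    intro z hz
    have : z ≠ y := fun e => hyB (e ▸ hz)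
    rw [Pi.single_eq_of_ne this, mul_zero]
  rw [hB, h1]
  refine (Finset.sum_subset Finset.subset_union_right fun y _ hy => ?_).symm
  rw [mem_neighbours, not_not] at hy
  rw [hy, zero_mul]

variable {G}

/-- The vertex set is invariant under the symmetries of the operator. -/
theorem mem_of_invariant {T : Plane → Plane} (hT : (discreteSchrodinger G).Invariant T)
    {x : Plane} (hx : x ∈ G.vertices) : T x ∈ G.vertices := by
  by_contra hn
  -- The relation only sees values at vertices, so a delta function off the vertices is an
  -- admissible image of `0`. Its pullback by `T` has the value `1` at the vertex `x`, where the
  -- image of `0` must vanish.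
  have h0 : ((0 : Plane → ℂ), (Pi.single (T x) 1 : Plane → ℂ)) ∈ (discreteSchrodinger G).rel := by
    rw [mem_rel]
    intro v
    have : (v : Plane) ≠ T x := fun e => hn (e ▸ v.2)
    rw [map_zero, Pi.single_eq_of_ne this]
  have h1 := G.mem_rel.1 (hT _ _ h0) ⟨x, hx⟩
  have e : ((0 : Plane → ℂ) ∘ T) = 0 := rfl
  rw [e, map_zero] at h1
  simp at h1

/-- Invariance is applied to the delta function at `T y`, whose pullback by the injective `T` is the
delta function at `y`. -/
theorem kernel_comp {T T' : Plane → Plane} (hT : (discreteSchrodinger G).Invariant T)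
    (hl : ∀ x, T' (T x) = x)
    (hT' : ∀ x, T x ∈ G.vertices ↔ x ∈ G.vertices) (x y : Plane) :
    G.kernel (T x) (T y) = G.kernel x y := by
  by_cases hx : x ∈ G.vertices
  · have hTx := (hT' x).2 hx
    classical
    have h0 : ((Pi.single (T y) 1 : Plane → ℂ), fun z => if hz : z ∈ G.vertices then
        G.app ⟨z, hz⟩ (Pi.single (T y) 1) else 0) ∈ (discreteSchrodinger G).rel := by
      rw [mem_rel]
      intro v
      simp
    have h1 := G.mem_rel.1 (hT _ _ h0) ⟨x, hx⟩
    have e : ((Pi.single (T y) 1 : Plane → ℂ) ∘ T) = Pi.single y 1 := by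
      ext z
      by_cases h : z = y
      · simp [h]
      · have : T z ≠ T y := fun e => h (by rw [← hl z, e, hl])
        simp [Pi.single_eq_of_ne h, Pi.single_eq_of_ne this]
    rw [e] at h1
    simp only [Function.comp_apply, hTx, dif_pos] at h1
    rw [G.kernel_of_mem ⟨x, hx⟩, G.kernel_of_mem ⟨T x, hTx⟩, h1]
  · rw [G.kernel_eq_zero_of_left hx, G.kernel_eq_zero_of_left (mt (hT' x).1 hx)]

theorem vadd_mem (hΓ : ∀ m n : ℤ, (discreteSchrodinger G).Invariant (shift m n)) (g : ℤ × ℤ)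
    (x : Plane) : g +ᵥ x ∈ G.vertices ↔ x ∈ G.vertices := by
  refine ⟨fun h => ?_, fun h => mem_of_invariant (hΓ g.1 g.2) h⟩
  have := mem_of_invariant (hΓ (-g).1 (-g).2) h
  rw [← vadd_def, neg_vadd_vadd] at this
  exact this

theorem kernel_vadd (hΓ : ∀ m n : ℤ, (discreteSchrodinger G).Invariant (shift m n)) (g : ℤ × ℤ)
    (x y : Plane) : G.kernel (g +ᵥ x) (g +ᵥ y) = G.kernel x y :=
  kernel_comp (T := fun x => g +ᵥ x) (T' := fun x => -g +ᵥ x) (hΓ g.1 g.2) (neg_vadd_vadd g)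
    (vadd_mem hΓ g) x y

/-- Countably many translates of the cell contain finitely many vertices each. This makes the vertex
set measurable. -/
theorem countable_vertices (hΓ : ∀ m n : ℤ, (discreteSchrodinger G).Invariant (shift m n)) :
    G.vertices.Countable := by
  refine (Set.countable_iUnion fun g : ℤ × ℤ =>
    (G.finite_cell.countable.image (fun x => g +ᵥ x))).mono fun x hx => ?_
  refine Set.mem_iUnion.2 ⟨floorPt x, basePt x, ⟨?_, basePt_mem x⟩, ?_⟩
  · exact (vadd_mem hΓ _ x).2 hx
  · exact vadd_neg_vadd _ x

/-- The counting measure on the vertices. -/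
def measure (G : EmbeddedGraph) : Measure Plane := Measure.count.restrict G.vertices

theorem ae_iff (hΓ : ∀ m n : ℤ, (discreteSchrodinger G).Invariant (shift m n)) {p : Plane → Prop} :
    (∀ᵐ x ∂G.measure, p x) ↔ ∀ x ∈ G.vertices, p x := by
  rw [measure, ae_restrict_iff' (countable_vertices hΓ).measurableSet, Measure.ae_count_iff]

theorem measurePreserving (hΓ : ∀ m n : ℤ, (discreteSchrodinger G).Invariant (shift m n))
    {T : Plane → Plane} (hTm : Measurable T) (hTb : Function.Bijective T)
    (hT : ∀ x, T x ∈ G.vertices ↔ x ∈ G.vertices) : MeasurePreserving T G.measure G.measure := by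
  refine ⟨hTm, ?_⟩
  have hV := (countable_vertices hΓ).measurableSet
  ext s hs
  rw [Measure.map_apply hTm hs, measure, Measure.restrict_apply (hTm hs), Measure.restrict_apply hs]
  have e : T ⁻¹' s ∩ G.vertices = T ⁻¹' (s ∩ G.vertices) := by
    ext x; simp [hT]
  rw [e, Measure.count_apply (hTm (hs.inter hV)), Measure.count_apply (hs.inter hV),
    Set.encard_preimage_of_bijective hTb]

theorem vaddInvariantMeasure (hΓ : ∀ m n : ℤ, (discreteSchrodinger G).Invariant (shift m n)) :
    VAddInvariantMeasure (ℤ × ℤ) Plane G.measure where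
  measure_preimage_vadd g _ hs :=
    (measurePreserving hΓ (measurable_const_vadd g) (AddAction.bijective g)
      (vadd_mem hΓ g)).measure_preimage hs.nullMeasurableSet

theorem isRegular (hΓ : ∀ m n : ℤ, (discreteSchrodinger G).Invariant (shift m n)) :
    (discreteSchrodinger G).IsRegular where
  congr {ψ η ψ' η'} h h1 h2 := by
    rw [EventuallyEq, show (discreteSchrodinger G).μ = G.measure from rfl, ae_iff hΓ] at h1 h2
    rw [mem_rel] at h ⊢
    intro v
    rw [← h2 v v.2, h, G.app_congr v fun u => h1 u u.2]
  single {η} h := by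
    rw [EventuallyEq, show (discreteSchrodinger G).μ = G.measure from rfl, ae_iff hΓ]
    intro x hx
    have := G.mem_rel.1 h ⟨x, hx⟩
    rw [map_zero] at this
    exact this
  conj {ψ η} h := by
    rw [mem_rel] at h ⊢
    intro v
    rw [app_conj, h]

end EmbeddedGraph

/-! ### The twisted discrete operator as a finite matrix -/

namespace EmbeddedGraph

variable {G : EmbeddedGraph}

/-- The vertices in the fundamental domain. -/
def cellVertices (G : EmbeddedGraph) : Finset Plane := G.finite_cell.toFinset

theorem mem_cellVertices {x : Plane} : x ∈ G.cellVertices ↔ x ∈ G.vertices ∧ x ∈ cell := by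
  simp [cellVertices]

theorem measure_restrict_cell (G : EmbeddedGraph) :
    G.measure.restrict cell = Measure.count.restrict (G.cellVertices : Set Plane) := by
  rw [measure, Measure.restrict_restrict measurableSet_cell, cellVertices, Set.Finite.coe_toFinset,
    Set.inter_comm]

theorem ae_cell_iff {p : Plane → Prop} :
    (∀ᵐ x ∂G.measure.restrict cell, p x) ↔ ∀ x ∈ G.cellVertices, p x := by
  rw [measure_restrict_cell, ae_restrict_iff' (Finset.measurableSet _), Measure.ae_count_iff]
  rfl

theorem cell_ext {f g : CellL2 G.measure} (h : ∀ x ∈ G.cellVertices, f x = g x) : f = g :=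
  Lp.ext (ae_cell_iff.2 h)

theorem inner_cell (f g : CellL2 G.measure) :
    inner ℂ f g = ∑ x ∈ G.cellVertices, starRingEnd ℂ (f x) * g x := by
  have key : ∀ F : Plane → ℂ, ∫ x in cell, F x ∂G.measure = ∑ x ∈ G.cellVertices, F x := by
    intro F
    have hi : IntegrableOn F (G.cellVertices : Set Plane) Measure.count := by
      rw [← (G.cellVertices : Set Plane).biUnion_of_singleton]
      exact (integrableOn_finset_iUnion (s := G.cellVertices)).2 fun x _ =>
        integrableOn_singleton (by finiteness) (by simp)
    rw [measure_restrict_cell, setIntegral_finset _ hi]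
    refine Finset.sum_congr rfl fun x _ => ?_
    rw [measureReal_def, Measure.count_singleton]
    simp
  rw [L2.inner_def, key]
  exact Finset.sum_congr rfl fun x _ => RCLike.inner_apply' _ _

/-- The point evaluations. -/
def evalAt (x : G.cellVertices) : CellL2 G.measure →ₗ[ℂ] ℂ where
  toFun f := f x
  map_add' f g := ae_cell_iff.1 (Lp.coeFn_add f g) x x.2
  map_smul' c f := ae_cell_iff.1 (Lp.coeFn_smul c f) x x.2

instance : FiniteDimensional ℂ (CellL2 G.measure) := by
  let e : CellL2 G.measure →ₗ[ℂ] (G.cellVertices → ℂ) := LinearMap.pi evalAt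
  refine FiniteDimensional.of_injective e fun f g h => cell_ext fun x hx => ?_
  exact congrFun h ⟨x, hx⟩

theorem memLp_single (x : Plane) (c : ℂ) :
    MemLp (Pi.single x c : Plane → ℂ) 2 (G.measure.restrict cell) := by
  have hm : Measurable (Pi.single x c : Plane → ℂ) := by
    classical
    have : (Pi.single x c : Plane → ℂ) = Set.indicator {x} fun _ => c := by
      ext y
      by_cases h : y = x <;> simp [h]
    rw [this]
    exact measurable_const.indicator (measurableSet_singleton x)
  rw [measure_restrict_cell]
  have : IsFiniteMeasure (Measure.count.restrict (G.cellVertices : Set Plane)) :=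
    ⟨by rw [Measure.restrict_apply_univ, Measure.count_apply_finset]; exact ENNReal.natCast_lt_top _⟩
  refine MemLp.of_bound hm.aestronglyMeasurable ‖c‖ (Eventually.of_forall fun y => ?_)
  by_cases h : y = x <;> simp [h]

/-- The function that is `1` at `x` and vanishes at the other vertices of the cell. -/
def basisAt (G : EmbeddedGraph) (x : Plane) : CellL2 G.measure := (memLp_single x 1).toLp _

theorem basisAt_apply (x : Plane) {y : Plane} (hy : y ∈ G.cellVertices) :
    G.basisAt x y = (Pi.single x 1 : Plane → ℂ) y :=
  ae_cell_iff.1 (memLp_single x 1).coeFn_toLp y hy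

section Twisted

variable (hΓ : ∀ m n : ℤ, (discreteSchrodinger G).Invariant (shift m n)) (k₀ : Fin 2 → ℝ)

include hΓ in
theorem basePt_mem_cellVertices {x : Plane} (hx : x ∈ G.vertices) :
    basePt x ∈ G.cellVertices :=
  mem_cellVertices.2 ⟨(vadd_mem hΓ _ x).2 hx, basePt_mem x⟩

open scoped Classical in
/-- The value at `x` of the Bloch function that extends `f`. -/
def extAt (hΓ : ∀ m n : ℤ, (discreteSchrodinger G).Invariant (shift m n)) (k₀ : Fin 2 → ℝ)
    (x : Plane) : CellL2 G.measure →L[ℂ] ℂ :=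
  LinearMap.toContinuousLinearMap (if hx : x ∈ G.vertices then
    phase k₀ (floorPt x) • evalAt ⟨basePt x, basePt_mem_cellVertices hΓ hx⟩ else 0)

theorem extAt_apply {x : Plane} (hx : x ∈ G.vertices) (f : CellL2 G.measure) :
    extAt hΓ k₀ x f = ext k₀ f x := by
  simp [extAt, hx, evalAt, ext]

/-- The operator `exp (-i δ·x) H exp (i δ·x)` on the cell space. -/
def twisted (δ : Plane) : CellL2 G.measure →L[ℂ] CellL2 G.measure :=
  ∑ x ∈ G.cellVertices, ∑ y ∈ G.neighbours x,
    planeWave δ (y - x) • (G.kernel x y • (extAt hΓ k₀ y).smulRight (G.basisAt x))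

theorem planeWave_sub (δ x y : Plane) :
    planeWave δ (y - x) = starRingEnd ℂ (planeWave δ x) * planeWave δ y := by
  rw [conj_planeWave, planeWave, planeWave, planeWave, ← Complex.exp_add, inner_sub_right,
    inner_neg_left]
  congr 1; push_cast; ring

theorem twisted_apply (δ : Plane) (f : CellL2 G.measure) {x : Plane} (hx : x ∈ G.cellVertices) :
    twisted hΓ k₀ δ f x = starRingEnd ℂ (planeWave δ x) *
      ∑ y ∈ G.neighbours x, G.kernel x y * (planeWave δ y * ext k₀ f y) := by
  have h1 : twisted hΓ k₀ δ f x = evalAt ⟨x, hx⟩ (twisted hΓ k₀ δ f) := rfl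
  rw [h1, twisted, sum_apply, map_sum, Finset.sum_eq_single x]
  · rw [sum_apply, map_sum, Finset.mul_sum]
    refine Finset.sum_congr rfl fun y hy => ?_
    have h2 : evalAt ⟨x, hx⟩ (G.basisAt x) = 1 := by
      change G.basisAt x x = 1
      rw [basisAt_apply x hx, Pi.single_eq_same]
    simp only [FunLike.coe_smul, Pi.smul_apply, ContinuousLinearMap.smulRight_apply, map_smul, h2]
    rw [extAt_apply hΓ k₀ (G.mem_of_kernel_ne_zero (G.mem_neighbours.1 hy)).2, planeWave_sub]
    simp only [smul_eq_mul]; ring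
  · intro z _ hzx
    have h2 : evalAt ⟨x, hx⟩ (G.basisAt z) = 0 := by
      change G.basisAt z x = 0
      rw [basisAt_apply z hx, Pi.single_eq_of_ne hzx.symm]
    rw [sum_apply, map_sum]
    refine Finset.sum_eq_zero fun y _ => ?_
    simp only [FunLike.coe_smul, Pi.smul_apply, ContinuousLinearMap.smulRight_apply, map_smul, h2,
      smul_zero]
  · exact fun h => absurd hx h

theorem differentiable_twisted : Differentiable ℝ (twisted hΓ k₀) := by
  unfold twisted
  refine Differentiable.fun_sum fun x _ => Differentiable.fun_sum fun y _ => ?_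
  have : Differentiable ℝ fun δ => planeWave δ (y - x) := by
    unfold planeWave
    have h1 : Differentiable ℝ fun δ : Plane => inner ℝ δ (y - x) :=
      differentiable_id.inner ℝ (differentiable_const _)
    have h2 : Differentiable ℝ fun δ : Plane => ((inner ℝ δ (y - x) : ℝ) : ℂ) :=
      Complex.ofRealCLM.differentiable.comp h1
    exact (h2.const_mul Complex.I).cexp
  exact this.smul_const _

include hΓ in
-- Both sums run over the pairs of interacting vertices modulo the diagonal action of the lattice,
-- normalised by putting either the first or the second vertex into the cell. The bijection shifts a
-- pair so that its second vertex enters the cell, and swaps.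
theorem sum_swap {b : Plane → Plane → ℂ} (hb : ∀ (g : ℤ × ℤ) x y, b (g +ᵥ x) (g +ᵥ y) = b x y) :
    ∑ x ∈ G.cellVertices, ∑ y ∈ G.neighbours x, b x y =
      ∑ x ∈ G.cellVertices, ∑ y ∈ G.neighbours x, b y x := by
  rw [Finset.sum_sigma', Finset.sum_sigma']
  have hmem : ∀ p ∈ G.cellVertices.sigma fun x => G.neighbours x,
      (⟨basePt p.2, -floorPt p.2 +ᵥ p.1⟩ : (_ : Plane) × Plane) ∈
        G.cellVertices.sigma fun x => G.neighbours x := by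
    rintro ⟨x, y⟩ hp
    rw [Finset.mem_sigma] at hp ⊢
    have hk := G.mem_neighbours.1 hp.2
    refine ⟨basePt_mem_cellVertices hΓ (G.mem_of_kernel_ne_zero hk).2, ?_⟩
    rw [mem_neighbours, basePt, kernel_vadd hΓ, kernel_symm]
    exact hk
  have hinv : ∀ p ∈ G.cellVertices.sigma fun x => G.neighbours x,
      (⟨basePt (-floorPt p.2 +ᵥ p.1), -floorPt (-floorPt p.2 +ᵥ p.1) +ᵥ basePt p.2⟩ :
        (_ : Plane) × Plane) = p := by
    rintro ⟨x, y⟩ hp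
    rw [Finset.mem_sigma] at hp
    have hx := (mem_cellVertices.1 hp.1).2
    have h1 : floorPt (-floorPt y +ᵥ x) = -floorPt y := by
      rw [floorPt_vadd, (mem_cell_iff x).1 hx, zero_add]
    simp only [basePt_vadd, basePt_of_mem hx, h1, neg_neg]
    rw [basePt, vadd_neg_vadd]
  refine Finset.sum_bij' (fun p _ => ⟨basePt p.2, -floorPt p.2 +ᵥ p.1⟩)
    (fun p _ => ⟨basePt p.2, -floorPt p.2 +ᵥ p.1⟩) hmem hmem hinv hinv ?_
  rintro ⟨x, y⟩ _
  simp only [basePt, hb]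

include hΓ in
theorem kernel_twist_invariant (δ : Plane) (f g : CellL2 G.measure) (γ : ℤ × ℤ) (x y : Plane) :
    starRingEnd ℂ (planeWave δ (γ +ᵥ x) * ext k₀ f (γ +ᵥ x)) * (G.kernel (γ +ᵥ x) (γ +ᵥ y) *
      (planeWave δ (γ +ᵥ y) * ext k₀ g (γ +ᵥ y))) =
    starRingEnd ℂ (planeWave δ x * ext k₀ f x) * (G.kernel x y *
      (planeWave δ y * ext k₀ g y)) := by
  have hpw : ∀ z : Plane, planeWave δ (γ +ᵥ z) =
      planeWave δ ((γ.1 : ℝ) • a₁ + (γ.2 : ℝ) • a₂) * planeWave δ z := by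
    intro z
    rw [planeWave, planeWave, planeWave, ← Complex.exp_add, vadd_eq_add, inner_add_right]
    congr 1; push_cast; ring
  rw [kernel_vadd hΓ, hpw, hpw, isQuasiPeriodic_ext, isQuasiPeriodic_ext]
  set u := planeWave δ ((γ.1 : ℝ) • a₁ + (γ.2 : ℝ) • a₂) with hu
  have h1 : starRingEnd ℂ u * u = 1 := by rw [Complex.conj_mul', hu, norm_planeWave]; simp
  have h2 : starRingEnd ℂ (phase k₀ γ) * phase k₀ γ = 1 := by
    rw [Complex.conj_mul', norm_phase]; simp
  simp only [map_mul]
  linear_combination (starRingEnd ℂ (planeWave δ x) * starRingEnd ℂ (ext k₀ f x) *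
    G.kernel x y * planeWave δ y * ext k₀ g y) * (starRingEnd ℂ (phase k₀ γ) * phase k₀ γ * h1 + h2)

/-- The kernel is real and symmetric, and the summand of the sesquilinear form is invariant under
the lattice, since its phases cancel; `sum_swap` exchanges the two variables. -/
theorem isSymmetric_twisted (δ : Plane) :
    (twisted hΓ k₀ δ : CellL2 G.measure →ₗ[ℂ] CellL2 G.measure).IsSymmetric := by
  intro f g
  change inner ℂ (twisted hΓ k₀ δ f) g = inner ℂ f (twisted hΓ k₀ δ g)
  rw [inner_cell, inner_cell]
  have hext : ∀ x ∈ G.cellVertices, ∀ f : CellL2 G.measure, f x = ext k₀ f x := fun x hx f =>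
    (ext_of_mem k₀ f (mem_cellVertices.1 hx).2).symm
  have e2 : ∑ x ∈ G.cellVertices, starRingEnd ℂ (f x) * twisted hΓ k₀ δ g x =
      ∑ x ∈ G.cellVertices, ∑ y ∈ G.neighbours x,
        starRingEnd ℂ (planeWave δ x * ext k₀ f x) * (G.kernel x y *
          (planeWave δ y * ext k₀ g y)) := by
    refine Finset.sum_congr rfl fun x hx => ?_
    rw [twisted_apply hΓ k₀ δ g hx, hext x hx f, Finset.mul_sum, Finset.mul_sum]
    refine Finset.sum_congr rfl fun y _ => ?_
    rw [map_mul]; ring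
  have e1 : ∑ x ∈ G.cellVertices, starRingEnd ℂ (twisted hΓ k₀ δ f x) * g x =
      ∑ x ∈ G.cellVertices, ∑ y ∈ G.neighbours x,
        starRingEnd ℂ (planeWave δ y * ext k₀ f y) * (G.kernel y x *
          (planeWave δ x * ext k₀ g x)) := by
    refine Finset.sum_congr rfl fun x hx => ?_
    rw [twisted_apply hΓ k₀ δ f hx, hext x hx g, Finset.mul_sum, map_sum, Finset.sum_mul]
    refine Finset.sum_congr rfl fun y _ => ?_
    simp only [map_mul, conj_kernel, Complex.conj_conj, G.kernel_symm y x]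
    ring
  rw [e1, e2]
  exact (sum_swap hΓ (b := fun x y => starRingEnd ℂ (planeWave δ x * ext k₀ f x) *
    (G.kernel x y * (planeWave δ y * ext k₀ g y))) (kernel_twist_invariant hΓ k₀ δ f g)).symm

/-- Both sides of the equation are multiplied by the same factor under a translation, so it holds at
all vertices once it holds at those of the cell. -/
theorem twistedRel_iff (δ : Plane) (f g : CellL2 G.measure) :
    (discreteSchrodinger G).twistedRel k₀ δ f g ↔ g = twisted hΓ k₀ δ f := by
  change (_, _) ∈ (discreteSchrodinger G).rel ↔ _
  rw [mem_rel]
  have hcell : ∀ x ∈ G.cellVertices, (planeWave δ x * ext k₀ g x =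
      ∑ y ∈ G.neighbours x, G.kernel x y * (planeWave δ y * ext k₀ f y) ↔
        g x = twisted hΓ k₀ δ f x) := by
    intro x hx
    have h1 : starRingEnd ℂ (planeWave δ x) * planeWave δ x = 1 := by
      rw [Complex.conj_mul', norm_planeWave]; simp
    rw [twisted_apply hΓ k₀ δ f hx, ext_of_mem k₀ g (mem_cellVertices.1 hx).2]
    constructor
    · intro h
      rw [← h, ← mul_assoc, h1, one_mul]
    · intro h
      rw [h, ← mul_assoc, mul_comm (planeWave δ x), h1, one_mul]
  constructor
  · intro h
    refine cell_ext fun x hx => ?_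
    rw [← hcell x hx]
    have := h ⟨x, (mem_cellVertices.1 hx).1⟩
    rwa [app_eq_sum] at this
  · intro h v
    rw [app_eq_sum]
    have hb := (hcell _ (basePt_mem_cellVertices hΓ v.2)).2 (by rw [h])
    have hv : floorPt (v : Plane) +ᵥ basePt v = (v : Plane) := vadd_neg_vadd _ _
    have hpw : ∀ z : Plane, planeWave δ (floorPt (v : Plane) +ᵥ z) = planeWave δ
        (((floorPt (v : Plane)).1 : ℝ) • a₁ + ((floorPt (v : Plane)).2 : ℝ) • a₂) *
          planeWave δ z := by
      intro z
      rw [planeWave, planeWave, planeWave, ← Complex.exp_add, vadd_eq_add, inner_add_right]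
      congr 1; push_cast; ring
    have hs : ∑ y ∈ G.neighbours (v : Plane), G.kernel v y * (planeWave δ y * ext k₀ f y) =
        ∑ y ∈ G.neighbours (basePt v), G.kernel v (floorPt (v : Plane) +ᵥ y) *
          (planeWave δ (floorPt (v : Plane) +ᵥ y) * ext k₀ f (floorPt (v : Plane) +ᵥ y)) := by
      refine Finset.sum_bij' (fun y _ => -floorPt (v : Plane) +ᵥ y)
        (fun y _ => floorPt (v : Plane) +ᵥ y) ?_ ?_ ?_ ?_ ?_
      · intro y hy
        rw [mem_neighbours] at hy ⊢
        rwa [basePt, kernel_vadd hΓ]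
      · intro y hy
        rw [mem_neighbours] at hy ⊢
        rw [← kernel_vadd hΓ (floorPt (v : Plane)), hv] at hy
        exact hy
      · exact fun y _ => vadd_neg_vadd _ _
      · exact fun y _ => neg_vadd_vadd _ _
      · intro y _
        rw [vadd_neg_vadd]
    have hk : ∀ y, G.kernel v (floorPt (v : Plane) +ᵥ y) = G.kernel (basePt v) y := by
      intro y
      conv_lhs => rw [← hv]
      rw [floorPt_vadd, (mem_cell_iff _).1 (basePt_mem _), zero_add, kernel_vadd hΓ]
    suffices h' : planeWave δ v * ext k₀ (g : CellL2 G.measure) v = _ from h'.trans hs.symm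
    simp only [hk, hpw, isQuasiPeriodic_ext k₀ f _ _]
    have e : ∀ y, G.kernel (basePt v) y * (planeWave δ
        (((floorPt (v : Plane)).1 : ℝ) • a₁ + ((floorPt (v : Plane)).2 : ℝ) • a₂) *
          planeWave δ y * (phase k₀ (floorPt (v : Plane)) * ext k₀ f y)) = (planeWave δ
        (((floorPt (v : Plane)).1 : ℝ) • a₁ + ((floorPt (v : Plane)).2 : ℝ) • a₂) *
        phase k₀ (floorPt (v : Plane))) * (G.kernel (basePt v) y * (planeWave δ y * ext k₀ f y)) :=
      fun y => by ring
    simp only [e]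
    rw [← Finset.mul_sum, ← hb]
    conv_lhs => rw [← hv, hpw, isQuasiPeriodic_ext]
    ring

include hΓ in
theorem exists_isResolventFamily : ∃ c S L, (discreteSchrodinger G).IsResolventFamily k₀ c S L := by
  have : FiniteDimensional ℂ (discreteSchrodinger G).CellSpace :=
    inferInstanceAs (FiniteDimensional ℂ (CellL2 G.measure))
  exact PlaneOperator.exists_isResolventFamily_of_finiteDimensional
    (differentiable_twisted hΓ k₀ 0) (isSymmetric_twisted hΓ k₀) (twistedRel_iff hΓ k₀)

end Twisted

end EmbeddedGraph

/-- What the theorem needs to know about the operator. -/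
structure PlaneOperator.IsAdmissible (H : PlaneOperator) (k₀ : Fin 2 → ℝ) : Prop where
  vaddInvariant : VAddInvariantMeasure (ℤ × ℤ) Plane H.μ
  regular : H.IsRegular
  rot : MeasurePreserving rot H.μ H.μ
  reflect : H.Invariant reflect → MeasurePreserving reflect H.μ H.μ
  invert : H.Invariant invert → MeasurePreserving invert H.μ H.μ
  resolvent : ∃ c S L, H.IsResolventFamily k₀ c S L

theorem EmbeddedGraph.isAdmissible {G : EmbeddedGraph}
    (hΓ : ∀ m n : ℤ, (discreteSchrodinger G).Invariant (shift m n))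
    (hR : (discreteSchrodinger G).Invariant Hexagonal.rot) (k₀ : Fin 2 → ℝ) :
    (discreteSchrodinger G).IsAdmissible k₀ where
  vaddInvariant := vaddInvariantMeasure hΓ
  regular := isRegular hΓ
  rot := by
    refine measurePreserving hΓ continuous_rot.measurable ⟨?_, ?_⟩ fun x => ⟨fun h => ?_, mem_of_invariant hR⟩
    · exact Function.LeftInverse.injective (g := fun x => Hexagonal.rot (Hexagonal.rot x)) rot_rot_rot
    · exact fun x => ⟨_, rot_rot_rot x⟩
    · have := mem_of_invariant hR (mem_of_invariant hR h)
      rwa [rot_rot_rot] at this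
  reflect hF := by
    refine measurePreserving hΓ continuous_reflect.measurable
      (Function.Involutive.bijective reflect_reflect) fun x => ⟨fun h => ?_, mem_of_invariant hF⟩
    have := mem_of_invariant hF h
    rwa [reflect_reflect] at this
  invert hV := by
    refine measurePreserving hΓ continuous_invert.measurable
      (Function.Involutive.bijective invert_invert) fun x => ⟨fun h => ?_, mem_of_invariant hV⟩
    have := mem_of_invariant hV h
    rwa [invert_invert] at this
  resolvent := exists_isResolventFamily hΓ k₀

/-! ### Lebesgue measure: symmetries, integrals over cells, continuous functionals -/

section Volume

instance : VAddInvariantMeasure (ℤ × ℤ) Plane volume where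
  measure_preimage_vadd g _ hs :=
    (measurePreserving_add_right volume ((g.1 : ℝ) • a₁ + (g.2 : ℝ) • a₂)).measure_preimage
      hs.nullMeasurableSet

theorem measurePreserving_of_linear {T : Plane → Plane} (hadd : ∀ x y, T (x + y) = T x + T y)
    (hsmul : ∀ (t : ℝ) x, T (t • x) = t • T x) (hn : ∀ x, ‖T x‖ = ‖x‖) :
    MeasurePreserving T volume volume := by
  let L : Plane →ₗᵢ[ℝ] Plane := ⟨⟨⟨T, hadd⟩, hsmul⟩, hn⟩
  exact (L.toLinearIsometryEquiv rfl).measurePreserving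

theorem norm_rot (x : Plane) : ‖rot x‖ = ‖x‖ := by
  have h3 : √3 ^ 2 = 3 := Real.sq_sqrt (by norm_num)
  rw [EuclideanSpace.norm_eq, EuclideanSpace.norm_eq]
  congr 1
  simp only [Fin.sum_univ_two, Real.norm_eq_abs, sq_abs]
  simp [rot]; ring_nf; rw [h3]; ring

theorem measurePreserving_rot : MeasurePreserving rot volume volume := by
  refine measurePreserving_of_linear (fun x y => ?_) (fun t x => ?_) norm_rot
  · ext i; fin_cases i <;> simp [rot] <;> ring
  · ext i; fin_cases i <;> simp [rot] <;> ring

theorem measurePreserving_reflect : MeasurePreserving reflect volume volume := by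
  refine measurePreserving_of_linear (fun x y => ?_) (fun t x => ?_) norm_reflect
  · ext i; fin_cases i
    · simp [reflect]; ring
    · simp [reflect]
  · ext i; fin_cases i <;> simp [reflect]

theorem measurePreserving_invert : MeasurePreserving invert volume volume := by
  refine measurePreserving_of_linear (fun x y => neg_add x y) (fun t x => (smul_neg t x).symm) norm_neg

theorem lattice_expand (x : Plane) : inner ℝ b₁ x • a₁ + inner ℝ b₂ x • a₂ = x := by
  have h3 : √3 * √3 = 3 := sqrt_three_mul_self
  have h0 : √3 ≠ 0 := by positivity
  ext i
  fin_cases i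
  · simp [inner_plane, a₁, a₂, b₁, b₂]; field_simp; ring
  · simp [inner_plane, a₁, a₂, b₁, b₂]; field_simp; ring

theorem isCompact_parallelogram :
    IsCompact {x : Plane | |inner ℝ b₁ x| ≤ 1 ∧ |inner ℝ b₂ x| ≤ 1} := by
  have hK : IsCompact ((fun p : ℝ × ℝ => p.1 • a₁ + p.2 • a₂) ''
      (Set.Icc (-1) 1 ×ˢ Set.Icc (-1) 1)) :=
    (isCompact_Icc.prod isCompact_Icc).image (by fun_prop)
  refine hK.of_isClosed_subset ?_ ?_
  · have hc : ∀ b : Plane, Continuous fun x : Plane => |inner ℝ b x| := fun b => by fun_prop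
    exact (isClosed_le (hc b₁) continuous_const).inter (isClosed_le (hc b₂) continuous_const)
  · intro x hx
    exact ⟨(inner ℝ b₁ x, inner ℝ b₂ x), ⟨abs_le.1 hx.1, abs_le.1 hx.2⟩, lattice_expand x⟩

theorem cell_subset_parallelogram :
    cell ⊆ {x : Plane | |inner ℝ b₁ x| ≤ 1 ∧ |inner ℝ b₂ x| ≤ 1} := by
  intro x hx
  exact ⟨abs_le.2 ⟨by linarith [hx.1.1], hx.1.2.le⟩, abs_le.2 ⟨by linarith [hx.2.1], hx.2.2.le⟩⟩

instance : IsFiniteMeasure ((volume : Measure Plane).restrict cell) :=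
  ⟨by
    rw [Measure.restrict_apply_univ]
    exact (measure_mono cell_subset_parallelogram).trans_lt isCompact_parallelogram.measure_lt_top⟩

/-- The integral over the plane as a sum of integrals over cells. -/
theorem integral_eq_sum_cell {F : Plane → ℂ} (hF : Integrable F) {s : Finset (ℤ × ℤ)}
    (hs : ∀ x, F x ≠ 0 → floorPt x ∈ s) :
    ∫ x, F x = ∑ g ∈ s, ∫ x in cell, F (g +ᵥ x) := by
  have hm : ∀ g : ℤ × ℤ, MeasurableSet ((fun x : Plane => -g +ᵥ x) ⁻¹' cell) := fun g =>
    measurable_const_vadd (-g) measurableSet_cell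
  have hmem : ∀ (g : ℤ × ℤ) (x : Plane), x ∈ (fun x : Plane => -g +ᵥ x) ⁻¹' cell ↔ floorPt x = g := by
    intro g x
    rw [Set.mem_preimage, mem_cell_iff, floorPt_vadd, add_neg_eq_zero]
  rw [← setIntegral_eq_integral_of_forall_compl_eq_zero
    (s := ⋃ g ∈ s, (fun x : Plane => -g +ᵥ x) ⁻¹' cell), integral_biUnion_finset s (fun g _ => hm g)]
  · refine Finset.sum_congr rfl fun g _ => ?_
    have h1 := (measurePreserving_vadd (-g) (volume : Measure Plane)).setIntegral_preimage_emb
      (measurableEmbedding_const_vadd (-g)) (fun x => F (g +ᵥ x)) cell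
    simpa only [vadd_neg_vadd] using h1
  · intro g _ g' _ hne
    rw [Function.onFun, Set.disjoint_left]
    intro x hx hx'
    rw [hmem] at hx hx'
    exact hne (hx.symm.trans hx')
  · exact fun g _ => hF.integrableOn
  · intro x hx
    by_contra h0
    exact hx (Set.mem_iUnion₂.2 ⟨floorPt x, hs x h0, (hmem _ x).2 rfl⟩)

theorem memLp_cell_of_continuous {m : Plane → ℂ} (hm : Continuous m) :
    MemLp m 2 ((volume : Measure Plane).restrict cell) := by
  obtain ⟨C, hC⟩ := isCompact_parallelogram.exists_bound_of_continuousOn hm.continuousOn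
  refine MemLp.of_bound hm.aestronglyMeasurable C ?_
  rw [ae_restrict_iff' measurableSet_cell]
  exact Eventually.of_forall fun x hx => hC x (cell_subset_parallelogram hx)

theorem integrable_mul_of_locL2 {f : Plane → ℂ} (hf : LocL2 volume f) {χ : Plane → ℂ}
    (hχ : Continuous χ) (hc : HasCompactSupport χ) : Integrable (fun x => χ x * f x) := by
  have hl : LocallyIntegrable f := by
    rw [MeasureTheory.locallyIntegrable_iff]
    intro C hC
    have : IsFiniteMeasure (volume.restrict C) := ⟨by simpa using hC.measure_lt_top⟩
    exact (hf C hC).integrable (by norm_num)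
  exact hl.integrable_smul_left_of_hasCompactSupport hχ hc

theorem locL2_ext (k : Fin 2 → ℝ) (f : CellL2 volume) : LocL2 volume (ext k f) :=
  (ext_mem_blochSpace k f).1

theorem integral_mul_ext_eq_sum {χ : Plane → ℂ} (hχ : Continuous χ) (hc : HasCompactSupport χ)
    (k : Fin 2 → ℝ) (f : CellL2 volume) {s : Finset (ℤ × ℤ)}
    (hs : ∀ x, χ x ≠ 0 → floorPt x ∈ s) :
    ∫ x, χ x * ext k f x = ∑ g ∈ s, ∫ x in cell, χ (g +ᵥ x) * phase k g * f x := by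
  rw [integral_eq_sum_cell (integrable_mul_of_locL2 (locL2_ext k f) hχ hc)
    fun x hx => hs x (left_ne_zero_of_mul hx)]
  refine Finset.sum_congr rfl fun g _ => integral_congr_ae ?_
  filter_upwards [ext_ae_cell volume k f] with x hx
  rw [isQuasiPeriodic_ext k f, hx, mul_assoc]

theorem continuous_vadd (g : ℤ × ℤ) : Continuous fun x : Plane => g +ᵥ x := by
  simp only [vadd_eq_add]; fun_prop

/-- Integration of Bloch functions against a compactly supported function is continuous. -/
theorem exists_functional {χ : Plane → ℂ} (hχ : Continuous χ) (hc : HasCompactSupport χ)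
    (k : Fin 2 → ℝ) : ∃ ℓ : CellL2 volume →L[ℂ] ℂ, ∀ f, ℓ f = ∫ x, χ x * ext k f x := by
  let s := (finite_floorPt_image hc).toFinset
  have hs : ∀ x, χ x ≠ 0 → floorPt x ∈ s := fun x hx => by
    simp only [s, Set.Finite.mem_toFinset]
    exact ⟨x, subset_tsupport _ hx, rfl⟩
  have hm : ∀ g : ℤ × ℤ, Continuous fun x : Plane => starRingEnd ℂ (χ (g +ᵥ x) * phase k g) :=
    fun g => Complex.continuous_conj.comp ((hχ.comp (continuous_vadd g)).mul continuous_const)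
  refine ⟨∑ g ∈ s, innerSL ℂ ((memLp_cell_of_continuous (hm g)).toLp _), fun f => ?_⟩
  rw [integral_mul_ext_eq_sum hχ hc k f hs, sum_apply]
  refine Finset.sum_congr rfl fun g _ => ?_
  rw [innerSL_apply_apply, L2.inner_def]
  refine integral_congr_ae ?_
  filter_upwards [(memLp_cell_of_continuous (hm g)).coeFn_toLp] with x hx
  rw [hx, RCLike.inner_apply', Complex.conj_conj]

end Volume

/-! ### Weak derivatives: uniqueness and complex test functions -/

section Weak

theorem IsWeakPartial.congr {i : Fin 2} {f g f' g' : Plane → ℂ} (h : IsWeakPartial i f g)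
    (hf : f =ᵐ[volume] f') (hg : g =ᵐ[volume] g') : IsWeakPartial i f' g' := by
  intro φ hφ hc
  have e1 : ∫ x, fderiv ℝ φ x (EuclideanSpace.single i 1) • f' x =
      ∫ x, fderiv ℝ φ x (EuclideanSpace.single i 1) • f x :=
    integral_congr_ae (by filter_upwards [hf] with x hx; rw [hx])
  have e2 : ∫ x, φ x • g' x = ∫ x, φ x • g x :=
    integral_congr_ae (by filter_upwards [hg] with x hx; rw [hx])
  rw [e1, e2, h φ hφ hc]

theorem IsWeakPartial.conj {i : Fin 2} {f g : Plane → ℂ} (h : IsWeakPartial i f g) :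
    IsWeakPartial i (fun x => starRingEnd ℂ (f x)) fun x => starRingEnd ℂ (g x) := by
  intro φ hφ hc
  have e : ∀ (t : ℝ) (z : ℂ), t • starRingEnd ℂ z = starRingEnd ℂ (t • z) := fun t z => by
    rw [Complex.real_smul, Complex.real_smul, map_mul, Complex.conj_ofReal]
  simp only [e]
  rw [integral_conj, integral_conj, h φ hφ hc, map_neg]

theorem LocL2.congr {f g : Plane → ℂ} (h : LocL2 volume f) (hfg : f =ᵐ[volume] g) :
    LocL2 volume g := fun C hC => (memLp_congr_ae (ae_restrict_of_ae hfg)).1 (h C hC)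

theorem LocL2.conj {f : Plane → ℂ} (h : LocL2 volume f) :
    LocL2 volume fun x => starRingEnd ℂ (f x) := fun C hC => (h C hC).star

theorem LocL2.locallyIntegrable {f : Plane → ℂ} (h : LocL2 volume f) : LocallyIntegrable f := by
  rw [MeasureTheory.locallyIntegrable_iff]
  intro C hC
  have : IsFiniteMeasure (volume.restrict C) := ⟨by simpa using hC.measure_lt_top⟩
  exact (h C hC).integrable (by norm_num)

theorem IsWeakPartial.ae_eq_zero {i : Fin 2} {f g : Plane → ℂ} (h : IsWeakPartial i f g)
    (hf : f =ᵐ[volume] 0) (hg : LocL2 volume g) : g =ᵐ[volume] 0 := by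
  have h0 := h.congr hf EventuallyEq.rfl
  refine ae_eq_zero_of_integral_contDiff_smul_eq_zero hg.locallyIntegrable fun φ hφ hc => ?_
  have := h0 φ hφ hc
  simpa using this.symm

theorem IsWeakPartial.ae_eq {i : Fin 2} {f f' g g' : Plane → ℂ} (h : IsWeakPartial i f g)
    (h' : IsWeakPartial i f' g') (hff : f =ᵐ[volume] f') (hf : LocL2 volume f)
    (hg : LocL2 volume g) (hg' : LocL2 volume g') : g =ᵐ[volume] g' := by
  have h1 := (h'.congr hff.symm EventuallyEq.rfl).smul (-1)
  have h2 := (h.add hf hg (hf.smul (-1)) (hg'.smul (-1)) h1).ae_eq_zero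
    (Eventually.of_forall fun x => by simp) (hg.add (hg'.smul (-1)))
  filter_upwards [h2] with x hx
  have : g x + (-1) * g' x = 0 := hx
  linear_combination this

theorem schrodinger_isRegular (q : Plane → ℝ) : (schrodinger q).IsRegular where
  congr {ψ η ψ' η'} := by
    rintro ⟨g, h, h1, h2, h3, h4, h5, h6⟩ e1 e2
    have e1' : ψ =ᵐ[volume] ψ' := e1
    have e2' : η =ᵐ[volume] η' := e2
    refine ⟨g, h, h1.congr e1', h2, h3, fun i => (h4 i).congr e1' EventuallyEq.rfl, h5, ?_⟩
    filter_upwards [h6, e1', e2'] with x hx k1 k2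
    rw [← k2, hx, k1]
  single {η} := by
    rintro ⟨g, h, h1, h2, h3, h4, h5, h6⟩
    have hg : ∀ i, g i =ᵐ[volume] 0 := fun i => (h4 i).ae_eq_zero EventuallyEq.rfl (h2 i)
    have hh : ∀ i j, h i j =ᵐ[volume] 0 := fun i j => (h5 i j).ae_eq_zero (hg i) (h3 i j)
    change η =ᵐ[volume] 0
    filter_upwards [h6, hh 0 0, hh 1 1] with x hx k1 k2
    rw [hx, k1, k2]
    simp
  conj {ψ η} := by
    rintro ⟨g, h, h1, h2, h3, h4, h5, h6⟩
    refine ⟨fun i x => starRingEnd ℂ (g i x), fun i j x => starRingEnd ℂ (h i j x), h1.conj,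
      fun i => (h2 i).conj, fun i j => (h3 i j).conj, fun i => (h4 i).conj,
      fun i j => (h5 i j).conj, ?_⟩
    filter_upwards [h6] with x hx
    rw [hx]
    simp

/-- The weak derivative with complex test functions. -/
theorem IsWeakPartial.integral_mul {i : Fin 2} {f g : Plane → ℂ} (h : IsWeakPartial i f g)
    (hf : LocL2 volume f) (hg : LocL2 volume g) {χ : Plane → ℂ} (hχ : ContDiff ℝ ∞ χ)
    (hc : HasCompactSupport χ) :
    ∫ x, fderiv ℝ χ x (EuclideanSpace.single i 1) * f x = -∫ x, χ x * g x := by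
  have hd : Differentiable ℝ χ := hχ.differentiable (by simp)
  let u : Plane → ℝ := fun x => (χ x).re
  let v : Plane → ℝ := fun x => (χ x).im
  have hu : ContDiff ℝ ∞ u := Complex.reCLM.contDiff.comp hχ
  have hv : ContDiff ℝ ∞ v := Complex.imCLM.contDiff.comp hχ
  have hcu : HasCompactSupport u := hc.comp_left (g := Complex.re) rfl
  have hcv : HasCompactSupport v := hc.comp_left (g := Complex.im) rfl
  have du : ∀ x w, fderiv ℝ u x w = (fderiv ℝ χ x w).re := fun x w => by
    have := (Complex.reCLM.hasFDerivAt.comp x (hd x).hasFDerivAt).fderiv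
    exact congrArg (fun L : Plane →L[ℝ] ℝ => L w) this
  have dv : ∀ x w, fderiv ℝ v x w = (fderiv ℝ χ x w).im := fun x w => by
    have := (Complex.imCLM.hasFDerivAt.comp x (hd x).hasFDerivAt).fderiv
    exact congrArg (fun L : Plane →L[ℝ] ℝ => L w) this
  have e1 : ∀ x, fderiv ℝ χ x (EuclideanSpace.single i 1) * f x =
      fderiv ℝ u x (EuclideanSpace.single i 1) • f x +
        Complex.I * (fderiv ℝ v x (EuclideanSpace.single i 1) • f x) := by
    intro x
    rw [du, dv, Complex.real_smul, Complex.real_smul]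
    conv_lhs => rw [← Complex.re_add_im (fderiv ℝ χ x (EuclideanSpace.single i 1))]
    ring
  have e2 : ∀ x, χ x * g x = u x • g x + Complex.I * (v x • g x) := by
    intro x
    rw [Complex.real_smul, Complex.real_smul]
    conv_lhs => rw [← Complex.re_add_im (χ x)]
    ring
  simp only [e1, e2]
  rw [integral_add (integrable_fderiv_smul hf hu hcu _)
      ((integrable_fderiv_smul hf hv hcv _).const_mul _),
    integral_add (integrable_smul_of_locL2 hg hu.continuous hcu)
      ((integrable_smul_of_locL2 hg hv.continuous hcv).const_mul _),
    integral_const_mul, integral_const_mul, h u hu hcu, h v hv hcv]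
  ring

end Weak

/-! ### Plane waves as a Hilbert basis of the cell space -/

section Fourier

local instance unitCircleMeasureSpace : MeasureSpace UnitAddCircle := ⟨AddCircle.haarAddCircle⟩

/-- Lattice coordinates. -/
def latticeCoord : (Fin 2 → ℝ) ≃L[ℝ] Plane :=
  LinearEquiv.toContinuousLinearEquiv
    { toFun := fun s => s 0 • a₁ + s 1 • a₂
      invFun := fun x => ![inner ℝ b₁ x, inner ℝ b₂ x]
      map_add' := fun s t => by simp only [Pi.add_apply]; module
      map_smul' := fun c s => by
        simp only [Pi.smul_apply, smul_eq_mul, RingHom.id_apply]; module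
      left_inv := fun s => by
        ext i
        fin_cases i <;> simp [inner_add_right, inner_smul_right, inner_b₁_a₁, inner_b₁_a₂,
          inner_b₂_a₁, inner_b₂_a₂]
      right_inv := fun x => by simpa using lattice_expand x }

theorem latticeCoord_apply (s : Fin 2 → ℝ) : latticeCoord s = s 0 • a₁ + s 1 • a₂ := rfl

theorem inner_b₁_latticeCoord (s : Fin 2 → ℝ) : inner ℝ b₁ (latticeCoord s) = s 0 := by
  simp [latticeCoord_apply, inner_add_right, inner_smul_right, inner_b₁_a₁, inner_b₁_a₂]

theorem inner_b₂_latticeCoord (s : Fin 2 → ℝ) : inner ℝ b₂ (latticeCoord s) = s 1 := by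
  simp [latticeCoord_apply, inner_add_right, inner_smul_right, inner_b₂_a₁, inner_b₂_a₂]

theorem preimage_latticeCoord_cell :
    latticeCoord ⁻¹' cell = Set.pi Set.univ fun _ : Fin 2 => Set.Ico (0 : ℝ) 1 := by
  ext s
  change (inner ℝ b₁ (latticeCoord s) ∈ Set.Ico (0 : ℝ) 1 ∧
    inner ℝ b₂ (latticeCoord s) ∈ Set.Ico (0 : ℝ) 1) ↔ _
  rw [inner_b₁_latticeCoord, inner_b₂_latticeCoord, Set.mem_univ_pi, Fin.forall_fin_two]

/-- The point of the cell that corresponds to a point of the torus. -/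
def torusPt (t : UnitAddTorus (Fin 2)) : Plane :=
  latticeCoord (UnitAddTorus.measurableEquivPiIoc (0 : Fin 2 → ℝ) t).1

/-- Lattice coordinates scale Lebesgue measure by a constant that only has to be positive and
finite. The torus is parametrised by boxes that are half-open on the other side than the cell, a
difference of measure zero. -/
theorem exists_measurePreserving_torusPt : ∃ c : ENNReal, c ≠ 0 ∧ c ≠ ⊤ ∧
    MeasurePreserving torusPt volume (c • (volume : Measure Plane).restrict cell) := by
  obtain ⟨c, hc0, hc, h⟩ : ∃ c : ENNReal, c ≠ 0 ∧ c ≠ ⊤ ∧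
      (volume : Measure (Fin 2 → ℝ)).map latticeCoord = c • (volume : Measure Plane) := by
    have := latticeCoord.isAddHaarMeasure_map (volume : Measure (Fin 2 → ℝ))
    refine ⟨Measure.addHaarScalarFactor ((volume : Measure (Fin 2 → ℝ)).map latticeCoord)
      (volume : Measure Plane), ?_, ENNReal.coe_ne_top, Measure.isAddLeftInvariant_eq_smul _ _⟩
    exact_mod_cast (Measure.addHaarScalarFactor_pos_of_isAddHaarMeasure _ _).ne'
  refine ⟨c, hc0, hc, ?_⟩
  have h1 : MeasurePreserving latticeCoord volume (c • (volume : Measure Plane)) :=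
    ⟨latticeCoord.continuous.measurable, h⟩
  have h2 := h1.restrict_preimage measurableSet_cell
  rw [preimage_latticeCoord_cell, Measure.restrict_smul] at h2
  have h3 : (volume : Measure (Fin 2 → ℝ)).restrict (Set.pi Set.univ fun _ => Set.Ico (0 : ℝ) 1) =
      volume.restrict {x | ∀ i, x i ∈ Set.Ioc ((0 : Fin 2 → ℝ) i) ((0 : Fin 2 → ℝ) i + 1)} := by
    refine Measure.restrict_congr_set ?_
    have e : {x : Fin 2 → ℝ | ∀ i, x i ∈ Set.Ioc ((0 : Fin 2 → ℝ) i) ((0 : Fin 2 → ℝ) i + 1)} =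
        Set.pi Set.univ fun i => Set.Ioc ((0 : Fin 2 → ℝ) i) ((1 : Fin 2 → ℝ) i) := by
      ext x; simp
    rw [e]
    exact (Measure.univ_pi_Ico_ae_eq_Icc (f := (0 : Fin 2 → ℝ)) (g := 1)).trans
      Measure.univ_pi_Ioc_ae_eq_Icc.symm
  rw [h3] at h2
  have h4 : MeasurableSet
      {x : Fin 2 → ℝ | ∀ i, x i ∈ Set.Ioc ((0 : Fin 2 → ℝ) i) ((0 : Fin 2 → ℝ) i + 1)} :=
    MeasurableSet.univ_pi' fun i => measurableSet_Ioc
  exact h2.comp ((measurePreserving_subtype_coe h4).comp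
    (UnitAddTorus.measurePreserving_equivPiIoc (0 : Fin 2 → ℝ)))

/-- The points of the reciprocal lattice, shifted by the quasimomentum. -/
def momentum (k : Fin 2 → ℝ) (n : Fin 2 → ℤ) : Plane := kappa fun i => k i + 2 * Real.pi * n i

theorem momentum_eq (k : Fin 2 → ℝ) (n : Fin 2 → ℤ) :
    momentum k n = kappa k + momentum 0 n := by
  simp only [momentum, kappa, Pi.zero_apply, zero_add]; module

theorem inner_kappa_latticeCoord (k : Fin 2 → ℝ) (s : Fin 2 → ℝ) :
    inner ℝ (kappa k) (latticeCoord s) = k 0 * s 0 + k 1 * s 1 := by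
  rw [kappa, inner_add_left, inner_smul_left, inner_smul_left, inner_b₁_latticeCoord,
    inner_b₂_latticeCoord]
  simp

theorem planeWave_torusPt (n : Fin 2 → ℤ) (t : UnitAddTorus (Fin 2)) :
    planeWave (momentum 0 n) (torusPt t) = UnitAddTorus.mFourier n t := by
  rw [torusPt, planeWave, momentum, inner_kappa_latticeCoord, UnitAddTorus.mFourier]
  simp only [ContinuousMap.coe_mk, Fin.prod_univ_two, UnitAddTorus.coe_measurableEquivPiIoc_apply]
  conv_rhs => rw [← AddCircle.coe_equivIoc (p := (1 : ℝ)) (a := (0 : Fin 2 → ℝ) 0) (y := t 0),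
    ← AddCircle.coe_equivIoc (p := (1 : ℝ)) (a := (0 : Fin 2 → ℝ) 1) (y := t 1),
    fourier_coe_apply, fourier_coe_apply, ← Complex.exp_add]
  congr 1
  simp only [Pi.zero_apply]
  push_cast
  ring

theorem isQuasiPeriodic_planeWave (k : Fin 2 → ℝ) (n : Fin 2 → ℤ) :
    IsQuasiPeriodic k (planeWave (momentum k n)) := by
  intro g x
  rw [planeWave, momentum, inner_kappa_vadd, planeWave, phase, ← Complex.exp_add,
    Complex.exp_eq_exp_iff_exists_int]
  refine ⟨g.1 * n 0 + g.2 * n 1, ?_⟩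
  push_cast
  ring

/-- The plane waves as elements of the cell space. -/
def waveVec (k : Fin 2 → ℝ) (n : Fin 2 → ℤ) : CellL2 volume :=
  (memLp_cell_of_continuous (continuous_planeWave (momentum k n))).toLp _

theorem waveVec_ae (k : Fin 2 → ℝ) (n : Fin 2 → ℤ) :
    waveVec k n =ᵐ[volume.restrict cell] planeWave (momentum k n) := MemLp.coeFn_toLp _

theorem ext_waveVec (k : Fin 2 → ℝ) (n : Fin 2 → ℤ) :
    ext k (waveVec k n) =ᵐ[volume] planeWave (momentum k n) :=
  (ext_ae_eq (isQuasiPeriodic_planeWave k n).ae (waveVec_ae k n).symm).symm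

theorem inner_waveVec (k : Fin 2 → ℝ) (n : Fin 2 → ℤ) (f : CellL2 volume) :
    inner ℂ (waveVec k n) f =
      ∫ x in cell, starRingEnd ℂ (planeWave (momentum k n) x) * f x := by
  rw [L2.inner_def]
  refine integral_congr_ae ?_
  filter_upwards [waveVec_ae k n] with x hx
  rw [hx, RCLike.inner_apply']

theorem integral_torusPt {c : ENNReal}
    (h : MeasurePreserving torusPt volume (c • (volume : Measure Plane).restrict cell))
    {F : Plane → ℂ} (hF : AEStronglyMeasurable F (volume.restrict cell)) :
    ∫ t, F (torusPt t) = c.toReal • ∫ x in cell, F x := by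
  rw [← integral_smul_measure, ← h.map_eq, integral_map h.measurable.aemeasurable]
  rw [h.map_eq]
  exact hF.smul_measure c

theorem inner_waveVec_waveVec {c : ENNReal}
    (h : MeasurePreserving torusPt volume (c • (volume : Measure Plane).restrict cell))
    (k : Fin 2 → ℝ) (m n : Fin 2 → ℤ) :
    (c.toReal : ℂ) * inner ℂ (waveVec k m) (waveVec k n) = if m = n then 1 else 0 := by
  have h1 := orthonormal_iff_ite.1 (UnitAddTorus.orthonormal_mFourier (d := Fin 2)) m n
  rw [ContinuousMap.inner_toLp] at h1
  rw [← h1]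
  have h2 : ∀ t, UnitAddTorus.mFourier n t * starRingEnd ℂ (UnitAddTorus.mFourier m t) =
      starRingEnd ℂ (planeWave (momentum k m) (torusPt t)) *
        planeWave (momentum k n) (torusPt t) := by
    intro t
    rw [← planeWave_torusPt, ← planeWave_torusPt, conj_planeWave, conj_planeWave, momentum_eq k m,
      momentum_eq k n, ← planeWave_add, ← planeWave_add]
    congr 1; abel
  simp only [h2]
  rw [integral_torusPt h (F := fun x => starRingEnd ℂ (planeWave (momentum k m) x) *
    planeWave (momentum k n) x), inner_waveVec, Complex.real_smul]
  · congr 1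
    refine integral_congr_ae ?_
    filter_upwards [waveVec_ae k n] with x hx
    rw [hx]
  · exact ((Complex.continuous_conj.comp (continuous_planeWave _)).mul
      (continuous_planeWave _)).aestronglyMeasurable

/-- Dividing `f` by the plane wave of `kappa k` leaves a function on the torus whose Fourier
coefficients are multiples of the given inner products; the Fourier basis of the torus is complete.
-/
theorem eq_zero_of_inner_waveVec (k : Fin 2 → ℝ) {f : CellL2 volume}
    (hf : ∀ n, inner ℂ (waveVec k n) f = (0 : ℂ)) : f = 0 := by
  obtain ⟨c, hc0, hc, h⟩ := exists_measurePreserving_torusPt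
  let u : Plane → ℂ := fun x => starRingEnd ℂ (planeWave (kappa k) x) * f x
  have hu : MemLp u 2 (c • (volume : Measure Plane).restrict cell) := by
    have h1 : MemLp u 2 ((volume : Measure Plane).restrict cell) := by
      refine (Lp.memLp f).of_le ?_ ?_
      · exact (Complex.continuous_conj.comp (continuous_planeWave _)).aestronglyMeasurable.mul
          (Lp.aestronglyMeasurable f)
      · refine Eventually.of_forall fun x => ?_
        rw [norm_mul, RCLike.norm_conj, norm_planeWave, one_mul]
    exact h1.smul_measure hc
  have hv := hu.comp_measurePreserving h
  have hv0 : hv.toLp _ = 0 := by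
    rw [← (UnitAddTorus.mFourierBasis (d := Fin 2)).repr.map_eq_zero_iff]
    ext n
    rw [UnitAddTorus.mFourierBasis_repr, UnitAddTorus.mFourierCoeff]
    have e1 : ∫ t, UnitAddTorus.mFourier (-n) t • hv.toLp _ t =
        ∫ t, starRingEnd ℂ (planeWave (momentum k n) (torusPt t)) * f (torusPt t) := by
      refine integral_congr_ae ?_
      filter_upwards [hv.coeFn_toLp] with t ht
      rw [ht, UnitAddTorus.mFourier_neg, ← planeWave_torusPt, momentum_eq k n, planeWave_add,
        map_mul, smul_eq_mul, Function.comp_apply]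
      simp only [u]
      ring
    rw [e1, integral_torusPt h (F := fun x => starRingEnd ℂ (planeWave (momentum k n) x) * f x),
      ← inner_waveVec, hf, smul_zero]
    · rfl
    · exact (Complex.continuous_conj.comp (continuous_planeWave _)).aestronglyMeasurable.mul
        (Lp.aestronglyMeasurable f)
  have h1 : ∀ᵐ t, f (torusPt t) = 0 := by
    have h2 := hv.coeFn_toLp
    rw [hv0] at h2
    filter_upwards [h2, Lp.coeFn_zero ℂ 2 (volume : Measure (UnitAddTorus (Fin 2)))] with t h3 h4
    rw [h4] at h3
    have h5 : starRingEnd ℂ (planeWave (kappa k) (torusPt t)) * f (torusPt t) = 0 := h3.symm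
    refine (mul_eq_zero.1 h5).resolve_left ?_
    rw [conj_planeWave]
    exact planeWave_ne_zero _ _
  rw [← ae_map_iff (p := fun x => f x = 0) h.measurable.aemeasurable
    ((Lp.stronglyMeasurable f).measurable (measurableSet_singleton 0)), h.map_eq,
    Measure.ae_ennreal_smul_measure_iff hc0] at h1
  apply Lp.ext
  filter_upwards [h1, Lp.coeFn_zero ℂ 2 ((volume : Measure Plane).restrict cell)] with x h2 h3
  rw [h2, h3]; rfl

/-- The normalised plane waves form a Hilbert basis. -/
theorem exists_hilbertBasis_waveVec (k : Fin 2 → ℝ) :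
    ∃ (a : ℝ) (b : HilbertBasis (Fin 2 → ℤ) ℂ (CellL2 volume)), a ≠ 0 ∧
      ∀ n, b n = (a : ℂ) • waveVec k n := by
  obtain ⟨c, hc0, hc, h⟩ := exists_measurePreserving_torusPt
  have hcpos : 0 < c.toReal := ENNReal.toReal_pos hc0 hc
  have hsq : ((√c.toReal : ℝ) : ℂ) * ((√c.toReal : ℝ) : ℂ) = c.toReal := by
    rw [← Complex.ofReal_mul, Real.mul_self_sqrt hcpos.le]
  have ho : Orthonormal ℂ fun n => ((√c.toReal : ℝ) : ℂ) • waveVec k n := by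
    rw [orthonormal_iff_ite]
    intro m n
    rw [inner_smul_left, inner_smul_right, Complex.conj_ofReal, ← mul_assoc, hsq]
    exact inner_waveVec_waveVec h k m n
  have hs : √c.toReal ≠ 0 := (Real.sqrt_pos.2 hcpos).ne'
  refine ⟨√c.toReal, HilbertBasis.mkOfOrthogonalEqBot ho ?_, hs, fun n => ?_⟩
  · rw [Submodule.eq_bot_iff]
    intro f hf
    refine eq_zero_of_inner_waveVec k fun n => ?_
    rw [Submodule.mem_orthogonal] at hf
    have := hf _ (Submodule.subset_span ⟨n, rfl⟩)
    rw [inner_smul_left, Complex.conj_ofReal] at this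
    exact (mul_eq_zero.1 this).resolve_left (by exact_mod_cast hs)
  · rw [HilbertBasis.coe_mkOfOrthogonalEqBot]

end Fourier

/-! ### Operators that are diagonal in a Hilbert basis -/

section Diagonal

variable {ι E : Type*} [NormedAddCommGroup E] [InnerProductSpace ℂ E]

theorem HilbertBasis.eq_of_inner (b : HilbertBasis ι ℂ E) {f g : E}
    (h : ∀ n, (inner ℂ (b n) f : ℂ) = inner ℂ (b n) g) : f = g := by
  refine b.repr.injective ?_
  ext n
  rw [b.repr_apply_apply, b.repr_apply_apply, h]

theorem HilbertBasis.norm_le_of_inner (b : HilbertBasis ι ℂ E) {f g : E}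
    (h : ∀ n, ‖(inner ℂ (b n) f : ℂ)‖ ≤ ‖(inner ℂ (b n) g : ℂ)‖) : ‖f‖ ≤ ‖g‖ := by
  rw [← b.repr.norm_map f, ← b.repr.norm_map g]
  refine lp.norm_mono (by norm_num) fun n => ?_
  rw [b.repr_apply_apply, b.repr_apply_apply]
  exact h n

/-- `D` multiplies the coordinates with respect to the Hilbert basis `b` by the numbers `a n`. -/
def IsDiagonal (b : HilbertBasis ι ℂ E) (a : ι → ℂ) (D : E →L[ℂ] E) : Prop :=
  ∀ n f, (inner ℂ (b n) (D f) : ℂ) = a n * inner ℂ (b n) f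

variable {b : HilbertBasis ι ℂ E} {a a' : ι → ℂ} {D D' : E →L[ℂ] E}

theorem IsDiagonal.add (h : IsDiagonal b a D) (h' : IsDiagonal b a' D') :
    IsDiagonal b (fun n => a n + a' n) (D + D') := fun n f => by
  rw [add_apply, inner_add_right, h, h', add_mul]

theorem IsDiagonal.sub (h : IsDiagonal b a D) (h' : IsDiagonal b a' D') :
    IsDiagonal b (fun n => a n - a' n) (D - D') := fun n f => by
  rw [sub_apply, inner_sub_right, h, h', sub_mul]

theorem IsDiagonal.smul (c : ℂ) (h : IsDiagonal b a D) :
    IsDiagonal b (fun n => c * a n) (c • D) := fun n f => by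
  rw [FunLike.coe_smul, Pi.smul_apply, inner_smul_right, h, mul_assoc]

theorem IsDiagonal.norm_le (h : IsDiagonal b a D) {C : ℝ} (hC0 : 0 ≤ C) (hC : ∀ n, ‖a n‖ ≤ C) :
    ‖D‖ ≤ C := by
  refine D.opNorm_le_bound hC0 fun f => ?_
  have h1 : ‖D f‖ ≤ ‖(C : ℂ) • f‖ := by
    refine HilbertBasis.norm_le_of_inner b fun n => ?_
    rw [h, inner_smul_right, norm_mul, norm_mul, Complex.norm_real, Real.norm_of_nonneg hC0]
    exact mul_le_mul_of_nonneg_right (hC n) (norm_nonneg _)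
  rwa [norm_smul, Complex.norm_real, Real.norm_of_nonneg hC0] at h1

theorem IsDiagonal.isSymmetric {a : ι → ℝ} (h : IsDiagonal b (fun n => (a n : ℂ)) D) :
    (D : E →ₗ[ℂ] E).IsSymmetric := by
  intro f g
  change inner ℂ (D f) g = inner ℂ f (D g)
  rw [← b.tsum_inner_mul_inner, ← b.tsum_inner_mul_inner f]
  refine tsum_congr fun n => ?_
  rw [h, ← inner_conj_symm, h, map_mul, Complex.conj_ofReal, inner_conj_symm]
  ring

theorem exists_isDiagonal (b : HilbertBasis ι ℂ E) {a : ι → ℂ} {C : ℝ} (hC : ∀ n, ‖a n‖ ≤ C) :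
    ∃ D : E →L[ℂ] E, IsDiagonal b a D := by
  have hm : ∀ f : E, Memℓp (fun n => a n * b.repr f n) 2 := fun f => by
    have h1 := lp.memℓp ((C : ℂ) • b.repr f)
    refine memℓp_gen ((h1.summable (by norm_num)).of_nonneg_of_le (fun n => by positivity)
      fun n => ?_)
    refine Real.rpow_le_rpow (norm_nonneg _) ?_ (by norm_num)
    rw [lp.coeFn_smul, Pi.smul_apply, norm_smul, norm_mul, Complex.norm_real]
    exact mul_le_mul_of_nonneg_right ((hC n).trans (le_abs_self C)) (norm_nonneg _)
  have hi : ∀ f n, (inner ℂ (b n) (b.repr.symm ⟨_, hm f⟩) : ℂ) = a n * inner ℂ (b n) f := by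
    intro f n
    rw [← b.repr_apply_apply, b.repr.apply_symm_apply, ← b.repr_apply_apply]
  let T : E →ₗ[ℂ] E :=
    { toFun := fun f => b.repr.symm ⟨_, hm f⟩
      map_add' := fun f g => by
        refine HilbertBasis.eq_of_inner b fun n => ?_
        rw [inner_add_right, hi, hi, hi, inner_add_right, mul_add]
      map_smul' := fun c f => by
        refine HilbertBasis.eq_of_inner b fun n => ?_
        rw [RingHom.id_apply, inner_smul_right, hi, hi, inner_smul_right, mul_left_comm] }
  refine ⟨T.mkContinuous |C| fun f => ?_, fun n f => hi f n⟩
  have h1 : ‖T f‖ ≤ ‖(|C| : ℝ) • f‖ := by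
    rw [← Complex.coe_smul]
    refine HilbertBasis.norm_le_of_inner b fun n => ?_
    rw [show T f = b.repr.symm ⟨_, hm f⟩ from rfl, hi, inner_smul_right, norm_mul, norm_mul,
      Complex.norm_real, Real.norm_of_nonneg (abs_nonneg C)]
    exact mul_le_mul_of_nonneg_right ((hC n).trans (le_abs_self C)) (norm_nonneg _)
  rwa [norm_smul, Real.norm_of_nonneg (abs_nonneg C)] at h1

/-- Truncations to finitely many coordinates have finite rank, and they converge in norm because the
coefficients tend to zero. -/
theorem IsDiagonal.isCompactOperator [CompleteSpace E] (h : IsDiagonal b a D)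
    (ha : Tendsto a cofinite (𝓝 0)) : IsCompactOperator D := by
  classical
  have hP : ∀ n, IsDiagonal b (Pi.single n (a n)) (a n • (innerSL ℂ (b n)).smulRight (b n)) := by
    intro n m f
    rw [FunLike.coe_smul, Pi.smul_apply, ContinuousLinearMap.smulRight_apply, innerSL_apply_apply,
      inner_smul_right, inner_smul_right, orthonormal_iff_ite.1 b.orthonormal]
    by_cases hmn : m = n
    · subst hmn; simp
    · simp [hmn]
  let P : Finset ι → E →L[ℂ] E := fun s =>
    ∑ n ∈ s, a n • (innerSL ℂ (b n)).smulRight (b n)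
  have hPs : ∀ s, IsDiagonal b (fun m => if m ∈ s then a m else 0) (P s) := by
    intro s m f
    simp only [P, sum_apply, inner_sum]
    rw [Finset.sum_congr rfl fun n _ => hP n m f, ← Finset.sum_mul]
    congr 1
    simp [Pi.single_apply]
  refine isCompactOperator_of_tendsto (l := atTop) (F := P) ?_ (Eventually.of_forall fun s => ?_)
  · rw [tendsto_iff_norm_sub_tendsto_zero, Metric.tendsto_atTop]
    intro ε hε
    have h1 : ∀ᶠ n in cofinite, ‖a n‖ < ε / 2 := by
      have := ha.norm
      rw [norm_zero] at this
      exact this.eventually_lt_const (half_pos hε)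
    rw [eventually_cofinite] at h1
    refine ⟨h1.toFinset, fun s hs => ?_⟩
    rw [Real.dist_0_eq_abs, abs_norm]
    refine ((hPs s).sub h).norm_le (half_pos hε).le (fun n => ?_) |>.trans_lt (half_lt_self hε)
    by_cases hn : n ∈ s
    · simpa [hn] using (half_pos hε).le
    · rw [if_neg hn, zero_sub, norm_neg]
      by_contra hlt
      exact hn (hs (h1.mem_toFinset.2 fun h => hlt h.le))
  · refine Submodule.sum_mem (compactOperator (RingHom.id ℂ) E E) fun n _ => ?_
    refine Submodule.smul_mem _ _ ?_
    change IsCompactOperator _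
    exact (isCompactOperator_of_locallyCompactSpace_rng
      (ContinuousLinearMap.toSpanSingleton ℂ (b n))).comp_clm (innerSL ℂ (b n))

end Diagonal

/-! ### A smooth partition of unity under the lattice -/

section PartitionOfUnity

/-- A smooth bump whose translates by the integers sum up to `1`. -/
def bumpFactor (t : ℝ) : ℝ := Real.smoothTransition (t + 1) - Real.smoothTransition t

theorem bumpFactor_ne_zero {t : ℝ} (h : bumpFactor t ≠ 0) : -1 < t ∧ t < 1 := by
  constructor
  · by_contra! h1
    rw [bumpFactor, Real.smoothTransition.zero_of_nonpos (by linarith),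
      Real.smoothTransition.zero_of_nonpos (by linarith)] at h
    simp at h
  · by_contra! h1
    rw [bumpFactor, Real.smoothTransition.one_of_one_le (by linarith),
      Real.smoothTransition.one_of_one_le (by linarith)] at h
    simp at h

theorem bumpFactor_add_bumpFactor {t : ℝ} (h : t ∈ Set.Ico (0 : ℝ) 1) :
    bumpFactor (t + (-1 : ℤ)) + bumpFactor (t + (0 : ℤ)) = 1 := by
  have e1 := Real.smoothTransition.zero_of_nonpos (x := t + (-1 : ℤ)) (by
    push_cast; linarith [h.2])
  have e2 := Real.smoothTransition.one_of_one_le (x := t + (0 : ℤ) + 1) (by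
    push_cast; linarith [h.1])
  rw [bumpFactor, bumpFactor, e1, e2, show t + ((-1 : ℤ) : ℝ) + 1 = t + ((0 : ℤ) : ℝ) by
    push_cast; ring]
  ring

theorem contDiff_bumpFactor : ContDiff ℝ ∞ bumpFactor :=
  (Real.smoothTransition.contDiff.comp (contDiff_id.add contDiff_const)).sub
    Real.smoothTransition.contDiff

/-- A smooth bump on the plane whose translates by the lattice sum up to `1`. -/
def bump (x : Plane) : ℂ := ((bumpFactor (inner ℝ b₁ x) * bumpFactor (inner ℝ b₂ x) : ℝ) : ℂ)

theorem contDiff_bump : ContDiff ℝ ∞ bump := by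
  refine Complex.ofRealCLM.contDiff.comp (ContDiff.mul ?_ ?_)
  · exact contDiff_bumpFactor.comp (innerSL ℝ b₁).contDiff
  · exact contDiff_bumpFactor.comp (innerSL ℝ b₂).contDiff

theorem bump_ne_zero {x : Plane} (h : bump x ≠ 0) :
    (-1 < inner ℝ b₁ x ∧ inner ℝ b₁ x < 1) ∧ (-1 < inner ℝ b₂ x ∧ inner ℝ b₂ x < 1) := by
  rw [bump, Complex.ofReal_ne_zero] at h
  exact ⟨bumpFactor_ne_zero (left_ne_zero_of_mul h), bumpFactor_ne_zero (right_ne_zero_of_mul h)⟩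

theorem hasCompactSupport_bump : HasCompactSupport bump := by
  refine HasCompactSupport.intro isCompact_parallelogram fun x hx => ?_
  by_contra h
  have := bump_ne_zero h
  exact hx ⟨abs_le.2 ⟨this.1.1.le, this.1.2.le⟩, abs_le.2 ⟨this.2.1.le, this.2.2.le⟩⟩

/-- The shifts that move a point of the cell into the support of `bump`. -/
def bumpShifts : Finset (ℤ × ℤ) := {-1, 0} ×ˢ {-1, 0}

theorem floorPt_mem_bumpShifts {x : Plane} (h : bump x ≠ 0) : floorPt x ∈ bumpShifts := by
  have key : ∀ t : ℝ, -1 < t ∧ t < 1 → ⌊t⌋ ∈ ({-1, 0} : Finset ℤ) := by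
    intro t ht
    have h1 : -1 ≤ ⌊t⌋ := Int.le_floor.2 (by push_cast; exact ht.1.le)
    have h2 : ⌊t⌋ < 1 := Int.floor_lt.2 (by exact_mod_cast ht.2)
    simp only [Finset.mem_insert, Finset.mem_singleton]
    omega
  have := bump_ne_zero h
  exact Finset.mk_mem_product (key _ this.1) (key _ this.2)

theorem sum_bump {x : Plane} (hx : x ∈ cell) : ∑ g ∈ bumpShifts, bump (g +ᵥ x) = 1 := by
  have h1 := bumpFactor_add_bumpFactor hx.1
  have h2 := bumpFactor_add_bumpFactor hx.2
  have e : ∀ u : ℤ → ℂ, ∑ i ∈ ({-1, 0} : Finset ℤ), u i = u (-1) + u 0 := fun u =>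
    Finset.sum_pair (by norm_num)
  simp only [bumpShifts, Finset.sum_product, e, bump, inner_b₁_vadd, inner_b₂_vadd]
  rw [← Complex.ofReal_add, ← Complex.ofReal_add, ← Complex.ofReal_add, ← mul_add, ← mul_add,
    h2, mul_one, mul_one, h1, Complex.ofReal_one]

theorem norm_bump_le (x : Plane) : ‖bump x‖ ≤ 1 := by
  have key : ∀ t, |bumpFactor t| ≤ 1 := fun t => by
    have h1 := Real.smoothTransition.nonneg t
    have h2 := Real.smoothTransition.le_one (t + 1)
    have h3 := Real.smoothTransition.monotone (show t ≤ t + 1 by linarith)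
    rw [bumpFactor, abs_of_nonneg (by linarith)]
    linarith
  rw [bump, Complex.norm_real, Real.norm_eq_abs, abs_mul]
  exact mul_le_one₀ (key _) (abs_nonneg _) (key _)

end PartitionOfUnity

/-! ### Partial integration against plane waves -/

section PlaneWave

theorem contDiff_planeWave (v : Plane) : ContDiff ℝ ∞ (planeWave v) := by
  have h : ContDiff ℝ ∞ fun x : Plane => Complex.I * ((inner ℝ v x : ℝ) : ℂ) :=
    contDiff_const.mul (Complex.ofRealCLM.contDiff.comp (innerSL ℝ v).contDiff)
  exact h.cexp

theorem fderiv_planeWave (v x : Plane) (i : Fin 2) :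
    fderiv ℝ (planeWave v) x (EuclideanSpace.single i 1) =
      Complex.I * (v i : ℂ) * planeWave v x := by
  have h1 : HasFDerivAt (fun x : Plane => ((inner ℝ v x : ℝ) : ℂ))
      (Complex.ofRealCLM.comp (innerSL ℝ v)) x :=
    (Complex.ofRealCLM.comp (innerSL ℝ v)).hasFDerivAt
  have h2 : HasFDerivAt (planeWave v) _ x := (h1.const_mul Complex.I).cexp
  rw [h2.fderiv]
  have h3 : inner ℝ v (EuclideanSpace.single i (1 : ℝ)) = v i := by
    simp [EuclideanSpace.inner_single_right]
  simp [planeWave, h3]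
  ring

/-- Partial integration against a plane wave. -/
theorem integral_fderiv_mul_planeWave {χ : Plane → ℂ} (hχ : ContDiff ℝ ∞ χ)
    (hc : HasCompactSupport χ) (v : Plane) (i : Fin 2) :
    ∫ x, fderiv ℝ χ x (EuclideanSpace.single i 1) * planeWave v x =
      -(Complex.I * (v i : ℂ)) * ∫ x, χ x * planeWave v x := by
  have hd : Differentiable ℝ χ := hχ.differentiable (by simp)
  have hw : Differentiable ℝ (planeWave v) := (contDiff_planeWave v).differentiable (by simp)
  have hcd : Continuous fun x => fderiv ℝ χ x (EuclideanSpace.single i 1) :=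
    (hχ.continuous_fderiv (by simp)).clm_apply continuous_const
  have hwd : Continuous fun x => fderiv ℝ (planeWave v) x (EuclideanSpace.single i 1) :=
    ((contDiff_planeWave v).continuous_fderiv (by simp)).clm_apply continuous_const
  have h := integral_mul_fderiv_eq_neg_fderiv_mul_of_integrable (μ := (volume : Measure Plane))
    (f := planeWave v) (g := χ) (v := EuclideanSpace.single i 1)
    ((hwd.mul hχ.continuous).integrable_of_hasCompactSupport hc.mul_left)
    (((continuous_planeWave v).mul hcd).integrable_of_hasCompactSupport
      ((hc.fderiv_apply (𝕜 := ℝ) _).mul_left))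
    (((continuous_planeWave v).mul hχ.continuous).integrable_of_hasCompactSupport hc.mul_left)
    (fun x _ => hw x) (fun x _ => hd x)
  simp only [fderiv_planeWave] at h
  rw [← integral_const_mul, ← integral_congr_ae (Eventually.of_forall fun x => mul_comm _ _), h,
    ← integral_neg]
  refine integral_congr_ae (Eventually.of_forall fun x => ?_)
  change -(Complex.I * (v i : ℂ) * planeWave v x * χ x) = _
  ring

theorem HilbertBasis.clm_ext {ι E : Type*} [NormedAddCommGroup E] [InnerProductSpace ℂ E]
    (b : HilbertBasis ι ℂ E) {ℓ ℓ' : E →L[ℂ] ℂ} (h : ∀ n, ℓ (b n) = ℓ' (b n)) : ℓ = ℓ' := by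
  refine ContinuousLinearMap.ext_on (s := Set.range b) ?_ ?_
  · exact Submodule.dense_iff_topologicalClosure_eq_top.2 b.dense_span
  · rintro _ ⟨n, rfl⟩
    exact h n

theorem inner_waveVec_of_ne (k : Fin 2 → ℝ) {m n : Fin 2 → ℤ} (h : m ≠ n) :
    inner ℂ (waveVec k m) (waveVec k n) = (0 : ℂ) := by
  obtain ⟨c, hc0, hc, hp⟩ := exists_measurePreserving_torusPt
  have h1 := inner_waveVec_waveVec hp k m n
  rw [if_neg h] at h1
  refine (mul_eq_zero.1 h1).resolve_left ?_
  exact_mod_cast (ENNReal.toReal_pos hc0 hc).ne'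

theorem waveVec_clm_ext (k : Fin 2 → ℝ) {ℓ ℓ' : CellL2 volume →L[ℂ] ℂ}
    (h : ∀ n, ℓ (waveVec k n) = ℓ' (waveVec k n)) : ℓ = ℓ' := by
  obtain ⟨a, b, ha, hb⟩ := exists_hilbertBasis_waveVec k
  refine HilbertBasis.clm_ext b fun n => ?_
  rw [hb, map_smul, map_smul, h]

/-- Apart from `bump` the integrand is periodic, and the translates of `bump` sum up to `1`; the
integral over the plane folds up to one over the cell. In this way a compactly supported test
function computes a Fourier coefficient. -/
theorem integral_bump_mul (k : Fin 2 → ℝ) (n : Fin 2 → ℤ) (f : CellL2 volume) :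
    ∫ x, bump x * planeWave (-momentum k n) x * ext k f x = inner ℂ (waveVec k n) f := by
  have hχ : Continuous fun x => bump x * planeWave (-momentum k n) x :=
    contDiff_bump.continuous.mul (continuous_planeWave _)
  have hc : HasCompactSupport fun x => bump x * planeWave (-momentum k n) x :=
    hasCompactSupport_bump.mul_right
  rw [integral_mul_ext_eq_sum hχ hc k f fun x hx => floorPt_mem_bumpShifts (left_ne_zero_of_mul hx),
    inner_waveVec]
  have e : ∀ (g : ℤ × ℤ) (x : Plane),
      bump (g +ᵥ x) * planeWave (-momentum k n) (g +ᵥ x) * phase k g * f x =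
        bump (g +ᵥ x) * (starRingEnd ℂ (planeWave (momentum k n) x) * f x) := by
    intro g x
    rw [← conj_planeWave, isQuasiPeriodic_planeWave k n, map_mul, conj_phase]
    have : phase k (-g) * phase k g = 1 := by rw [← phase_add, neg_add_cancel, phase_zero]
    linear_combination (bump (g +ᵥ x) * starRingEnd ℂ (planeWave (momentum k n) x) * f x) * this
  simp only [e]
  have hf : Integrable (fun x => starRingEnd ℂ (planeWave (momentum k n) x) * f x)
      (volume.restrict cell) := by
    refine ((Lp.memLp f).integrable (by norm_num)).bdd_mul (c := 1)
      (Complex.continuous_conj.comp (continuous_planeWave _)).aestronglyMeasurable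
      (Eventually.of_forall fun x => ?_)
    rw [RCLike.norm_conj, norm_planeWave]
  rw [← integral_finsetSum]
  · refine setIntegral_congr_fun measurableSet_cell fun x hx => ?_
    change ∑ g ∈ bumpShifts, _ = _
    rw [← Finset.sum_mul, sum_bump hx, one_mul]
  · intro g _
    exact hf.bdd_mul (c := 1)
      (contDiff_bump.continuous.comp (continuous_vadd g)).aestronglyMeasurable
      (Eventually.of_forall fun x => norm_bump_le _)

end PlaneWave

/-! ### Weak differentiation in terms of Fourier coefficients -/

section Coefficients

variable (k : Fin 2 → ℝ) (δ : Plane) (i : Fin 2)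

theorem integral_fderiv_mul_waveVec {χ : Plane → ℂ} (hχ : ContDiff ℝ ∞ χ)
    (hc : HasCompactSupport χ) (n : Fin 2 → ℤ) :
    ∫ x, fderiv ℝ χ x (EuclideanSpace.single i 1) * planeWave δ x * ext k (waveVec k n) x =
      -(Complex.I * ((momentum k n + δ) i : ℂ)) *
        ∫ x, χ x * planeWave δ x * ext k (waveVec k n) x := by
  have e : ∀ u : Plane → ℂ, ∫ x, u x * planeWave δ x * ext k (waveVec k n) x =
      ∫ x, u x * planeWave (momentum k n + δ) x := fun u => by
    refine integral_congr_ae ?_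
    filter_upwards [ext_waveVec k n] with x hx
    rw [hx, planeWave_add, mul_assoc, mul_comm (planeWave δ x)]
  rw [e, e, integral_fderiv_mul_planeWave hχ hc]

/-- The Fourier coefficients of a weak derivative. -/
theorem isWeakPartial_iff (f g : CellL2 volume) :
    IsWeakPartial i (fun x => planeWave δ x * ext k f x) (fun x => planeWave δ x * ext k g x) ↔
      ∀ n, (inner ℂ (waveVec k n) g : ℂ) =
        Complex.I * ((momentum k n + δ) i : ℂ) * inner ℂ (waveVec k n) f := by
  have hl : ∀ f : CellL2 volume, LocL2 volume fun x => planeWave δ x * ext k f x := fun f => by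
    intro C hC
    refine (locL2_ext k f C hC).of_le ?_ (Eventually.of_forall fun x => ?_)
    · exact (continuous_planeWave δ).aestronglyMeasurable.mul (locL2_ext k f C hC).1
    · rw [norm_mul, norm_planeWave, one_mul]
  -- Both sides of the defining identity are continuous functionals on the cell space, so they are
  -- determined by their values on plane waves.
  have hfun : ∀ {χ : Plane → ℂ}, ContDiff ℝ ∞ χ → HasCompactSupport χ →
      ∃ ℓ₁ ℓ₂ : CellL2 volume →L[ℂ] ℂ,
        (∀ f, ℓ₁ f = ∫ x, fderiv ℝ χ x (EuclideanSpace.single i 1) * planeWave δ x * ext k f x) ∧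
        (∀ f, ℓ₂ f = ∫ x, χ x * planeWave δ x * ext k f x) ∧
        ∀ n, ℓ₁ (waveVec k n) =
          -(Complex.I * ((momentum k n + δ) i : ℂ)) * ℓ₂ (waveVec k n) := by
    intro χ hχ hc
    have hcd : Continuous fun x => fderiv ℝ χ x (EuclideanSpace.single i 1) :=
      (hχ.continuous_fderiv (by simp)).clm_apply continuous_const
    obtain ⟨ℓ₁, h₁⟩ := exists_functional (hcd.mul (continuous_planeWave δ))
      ((hc.fderiv_apply (𝕜 := ℝ) _).mul_right) k
    obtain ⟨ℓ₂, h₂⟩ := exists_functional (hχ.continuous.mul (continuous_planeWave δ))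
      hc.mul_right k
    refine ⟨ℓ₁, ℓ₂, h₁, h₂, fun n => ?_⟩
    rw [h₁, h₂]
    exact integral_fderiv_mul_waveVec k δ i hχ hc n
  constructor
  · intro h n
    let χ : Plane → ℂ := fun x => bump x * planeWave (-(momentum k n + δ)) x
    have hχ : ContDiff ℝ ∞ χ := contDiff_bump.mul (contDiff_planeWave _)
    have hc : HasCompactSupport χ := hasCompactSupport_bump.mul_right
    obtain ⟨ℓ₁, ℓ₂, h₁, h₂, h₃⟩ := hfun hχ hc
    have h₄ : ∀ f, ℓ₂ f = inner ℂ (waveVec k n) f := fun f => by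
      rw [h₂, ← integral_bump_mul]
      refine integral_congr_ae (Eventually.of_forall fun x => ?_)
      change bump x * planeWave (-(momentum k n + δ)) x * planeWave δ x * _ = _
      rw [mul_assoc (bump x), ← planeWave_add, neg_add, neg_add_cancel_right]
    -- On the wave `n` this is partial integration; on the other waves both sides vanish by
    -- orthogonality.
    have h₅ : ℓ₁ = -(Complex.I * ((momentum k n + δ) i : ℂ)) • innerSL ℂ (waveVec k n) := by
      refine waveVec_clm_ext k fun m => ?_
      rw [h₃, h₄, FunLike.coe_smul, Pi.smul_apply, innerSL_apply_apply, smul_eq_mul]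
      by_cases hmn : m = n
      · rw [hmn]
      · rw [inner_waveVec_of_ne k (Ne.symm hmn), mul_zero, mul_zero]
    have h₆ := h.integral_mul (hl f) (hl g) hχ hc
    simp only [← mul_assoc] at h₆
    rw [← h₁, ← h₂, h₄, h₅, FunLike.coe_smul, Pi.smul_apply, innerSL_apply_apply, smul_eq_mul] at h₆
    linear_combination h₆
  · intro h φ hφ hc
    have hχ : ContDiff ℝ ∞ fun x => (φ x : ℂ) := Complex.ofRealCLM.contDiff.comp hφ
    have hcχ : HasCompactSupport fun x => (φ x : ℂ) :=
      hc.comp_left (g := fun t : ℝ => (t : ℂ)) Complex.ofReal_zero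
    obtain ⟨ℓ₁, ℓ₂, h₁, h₂, h₃⟩ := hfun hχ hcχ
    obtain ⟨a, b, ha, hb⟩ := exists_hilbertBasis_waveVec k
    have hdφ : ∀ x v, fderiv ℝ (fun x => (φ x : ℂ)) x v = (fderiv ℝ φ x v : ℂ) := fun x v => by
      have := (Complex.ofRealCLM.hasFDerivAt.comp x
        ((hφ.differentiable (by simp)) x).hasFDerivAt).fderiv
      exact congrArg (fun L : Plane →L[ℝ] ℂ => L v) this
    -- The functionals are evaluated termwise on the Fourier series of `f` and `g`.
    have key : ℓ₁ f = -ℓ₂ g := by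
      have s₁ := (b.hasSum_repr f).mapL ℓ₁
      have s₂ := ((b.hasSum_repr g).mapL ℓ₂).neg
      refine s₁.unique (s₂.congr_fun fun n => ?_)
      rw [map_smul, map_smul, b.repr_apply_apply, b.repr_apply_apply, hb, map_smul, map_smul, h₃,
        inner_smul_left, inner_smul_left, h n]
      simp only [smul_eq_mul]
      ring
    have e₁ : ∫ x, fderiv ℝ φ x (EuclideanSpace.single i 1) • (planeWave δ x * ext k f x) = ℓ₁ f := by
      rw [h₁]
      refine integral_congr_ae (Eventually.of_forall fun x => ?_)
      change fderiv ℝ φ x _ • (planeWave δ x * ext k f x) =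
        fderiv ℝ (fun x => (φ x : ℂ)) x _ * planeWave δ x * ext k f x
      rw [hdφ, Complex.real_smul, mul_assoc]
    have e₂ : ∫ x, φ x • (planeWave δ x * ext k g x) = ℓ₂ g := by
      rw [h₂]
      refine integral_congr_ae (Eventually.of_forall fun x => ?_)
      change φ x • (planeWave δ x * ext k g x) = (φ x : ℂ) * planeWave δ x * ext k g x
      rw [Complex.real_smul, mul_assoc]
    rw [e₁, e₂, key]

end Coefficients

/-! ### Weak derivatives of Bloch functions -/

section Periodicity

theorem IsWeakPartial.vadd {i : Fin 2} {f g : Plane → ℂ} (h : IsWeakPartial i f g) (γ : ℤ × ℤ) :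
    IsWeakPartial i (fun x => f (γ +ᵥ x)) fun x => g (γ +ᵥ x) := by
  intro φ hφ hc
  set v : Plane := (γ.1 : ℝ) • a₁ + (γ.2 : ℝ) • a₂ with hv
  have hφ' : ContDiff ℝ ∞ fun x => φ (x - v) := hφ.comp (contDiff_id.sub contDiff_const)
  have hc' : HasCompactSupport fun x => φ (x - v) := by
    have := hc.comp_homeomorph (Homeomorph.subRight v)
    exact this
  have h1 := h _ hφ' hc'
  have hd : ∀ x, fderiv ℝ (fun x => φ (x - v)) x = fderiv ℝ φ (x - v) := fun x =>
    fderiv_comp_sub (f := φ) v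
  have e1 := integral_add_right_eq_self (μ := (volume : Measure Plane))
    (fun x => fderiv ℝ (fun x => φ (x - v)) x (EuclideanSpace.single i 1) • f x) v
  have e2 := integral_add_right_eq_self (μ := (volume : Measure Plane))
    (fun x => φ (x - v) • g x) v
  rw [← e1, ← e2] at h1
  simp only [hd, add_sub_cancel_right] at h1
  exact h1

/-- A weak derivative of a Bloch function is a Bloch function. -/
theorem IsWeakPartial.exists_ext {k : Fin 2 → ℝ} {δ : Plane} {i : Fin 2} {f : CellL2 volume}
    {G : Plane → ℂ} (h : IsWeakPartial i (fun x => planeWave δ x * ext k f x) G)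
    (hf : LocL2 volume fun x => planeWave δ x * ext k f x) (hG : LocL2 volume G) :
    ∃ g : CellL2 volume, G =ᵐ[volume] fun x => planeWave δ x * ext k g x := by
  let v : ℤ × ℤ → Plane := fun γ => (γ.1 : ℝ) • a₁ + (γ.2 : ℝ) • a₂
  have hw : ∀ (γ : ℤ × ℤ) x, planeWave δ (γ +ᵥ x) = planeWave δ (v γ) * planeWave δ x := by
    intro γ x
    rw [vadd_eq_add, planeWave, planeWave, planeWave, ← Complex.exp_add, inner_add_right]
    congr 1; push_cast; ring
  have hvl : ∀ {F : Plane → ℂ} (γ : ℤ × ℤ), LocL2 volume F → LocL2 volume fun x => F (γ +ᵥ x) := by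
    intro F γ hF C hC
    have h1 := hF _ (hC.image (continuous_vadd γ))
    have h2 := h1.comp_measurePreserving ((measurePreserving_vadd γ (volume : Measure Plane)).restrict_preimage_emb
      (measurableEmbedding_const_vadd γ) _)
    rwa [Set.preimage_image_eq _ (MeasurableEmbedding.injective (measurableEmbedding_const_vadd γ))] at h2
  -- Both sides are weak derivatives of the same function, and weak derivatives are unique.
  have hq : ∀ γ : ℤ × ℤ, ∀ᵐ x, G (γ +ᵥ x) = (planeWave δ (v γ) * phase k γ) * G x := by
    intro γ
    refine (h.vadd γ).ae_eq (h.smul (planeWave δ (v γ) * phase k γ))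
      (Eventually.of_forall fun x => ?_) (hvl γ hf) (hvl γ hG) (hG.smul _)
    change planeWave δ (γ +ᵥ x) * ext k f (γ +ᵥ x) = _ * (planeWave δ x * ext k f x)
    rw [hw, isQuasiPeriodic_ext]
    ring
  have hm : MemLp (fun x => planeWave (-δ) x * G x) 2 ((volume : Measure Plane).restrict cell) := by
    have h1 := (hG _ isCompact_parallelogram).mono_measure
      (Measure.restrict_mono cell_subset_parallelogram le_rfl)
    refine h1.of_le ((continuous_planeWave _).aestronglyMeasurable.mul h1.1)
      (Eventually.of_forall fun x => ?_)
    rw [norm_mul, norm_planeWave, one_mul]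
  refine ⟨hm.toLp _, ?_⟩
  have h2 := ext_ae_eq (k := k) (f := hm.toLp _) (ψ := fun x => planeWave (-δ) x * G x)
    (by
      filter_upwards [ae_all_iff.2 hq] with x hx γ
      have h0 : planeWave (-δ) (γ +ᵥ x) * planeWave δ (γ +ᵥ x) = 1 := planeWave_neg_mul _ _
      have h0' := planeWave_neg_mul δ x
      have h3 := planeWave_ne_zero δ x
      rw [hx]
      refine mul_left_cancel₀ h3 ?_
      rw [hw] at h0
      linear_combination (phase k γ * G x) * h0 - phase k γ * G x * h0')
    hm.coeFn_toLp.symm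
  filter_upwards [h2] with x hx
  rw [← hx, ← mul_assoc, mul_comm (planeWave δ x), planeWave_neg_mul, one_mul]

end Periodicity

/-! ### Fourier multipliers and growth of the momenta -/

section FourierCoefficients

theorem eq_of_inner_waveVec (k : Fin 2 → ℝ) {f g : CellL2 volume}
    (h : ∀ n, (inner ℂ (waveVec k n) f : ℂ) = inner ℂ (waveVec k n) g) : f = g := by
  rw [← sub_eq_zero]
  refine eq_zero_of_inner_waveVec k fun n => ?_
  rw [inner_sub_right, h, sub_self]

/-- The normalised plane waves of quasimomentum `k`. -/
def fourierBasis (k : Fin 2 → ℝ) : HilbertBasis (Fin 2 → ℤ) ℂ (CellL2 volume) :=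
  (exists_hilbertBasis_waveVec k).choose_spec.choose

theorem isDiagonal_fourierBasis_iff (k : Fin 2 → ℝ) {a : (Fin 2 → ℤ) → ℂ}
    {D : CellL2 volume →L[ℂ] CellL2 volume} :
    IsDiagonal (fourierBasis k) a D ↔
      ∀ n f, (inner ℂ (waveVec k n) (D f) : ℂ) = a n * inner ℂ (waveVec k n) f := by
  obtain ⟨h0, hb⟩ := (exists_hilbertBasis_waveVec k).choose_spec.choose_spec
  have h0' : (((exists_hilbertBasis_waveVec k).choose : ℝ) : ℂ) ≠ 0 := by exact_mod_cast h0
  have e : ∀ n (u : CellL2 volume), (inner ℂ (fourierBasis k n) u : ℂ) =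
      ((exists_hilbertBasis_waveVec k).choose : ℝ) * inner ℂ (waveVec k n) u := by
    intro n u
    rw [fourierBasis, hb, inner_smul_left, Complex.conj_ofReal]
  simp only [IsDiagonal, e]
  refine forall_congr' fun n => forall_congr' fun f => ?_
  rw [mul_left_comm]
  exact mul_right_inj' h0'

theorem inner_a₁_kappa (k : Fin 2 → ℝ) : inner ℝ a₁ (kappa k) = k 0 := by
  rw [kappa, inner_add_right, inner_smul_right, inner_smul_right, real_inner_comm,
    inner_b₁_a₁, real_inner_comm, inner_b₂_a₁]
  ring

theorem inner_a₂_kappa (k : Fin 2 → ℝ) : inner ℝ a₂ (kappa k) = k 1 := by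
  rw [kappa, inner_add_right, inner_smul_right, inner_smul_right, real_inner_comm,
    inner_b₁_a₂, real_inner_comm, inner_b₂_a₂]
  ring

theorem finite_momentum_norm_le (k : Fin 2 → ℝ) (B : ℝ) : {n | ‖momentum k n‖ ≤ B}.Finite := by
  obtain ⟨N, hN⟩ := exists_int_gt (‖k‖ + (‖a₁‖ + ‖a₂‖) * B)
  refine (Set.finite_Icc (fun _ => -N : Fin 2 → ℤ) (fun _ => N)).subset fun n hn => ?_
  have hB : 0 ≤ B := (norm_nonneg _).trans hn
  have key : ∀ i, ∃ v : Plane, ‖v‖ ≤ ‖a₁‖ + ‖a₂‖ ∧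
      inner ℝ v (momentum k n) = k i + 2 * Real.pi * n i := by
    intro i
    fin_cases i
    · exact ⟨a₁, by simp, inner_a₁_kappa _⟩
    · exact ⟨a₂, by simp, inner_a₂_kappa _⟩
  have h : ∀ i, |n i| ≤ N := by
    intro i
    obtain ⟨v, hv, he⟩ := key i
    have h1 : |k i + 2 * Real.pi * n i| ≤ (‖a₁‖ + ‖a₂‖) * B := by
      rw [← he]
      exact (abs_real_inner_le_norm _ _).trans
        (mul_le_mul hv hn (norm_nonneg _) (by positivity))
    have h2 : |k i| ≤ ‖k‖ := norm_le_pi_norm k i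
    have h3 : |2 * Real.pi * (n i : ℝ)| ≤ N := by
      have := abs_sub (k i + 2 * Real.pi * n i) (k i)
      rw [add_sub_cancel_left] at this
      linarith
    rw [abs_mul, abs_of_pos Real.two_pi_pos] at h3
    have h4 : |(n i : ℝ)| ≤ N := by
      have : 1 ≤ 2 * Real.pi := by linarith [Real.pi_gt_three]
      nlinarith [abs_nonneg (n i : ℝ)]
    exact_mod_cast h4
  exact ⟨fun i => (abs_le.1 (h i)).1, fun i => (abs_le.1 (h i)).2⟩

theorem tendsto_inv_momentum (k : Fin 2 → ℝ) {c : ℝ} (hc : 0 < c) :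
    Tendsto (fun n => (((‖momentum k n‖ ^ 2 + c)⁻¹ : ℝ) : ℂ)) cofinite (𝓝 0) := by
  rw [tendsto_zero_iff_norm_tendsto_zero]
  simp only [Complex.norm_real]
  rw [Metric.tendsto_nhds]
  intro ε hε
  rw [eventually_cofinite]
  -- A norm above `1 + ε⁻¹` has its square above `ε⁻¹`.
  refine (finite_momentum_norm_le k (1 + ε⁻¹)).subset fun n hn => ?_
  by_contra hlt
  simp only [Set.mem_ofPred_eq, not_le] at hlt
  refine hn ?_
  rw [Real.dist_0_eq_abs, abs_norm, norm_inv, Real.norm_of_nonneg (by positivity)]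
  refine inv_lt_of_inv_lt₀ hε ?_
  have : 0 < ε⁻¹ := inv_pos.2 hε
  nlinarith

theorem norm_sq_plane (v : Plane) : ‖v‖ ^ 2 = v 0 ^ 2 + v 1 ^ 2 := by
  rw [EuclideanSpace.norm_sq_eq, Fin.sum_univ_two]
  simp

theorem abs_coord_mul_le (v : Plane) (i j : Fin 2) : |v i * v j| ≤ ‖v‖ ^ 2 := by
  have h := norm_sq_plane v
  have hi : v i ^ 2 ≤ ‖v‖ ^ 2 := by
    fin_cases i <;> simp <;> nlinarith [sq_nonneg (v 0), sq_nonneg (v 1)]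
  have hj : v j ^ 2 ≤ ‖v‖ ^ 2 := by
    fin_cases j <;> simp <;> nlinarith [sq_nonneg (v 0), sq_nonneg (v 1)]
  rw [abs_le]
  constructor <;> nlinarith [sq_nonneg (v i + v j), sq_nonneg (v i - v j)]

theorem abs_coord_le (v : Plane) (i : Fin 2) : |v i| ≤ ‖v‖ ^ 2 + 1 := by
  have h := abs_coord_mul_le v i i
  rw [abs_mul] at h
  nlinarith [sq_nonneg (|v i| - 1), abs_nonneg (v i)]

end FourierCoefficients

/-! ### The operator `-Δ + q` in Fourier coefficients -/

section Potential

theorem isWeakPartial_one (i : Fin 2) : IsWeakPartial i 1 0 := by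
  intro φ hφ hc
  have hχ : ContDiff ℝ ∞ fun x => (φ x : ℂ) := Complex.ofRealCLM.contDiff.comp hφ
  have hcχ : HasCompactSupport fun x => (φ x : ℂ) :=
    hc.comp_left (g := fun t : ℝ => (t : ℂ)) Complex.ofReal_zero
  have h := integral_fderiv_mul_planeWave hχ hcχ 0 i
  have hdφ : ∀ x v, fderiv ℝ (fun x => (φ x : ℂ)) x v = (fderiv ℝ φ x v : ℂ) := fun x v => by
    have := (Complex.ofRealCLM.hasFDerivAt.comp x
      ((hφ.differentiable (by simp)) x).hasFDerivAt).fderiv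
    exact congrArg (fun L : Plane →L[ℝ] ℂ => L v) this
  simpa [hdφ, planeWave_zero] using h

theorem locL2_one : LocL2 volume 1 := fun C hC => by
  have : IsFiniteMeasure ((volume : Measure Plane).restrict C) :=
    ⟨by simpa using hC.measure_lt_top⟩
  exact memLp_const 1

/-- The constant function `1` is in the domain and its image is `q`, so invariance of the operator
is periodicity of the potential. -/
theorem potential_periodic {q : Plane → ℝ}
    (hΓ : ∀ m n : ℤ, (schrodinger q).Invariant (shift m n)) :
    ∀ᵐ x, ∀ g : ℤ × ℤ, q (g +ᵥ x) = q x := by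
  rw [ae_all_iff]
  intro g
  have h0 : ((1, fun x => (q x : ℂ)) : (Plane → ℂ) × (Plane → ℂ)) ∈ (schrodinger q).rel :=
    ⟨fun _ => 0, fun _ _ => 0, locL2_one, fun _ => LocL2.zero, fun _ _ => LocL2.zero,
      fun i => isWeakPartial_one i, fun i j φ _ _ => by simp,
      Eventually.of_forall fun x => by simp⟩
  have h1 := (schrodinger q).rel.sub_mem (hΓ g.1 g.2 _ _ h0) h0
  have h2 := (schrodinger_isRegular q).single_of_ae h1 (Eventually.of_forall fun x => by simp)
  change _ =ᵐ[volume] _ at h2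
  filter_upwards [h2] with x hx
  have h3 : ((q (shift g.1 g.2 x) : ℝ) : ℂ) - (q x : ℝ) = 0 := hx
  rw [vadd_def]
  exact_mod_cast sub_eq_zero.1 h3

variable {q : Plane → ℝ} {a : Plane → ℂ}

theorem ext_mulOp (ha : Measurable a) {C : ℝ} (hC : ∀ x, ‖a x‖ ≤ C)
    (hp : ∀ᵐ x, ∀ g : ℤ × ℤ, a (g +ᵥ x) = a x) (k : Fin 2 → ℝ) (f : CellL2 volume) :
    ext k (mulOp volume ha hC f) =ᵐ[volume] fun x => a x * ext k f x := by
  refine (ext_ae_eq ?_ ?_).symm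
  · filter_upwards [hp] with x hx g
    rw [hx, isQuasiPeriodic_ext]
    ring
  · filter_upwards [mulOp_ae (μ := volume) ha hC f, ext_ae_cell volume k f] with x h1 h2
    rw [h1, h2]

theorem isSymmetric_mulOp (ha : Measurable a) {C : ℝ} (hC : ∀ x, ‖a x‖ ≤ C)
    (hr : ∀ x, starRingEnd ℂ (a x) = a x) :
    (mulOp volume ha hC : CellL2 volume →ₗ[ℂ] CellL2 volume).IsSymmetric := by
  intro f g
  change inner ℂ (mulOp volume ha hC f) g = inner ℂ f (mulOp volume ha hC g)
  rw [L2.inner_def, L2.inner_def]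
  refine integral_congr_ae ?_
  filter_upwards [mulOp_ae (μ := volume) ha hC f, mulOp_ae (μ := volume) ha hC g] with x h1 h2
  rw [h1, h2, RCLike.inner_apply', RCLike.inner_apply', map_mul, hr]
  ring

theorem locL2_planeWave_mul_ext (k : Fin 2 → ℝ) (δ : Plane) (f : CellL2 volume) :
    LocL2 volume fun x => planeWave δ x * ext k f x := fun C hC => by
  refine (locL2_ext k f C hC).of_le ?_ (Eventually.of_forall fun x => ?_)
  · exact (continuous_planeWave δ).aestronglyMeasurable.mul (locL2_ext k f C hC).1
  · rw [norm_mul, norm_planeWave, one_mul]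

/-- The Fourier coefficients of the twisted operators. -/
theorem twistedRel_schrodinger_iff (hq : Measurable fun x => (q x : ℂ)) {C : ℝ}
    (hC : ∀ x, ‖(q x : ℂ)‖ ≤ C) (hp : ∀ᵐ x, ∀ g : ℤ × ℤ, q (g +ᵥ x) = q x) (k : Fin 2 → ℝ)
    (δ : Plane) (f g : CellL2 volume) :
    (schrodinger q).twistedRel k δ f g ↔
      ∀ n, (inner ℂ (waveVec k n) (g - mulOp volume hq hC f) : ℂ) =
        (‖momentum k n + δ‖ ^ 2 : ℝ) * inner ℂ (waveVec k n) f := by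
  have hp' : ∀ᵐ x, ∀ g : ℤ × ℤ, ((q (g +ᵥ x) : ℝ) : ℂ) = q x := by
    filter_upwards [hp] with x hx g
    rw [hx]
  have hM := ext_mulOp hq hC hp' k f
  have hext : ∀ (h₀ h₁ : CellL2 volume), ext k (-(h₀ + h₁) + mulOp volume hq hC f : CellL2 volume)
      =ᵐ[volume] fun x => -(ext k h₀ x + ext k h₁ x) + (q x : ℂ) * ext k f x := by
    intro h₀ h₁
    have e : (-(h₀ + h₁) : CellL2 volume) = (-1 : ℂ) • (h₀ + h₁) := by rw [neg_one_smul]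
    rw [e]
    filter_upwards [ext_add_ae k ((-1 : ℂ) • (h₀ + h₁)) (mulOp volume hq hC f),
      ext_smul_ae k (-1) (h₀ + h₁), ext_add_ae k h₀ h₁, hM] with x h1 h2 h3 h4
    simp only [Pi.add_apply, Pi.smul_apply, smul_eq_mul] at h1 h2 h3
    rw [h1, h2, h3, h4]
    ring
  constructor
  · rintro ⟨G, h, h1, h2, h3, h4, h5, h6⟩ n
    -- The derivatives are again twisted Bloch functions, so that they have Fourier coefficients
    -- themselves.
    choose g' hg' using fun i => (h4 i).exists_ext h1 (h2 i)
    have h5' : ∀ i j, IsWeakPartial j (fun x => planeWave δ x * ext k (g' i) x) (h i j) :=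
      fun i j => (h5 i j).congr (hg' i) EventuallyEq.rfl
    choose h' hh' using fun i j =>
      (h5' i j).exists_ext (locL2_planeWave_mul_ext k δ (g' i)) (h3 i j)
    have c1 := fun i => (isWeakPartial_iff k δ i f (g' i)).1
      ((h4 i).congr EventuallyEq.rfl (hg' i)) n
    have c2 := fun i => (isWeakPartial_iff k δ i (g' i) (h' i i)).1
      ((h5' i i).congr EventuallyEq.rfl (hh' i i)) n
    have e : g = -(h' 0 0 + h' 1 1) + mulOp volume hq hC f := by
      refine eq_of_ext_ae_eq (k := k) ?_
      filter_upwards [h6, hext (h' 0 0) (h' 1 1), hh' 0 0, hh' 1 1] with x k1 k2 k3 k4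
      rw [k2]
      refine mul_left_cancel₀ (planeWave_ne_zero δ x) ?_
      change planeWave δ x * ext k g x = -(h 0 0 x + h 1 1 x) +
        (q x : ℂ) * (planeWave δ x * ext k f x) at k1
      rw [k1, k3, k4]
      ring
    rw [e, add_sub_cancel_right, inner_neg_right, inner_add_right, c2, c2, c1, c1, norm_sq_plane]
    push_cast
    linear_combination (-(((momentum k n + δ) 0 : ℝ) : ℂ) ^ 2 * inner ℂ (waveVec k n) f -
      (((momentum k n + δ) 1 : ℝ) : ℂ) ^ 2 * inner ℂ (waveVec k n) f) * Complex.I_sq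
  · intro H
    set u := g - mulOp volume hq hC f with hu
    have hpos : ∀ n, (0 : ℝ) < ‖momentum k n + δ‖ ^ 2 + 1 := fun n => by positivity
    have hne : ∀ n, ((‖momentum k n + δ‖ ^ 2 + 1 : ℝ) : ℂ) ≠ 0 := fun n => by
      exact_mod_cast (hpos n).ne'
    -- Elliptic regularity: `f + u` has the coefficients of `f` times `‖p + δ‖² + 1`, where `p =
    -- momentum k n`. The derivatives of order one and two arise from it by multipliers bounded by
    -- `1`, hence are in `L²`.
    have hfu : ∀ n, (inner ℂ (waveVec k n) (f + u) : ℂ) =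
        (‖momentum k n + δ‖ ^ 2 + 1 : ℝ) * inner ℂ (waveVec k n) f := fun n => by
      rw [inner_add_right, H]
      push_cast
      ring
    have d1 : ∀ i, ∃ D, IsDiagonal (fourierBasis k) (fun n => Complex.I *
        (((momentum k n + δ) i / (‖momentum k n + δ‖ ^ 2 + 1) : ℝ) : ℂ)) D := fun i =>
      exists_isDiagonal _ (C := 1) fun n => by
        rw [norm_mul, Complex.norm_I, one_mul, Complex.norm_real, Real.norm_eq_abs, abs_div,
          abs_of_pos (hpos n)]
        exact div_le_one_of_le₀ (abs_coord_le _ i) (hpos n).le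
    have d2 : ∀ i j, ∃ D, IsDiagonal (fourierBasis k) (fun n =>
        ((-((momentum k n + δ) i * (momentum k n + δ) j) /
          (‖momentum k n + δ‖ ^ 2 + 1) : ℝ) : ℂ)) D := fun i j =>
      exists_isDiagonal _ (C := 1) fun n => by
        rw [Complex.norm_real, Real.norm_eq_abs, abs_div, abs_of_pos (hpos n), abs_neg]
        exact div_le_one_of_le₀ ((abs_coord_mul_le _ i j).trans (by linarith)) (hpos n).le
    choose D hD using d1
    choose D' hD' using d2
    have cancel : ∀ x y z : ℂ, z ≠ 0 → x / z * (z * y) = x * y := fun x y z hz => by field_simp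
    have c1 : ∀ i n, (inner ℂ (waveVec k n) (D i (f + u)) : ℂ) =
        Complex.I * ((momentum k n + δ) i : ℂ) * inner ℂ (waveVec k n) f := fun i n => by
      rw [(isDiagonal_fourierBasis_iff k).1 (hD i), hfu, Complex.ofReal_div,
        mul_assoc Complex.I, cancel _ _ _ (hne n), mul_assoc]
    have c2 : ∀ i j n, (inner ℂ (waveVec k n) (D' i j (f + u)) : ℂ) =
        -(((momentum k n + δ) i : ℂ) * ((momentum k n + δ) j : ℂ)) * inner ℂ (waveVec k n) f :=
      fun i j n => by
        rw [(isDiagonal_fourierBasis_iff k).1 (hD' i j), hfu, Complex.ofReal_div,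
          cancel _ _ _ (hne n)]
        push_cast
        ring
    refine ⟨fun i x => planeWave δ x * ext k (D i (f + u)) x,
      fun i j x => planeWave δ x * ext k (D' i j (f + u)) x, locL2_planeWave_mul_ext k δ f,
      fun i => locL2_planeWave_mul_ext k δ _, fun i j => locL2_planeWave_mul_ext k δ _,
      fun i => (isWeakPartial_iff k δ i _ _).2 (c1 i),
      fun i j => (isWeakPartial_iff k δ j _ _).2 fun n => ?_, ?_⟩
    · rw [c1, c2]
      linear_combination (-(((momentum k n + δ) i : ℝ) : ℂ) *
        (((momentum k n + δ) j : ℝ) : ℂ) * inner ℂ (waveVec k n) f) * Complex.I_sq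
    · have e : g = -(D' 0 0 (f + u) + D' 1 1 (f + u)) + mulOp volume hq hC f := by
        rw [← sub_eq_iff_eq_add, ← hu]
        refine eq_of_inner_waveVec k fun n => ?_
        rw [H, inner_neg_right, inner_add_right, c2, c2, norm_sq_plane]
        push_cast
        ring
      have hx := hext (D' 0 0 (f + u)) (D' 1 1 (f + u))
      rw [← e] at hx
      filter_upwards [hx] with x hx
      change planeWave δ x * ext k g x =
        -(planeWave δ x * ext k (D' 0 0 (f + u)) x + planeWave δ x * ext k (D' 1 1 (f + u)) x) +
          (q x : ℂ) * (planeWave δ x * ext k f x)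
      rw [hx]
      ring

end Potential

/-! ### Resolvents of the twisted operators `-Δ + q` -/

section Resolvent

variable {q : Plane → ℝ}

/-- The twisted operators `-Δ + q` have compact resolvents that are differentiable at zero. -/
theorem schrodinger_isResolventFamily (hq : Measurable q) (hb : ∃ C, ∀ x, |q x| ≤ C)
    (hΓ : ∀ m n : ℤ, (schrodinger q).Invariant (shift m n)) (k : Fin 2 → ℝ) :
    ∃ c S L, (schrodinger q).IsResolventFamily k c S L := by
  obtain ⟨C, hC⟩ := hb
  have hqm : Measurable fun x => (q x : ℂ) := Complex.measurable_ofReal.comp hq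
  have hqC : ∀ x, ‖(q x : ℂ)‖ ≤ C := fun x => by
    rw [Complex.norm_real]; exact hC x
  have hp := potential_periodic hΓ
  set M : CellL2 volume →L[ℂ] CellL2 volume := mulOp volume hqm hqC with hM
  have hMs : ∀ u v, inner ℂ (M u) v = (inner ℂ u (M v) : ℂ) :=
    isSymmetric_mulOp hqm hqC fun x => Complex.conj_ofReal _
  -- This makes `‖M * R‖ < 1`, so that `A 0` is invertible.
  set c : ℝ := ‖M‖ + 1 with hc
  have hc0 : 0 < c := by positivity
  set p : (Fin 2 → ℤ) → Plane := momentum k with hpdef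
  have hpos : ∀ n, 0 < ‖p n‖ ^ 2 + c := fun n => by positivity
  have hne : ∀ n, ((‖p n‖ ^ 2 + c : ℝ) : ℂ) ≠ 0 := fun n => by exact_mod_cast (hpos n).ne'
  obtain ⟨R, hR⟩ := exists_isDiagonal (fourierBasis k) (C := c⁻¹)
    (a := fun n => (((‖p n‖ ^ 2 + c)⁻¹ : ℝ) : ℂ)) fun n => by
      rw [Complex.norm_real, norm_inv, Real.norm_of_nonneg (hpos n).le]
      exact inv_anti₀ hc0 (le_add_of_nonneg_left (sq_nonneg _))
  have hRnorm : ‖R‖ ≤ c⁻¹ := hR.norm_le (inv_nonneg.2 hc0.le) fun n => by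
    rw [Complex.norm_real, norm_inv, Real.norm_of_nonneg (hpos n).le]
    exact inv_anti₀ hc0 (le_add_of_nonneg_left (sq_nonneg _))
  have hP : ∀ i, ∃ D, IsDiagonal (fourierBasis k)
      (fun n => ((p n i * (‖p n‖ ^ 2 + c)⁻¹ : ℝ) : ℂ)) D := fun i =>
    exists_isDiagonal _ (C := 1) fun n => by
      rw [Complex.norm_real, Real.norm_eq_abs, abs_mul, abs_inv, abs_of_pos (hpos n),
        ← div_eq_mul_inv]
      exact div_le_one_of_le₀ ((abs_coord_le _ i).trans (by
        have := norm_nonneg M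
        linarith)) (hpos n).le
  choose P hP using hP
  -- `K δ` is the change `2 δ·p + ‖δ‖²` of the Laplacian composed with its resolvent `R` at `-c`:
  -- polynomial in `δ` with bounded coefficients.
  let K : Plane → CellL2 volume →L[ℂ] CellL2 volume := fun δ =>
    ((2 * δ 0 : ℝ) : ℂ) • P 0 + ((2 * δ 1 : ℝ) : ℂ) • P 1 + ((‖δ‖ ^ 2 : ℝ) : ℂ) • R
  have hK : ∀ δ, IsDiagonal (fourierBasis k)
      (fun n => ((((‖p n + δ‖ ^ 2 - ‖p n‖ ^ 2) * (‖p n‖ ^ 2 + c)⁻¹ : ℝ)) : ℂ)) (K δ) := by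
    intro δ
    convert (((hP 0).smul ((2 * δ 0 : ℝ) : ℂ)).add ((hP 1).smul ((2 * δ 1 : ℝ) : ℂ))).add
      (hR.smul ((‖δ‖ ^ 2 : ℝ) : ℂ)) using 2 with n
    rw [← Complex.ofReal_mul, ← Complex.ofReal_mul, ← Complex.ofReal_mul, ← Complex.ofReal_add,
      ← Complex.ofReal_add, norm_sq_plane (p n + δ), norm_sq_plane (p n), norm_sq_plane δ]
    simp only [PiLp.add_apply]
    congr 1
    ring
  -- `A δ` is the twisted operator plus `c`, composed with `R`; the twisted resolvent is therefore
  -- `R * (A δ)⁻¹`.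
  let A : Plane → CellL2 volume →L[ℂ] CellL2 volume := fun δ => 1 + K δ + M * R
  have hA0 : IsUnit (A 0) := by
    have h0 : A 0 = 1 - -(M * R) := by
      simp [A, K]
    rw [h0]
    refine isUnit_one_sub_of_norm_lt_one ?_
    rw [norm_neg]
    refine (norm_mul_le _ _).trans_lt ?_
    refine (mul_le_mul_of_nonneg_left hRnorm (norm_nonneg _)).trans_lt ?_
    rw [← div_eq_mul_inv, div_lt_one hc0]
    linarith
  have hcoord : ∀ i, Differentiable ℝ fun δ : Plane => ((2 * δ i : ℝ) : ℂ) := fun i =>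
    Complex.ofRealCLM.differentiable.comp
      ((EuclideanSpace.proj (𝕜 := ℝ) i).differentiable.const_mul 2)
  have hnsq : Differentiable ℝ fun δ : Plane => ((‖δ‖ ^ 2 : ℝ) : ℂ) :=
    Complex.ofRealCLM.differentiable.comp (contDiff_norm_sq ℝ |>.differentiable (n := 1) (by simp))
  have hAd : Differentiable ℝ A :=
    ((differentiable_const _).add ((((hcoord 0).smul_const _).add ((hcoord 1).smul_const _)).add
      (hnsq.smul_const _))).add (differentiable_const _)
  have hAu : ∀ᶠ δ in 𝓝 0, IsUnit (A δ) :=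
    hAd.continuous.continuousAt.eventually (Units.isOpen.mem_nhds hA0)
  let S : Plane → CellL2 volume →L[ℂ] CellL2 volume := fun δ => R * Ring.inverse (A δ)
  have hRw := (isDiagonal_fourierBasis_iff k).1 hR
  have hAR : ∀ δ n y, (inner ℂ (waveVec k n) (A δ y) : ℂ) =
      ((‖p n + δ‖ ^ 2 + c : ℝ) : ℂ) * inner ℂ (waveVec k n) (R y) +
        inner ℂ (waveVec k n) (M (R y)) := by
    intro δ n y
    change inner ℂ (waveVec k n) (y + K δ y + M (R y)) = _
    rw [inner_add_right, inner_add_right, (isDiagonal_fourierBasis_iff k).1 (hK δ), hRw,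
      Complex.ofReal_mul, Complex.ofReal_inv]
    have h1 : ((‖p n + δ‖ ^ 2 + c : ℝ) : ℂ) =
        ((‖p n + δ‖ ^ 2 - ‖p n‖ ^ 2 : ℝ) : ℂ) + ((‖p n‖ ^ 2 + c : ℝ) : ℂ) := by
      push_cast; ring
    rw [h1]
    linear_combination (-inner ℂ (waveVec k n) y) * (mul_inv_cancel₀ (hne n))
  have hiff : ∀ δ, IsUnit (A δ) → ∀ f g : CellL2 volume,
      (schrodinger q).twistedRel k δ f g ↔ f = S δ (g + (c : ℂ) • f) := by
    intro δ hu f g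
    rw [twistedRel_schrodinger_iff hqm hqC hp]
    constructor
    · intro h
      set u := g - M f with hudef
      -- It has to be shown that `f` is in the range of `R`. Its preimage has the coefficients of `u
      -- + f` times this multiplier, which is bounded because `‖p‖² ≤ 2 ‖p + δ‖² + 2 ‖δ‖²`.
      have hdom : ∃ D, IsDiagonal (fourierBasis k)
          (fun n => (((‖p n‖ ^ 2 + c) / (‖p n + δ‖ ^ 2 + 1) : ℝ) : ℂ)) D :=
        exists_isDiagonal _ (C := 2 + 2 * ‖δ‖ ^ 2 + c) fun n => by
          rw [Complex.norm_real, Real.norm_of_nonneg (by positivity), div_le_iff₀ (by positivity)]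
          have h1 : ‖p n‖ ≤ ‖p n + δ‖ + ‖δ‖ := by
            simpa using norm_sub_le (p n + δ) δ
          have h2 : ‖p n‖ ^ 2 ≤ 2 * ‖p n + δ‖ ^ 2 + 2 * ‖δ‖ ^ 2 := by
            nlinarith [norm_nonneg (p n), sq_nonneg (‖p n + δ‖ - ‖δ‖)]
          nlinarith [sq_nonneg (‖p n + δ‖ * ‖δ‖), sq_nonneg ‖p n + δ‖, sq_nonneg ‖δ‖,
            mul_nonneg hc0.le (sq_nonneg ‖p n + δ‖)]
      obtain ⟨D, hD⟩ := hdom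
      have hy : ∀ n, (inner ℂ (waveVec k n) (D (u + f)) : ℂ) =
          ((‖p n‖ ^ 2 + c : ℝ) : ℂ) * inner ℂ (waveVec k n) f := by
        intro n
        have h1 : ((‖p n + δ‖ ^ 2 + 1 : ℝ) : ℂ) ≠ 0 := by
          exact_mod_cast (by positivity : (0 : ℝ) < ‖p n + δ‖ ^ 2 + 1).ne'
        have h2 : ((‖p n + δ‖ ^ 2 : ℝ) : ℂ) * inner ℂ (waveVec k n) f + inner ℂ (waveVec k n) f =
            ((‖p n + δ‖ ^ 2 + 1 : ℝ) : ℂ) * inner ℂ (waveVec k n) f := by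
          push_cast; ring
        rw [(isDiagonal_fourierBasis_iff k).1 hD, inner_add_right, h, h2, Complex.ofReal_div,
          ← mul_assoc, div_mul_cancel₀ _ h1]
      have hRy : R (D (u + f)) = f := eq_of_inner_waveVec k fun n => by
        rw [hRw, hy, ← mul_assoc, Complex.ofReal_inv, inv_mul_cancel₀ (hne n), one_mul]
      have hAy : A δ (D (u + f)) = g + (c : ℂ) • f := eq_of_inner_waveVec k fun n => by
        have h1 := h n
        rw [hudef, inner_sub_right] at h1
        rw [hAR, hRy, inner_add_right, inner_smul_right]
        push_cast
        push_cast at h1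
        linear_combination -h1
      change f = R (Ring.inverse (A δ) (g + (c : ℂ) • f))
      rw [← hAy, ringInverse_mul_apply hu, hRy]
    · intro h n
      set y := Ring.inverse (A δ) (g + (c : ℂ) • f) with hy
      have hRy : R y = f := h.symm
      have hAy : A δ y = g + (c : ℂ) • f := mul_ringInverse_apply hu _
      have h1 := hAR δ n y
      rw [hRy, hAy, inner_add_right, inner_smul_right] at h1
      rw [inner_sub_right]
      push_cast at h1 ⊢
      linear_combination h1
  -- Inserting `u = A δ y` and `v = A δ z` reduces this to the symmetry of `R + R K + R M R`; `R`
  -- and `K δ` commute, being diagonal in the same basis.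
  have hsymm : ∀ δ, IsUnit (A δ) → (S δ : CellL2 volume →ₗ[ℂ] CellL2 volume).IsSymmetric := by
    intro δ hu u v
    change inner ℂ (R (Ring.inverse (A δ) u)) v = inner ℂ u (R (Ring.inverse (A δ) v))
    set y := Ring.inverse (A δ) u with hy
    set z := Ring.inverse (A δ) v with hz
    have hAy : A δ y = u := mul_ringInverse_apply hu _
    have hAz : A δ z = v := mul_ringInverse_apply hu _
    rw [← hAy, ← hAz]
    change inner ℂ (R y) (z + K δ z + M (R z)) = inner ℂ (y + K δ y + M (R y)) (R z)
    have hRs : ∀ u v, inner ℂ (R u) v = (inner ℂ u (R v) : ℂ) := hR.isSymmetric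
    have hKs : ∀ u v, inner ℂ (K δ u) v = (inner ℂ u (K δ v) : ℂ) := (hK δ).isSymmetric
    have hcomm : ∀ u, R (K δ u) = K δ (R u) := fun u => eq_of_inner_waveVec k fun n => by
      rw [hRw, (isDiagonal_fourierBasis_iff k).1 (hK δ), (isDiagonal_fourierBasis_iff k).1 (hK δ),
        hRw, mul_left_comm]
    rw [inner_add_right, inner_add_right, inner_add_left, inner_add_left, hRs, hRs, hKs, hcomm,
      hMs]
  have hRc : IsCompactOperator R := hR.isCompactOperator (tendsto_inv_momentum k hc0)
  have hSd : DifferentiableAt ℝ S 0 :=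
    DifferentiableAt.mul_clm (differentiableAt_const R)
      (DifferentiableAt.ringInverse_clm hAd.differentiableAt hA0)
  refine ⟨c, S, (fderiv ℝ S 0 : Plane →ₗ[ℝ] (CellL2 volume →L[ℂ] CellL2 volume)),
    IsCompactFamily.of_differentiableAt ?_ ?_ hSd, ?_⟩
  · exact Eventually.of_forall fun δ => hRc.comp_clm (Ring.inverse (A δ))
  · filter_upwards [hAu] with δ hu
    exact hsymm δ hu
  · filter_upwards [hAu] with δ hu
    exact hiff δ hu

theorem schrodinger_isAdmissible (hq : Measurable q) (hb : ∃ C, ∀ x, |q x| ≤ C)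
    (hΓ : ∀ m n : ℤ, (schrodinger q).Invariant (shift m n)) (k : Fin 2 → ℝ) :
    (schrodinger q).IsAdmissible k where
  vaddInvariant := inferInstanceAs (VAddInvariantMeasure (ℤ × ℤ) Plane volume)
  regular := schrodinger_isRegular q
  rot := measurePreserving_rot
  reflect _ := measurePreserving_reflect
  invert _ := measurePreserving_invert
  resolvent := schrodinger_isResolventFamily hq hb hΓ k

end Resolvent

/-! ### The rotation acts nontrivially on Bloch functions of the plane -/

section NontrivialComponent

theorem eq_zero_of_planeWave_eq_one {d : Plane} (h : ∀ x, planeWave d x = 1) : d = 0 := by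
  by_contra hd
  -- At this point the phase is `π` and the wave has the value `-1`.
  have h1 := h ((Real.pi / ‖d‖ ^ 2) • d)
  have h2 : ‖d‖ ^ 2 ≠ 0 := by positivity
  rw [planeWave, inner_smul_right, real_inner_self_eq_norm_sq, div_mul_cancel₀ _ h2, mul_comm,
    Complex.exp_pi_mul_I] at h1
  norm_num at h1

theorem eq_zero_of_rotAdj_eq {d : Plane} (h : rotAdj d = d) : d = 0 := by
  have h1 := add_rotAdj_add_rotAdj d
  rw [h, h] at h1
  have h2 : (3 : ℝ) • d = 0 := by rw [← h1]; module
  exact (smul_eq_zero.1 h2).resolve_left (by norm_num)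

theorem exists_momentum_ne_zero (k : Fin 2 → ℝ) : ∃ n, momentum k n ≠ 0 := by
  by_contra! h
  have h1 := inner_a₁_kappa fun i => k i + 2 * Real.pi * ((0 : Fin 2 → ℤ) i : ℝ)
  have h2 := inner_a₁_kappa fun i => k i + 2 * Real.pi * ((1 : Fin 2 → ℤ) i : ℝ)
  have e1 := h 0
  have e2 := h 1
  rw [momentum] at e1 e2
  rw [e1, inner_zero_right] at h1
  rw [e2, inner_zero_right] at h2
  simp at h1 h2
  rw [← h1] at h2
  have := Real.pi_pos
  linarith

/-- The rotation acts nontrivially on the Bloch functions of the plane. -/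
theorem schrodinger_isotypic_ne_bot (q : Plane → ℝ) {k : Fin 2 → ℝ} (hk : IsRotationPoint k) :
    (schrodinger q).isotypic k 1 ≠ ⊥ := by
  intro hbot
  have : VAddInvariantMeasure (ℤ × ℤ) Plane (schrodinger q).μ :=
    inferInstanceAs (VAddInvariantMeasure (ℤ × ℤ) Plane volume)
  let hB : BlochSymm (schrodinger q).μ k (RingHom.id ℂ) rot :=
    blochSymm_rot hk measurePreserving_rot
  let hV : BlochSymm (schrodinger q).μ k (starRingEnd ℂ) invert :=
    blochSymm_invert measurePreserving_invert
  have hK := isIsotypic_rotOp hB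
  -- Only the exchange of the components matters, so the identity serves as the operator it commutes
  -- with.
  have hJ := isExchange_invert (S := 1) hB hV fun _ => rfl
  have h0 : ∀ u ∈ (schrodinger q).isotypic k 1, u = 0 := fun u hu => by
    rwa [hbot, Submodule.mem_bot] at hu
  have h2 : ∀ u ∈ (schrodinger q).isotypic k 2, u = 0 := fun u hu => by
    have e := h0 _ (hJ.right u hu)
    rw [← hJ.invol u, e]
    simpa using hJ.smul 0 0
  -- With component `1`, component `2` vanishes by the exchange, and only the functions fixed by the
  -- rotation remain.
  have hid : ∀ u, rotOp hB u = u := fun u => by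
    obtain ⟨p, hp, hu⟩ := hK.exists_sum u
    rw [h0 _ (hp 1), h2 _ (hp 2), add_zero, add_zero] at hu
    have h3 := (hK.mem 0 _).1 (hp 0)
    rw [hu]
    simpa using h3
  -- A plane wave fixed by the rotation has a wave vector fixed by `rotAdj`, which can only be zero.
  obtain ⟨n, hn⟩ := exists_momentum_ne_zero k
  refine hn (eq_zero_of_rotAdj_eq (sub_eq_zero.1 (eq_zero_of_planeWave_eq_one ?_)))
  have h4 : (fun x => planeWave (rotAdj (momentum k n)) x) =ᵐ[volume]
      fun x => planeWave (momentum k n) x := by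
    have h5 := hB.ext_op (waveVec k n)
    have h6 : hB.op (waveVec k n) = waveVec k n := hid (waveVec k n)
    rw [h6] at h5
    filter_upwards [h5, ext_waveVec k n,
      measurePreserving_rot.quasiMeasurePreserving.ae (ext_waveVec k n)] with x e1 e2 e3
    rw [← planeWave_rot, ← e3, ← e2]
    exact e1.symm
  have h7 := ((continuous_planeWave _).ae_eq_iff_eq volume (continuous_planeWave _)).1 h4
  intro x
  have h8 := congrFun h7 x
  rw [sub_eq_add_neg, planeWave_add, h8, mul_comm, planeWave_neg_mul]

end NontrivialComponent

/-! ### Conclusion for both kinds of operators -/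

theorem IsRealSchrodinger.isAdmissible {H : PlaneOperator} (hH : IsRealSchrodinger H)
    (hΓ : ∀ m n : ℤ, H.Invariant (shift m n)) (hR : H.Invariant rot) (k₀ : Fin 2 → ℝ) :
    H.IsAdmissible k₀ := by
  cases hH with
  | continuous q hq hb => exact schrodinger_isAdmissible hq hb hΓ k₀
  | discrete G => exact EmbeddedGraph.isAdmissible hΓ hR k₀

theorem IsRealSchrodinger.isotypic_ne_bot {H : PlaneOperator} (hH : IsRealSchrodinger H)
    {k₀ : Fin 2 → ℝ} (hk₀ : IsRotationPoint k₀)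
    (h : (∃ G, H = discreteSchrodinger G) → H.isotypic k₀ 1 ≠ ⊥) : H.isotypic k₀ 1 ≠ ⊥ := by
  cases hH with
  | continuous q hq hb => exact schrodinger_isotypic_ne_bot q hk₀
  | discrete G => exact h ⟨G, rfl⟩

end Hexagonal

end

theorem theorem1 (H : Hexagonal.PlaneOperator) (hH : Hexagonal.IsRealSchrodinger H)
    (hΓ : ∀ m n : ℤ, H.Invariant (Hexagonal.shift m n))
    (hR : H.Invariant Hexagonal.rot)
    (hFV : H.Invariant Hexagonal.reflect ∨ H.Invariant Hexagonal.invert)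
    (k₀ : Fin 2 → ℝ)
    (hk₀ : k₀ = Hexagonal.kStar ∨ k₀ = -Hexagonal.kStar ∨ k₀ = 0) :
    -- the splitting into three self-adjoint operators
    (Hexagonal.IsOrthogonalSum (H.floquet k₀) (H.isotypic k₀) (H.Q k₀) ∧
      ∀ j, Hexagonal.SelfAdj (H.Q k₀ j)) ∧
    -- isospectrality, and the multiple eigenvalues
    (Hexagonal.Isospectral (H.Q k₀ 1) (H.Q k₀ 2) ∧
      (∀ z : ℂ, Hexagonal.eigenspace (H.Q k₀ 1) z ≠ ⊥ →
        2 ≤ Hexagonal.multiplicity (H.floquet k₀) z) ∧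
      (((∃ G, H = Hexagonal.discreteSchrodinger G) → H.isotypic k₀ 1 ≠ ⊥) →
        ∃ E : ℝ, Hexagonal.eigenspace (H.Q k₀ 1) E ≠ ⊥ ∧
          2 ≤ Hexagonal.multiplicity (H.floquet k₀) E)) ∧
    -- the dispersion relation at a double eigenvalue
    (∀ E₀ : ℝ, Hexagonal.multiplicity (H.floquet k₀) E₀ = 2 →
      ∃ (α : ℂ) (lm lp : (Fin 2 → ℝ) → ℝ), H.IsLocalDispersion k₀ E₀ lm lp ∧
        (fun k => (lp k - E₀) ^ 2 -
            ‖α‖ ^ 2 * ‖Hexagonal.kappa k - Hexagonal.kappa k₀‖ ^ 2) =o[𝓝 k₀]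
          (fun k => ‖Hexagonal.kappa k - Hexagonal.kappa k₀‖ ^ 2) ∧
        (fun k => (lm k - E₀) ^ 2 -
            ‖α‖ ^ 2 * ‖Hexagonal.kappa k - Hexagonal.kappa k₀‖ ^ 2) =o[𝓝 k₀]
          (fun k => ‖Hexagonal.kappa k - Hexagonal.kappa k₀‖ ^ 2) ∧
        (fun k => lp k - E₀ - ‖α‖ * ‖Hexagonal.kappa k - Hexagonal.kappa k₀‖) =o[𝓝 k₀]
          (fun k => ‖Hexagonal.kappa k - Hexagonal.kappa k₀‖) ∧
        (fun k => lm k - E₀ + ‖α‖ * ‖Hexagonal.kappa k - Hexagonal.kappa k₀‖) =o[𝓝 k₀]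
          (fun k => ‖Hexagonal.kappa k - Hexagonal.kappa k₀‖) ∧
        -- the coefficient vanishes at the origin
        (k₀ = 0 → α = 0)) := by
  have hk := Hexagonal.isRotationPoint_of_eq hk₀
  obtain ⟨hΓμ, hr, hmR, hmF, hmV, c, S, L, hS⟩ := hH.isAdmissible hΓ hR k₀
  obtain ⟨h1, h2, h3, h4⟩ := hS.decomposition hr hΓ hR hk hmR
    (hFV.imp (fun h => ⟨h, hmF h⟩) fun h => ⟨h, hmV h⟩)
  exact ⟨h1, ⟨h2, h3, fun h => h4 (hH.isotypic_ne_bot hk h)⟩,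
    fun E₀ hE => hS.dispersion hr hΓ hR hk hmR E₀ hE⟩
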